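/- Throughout, a variety over $\mathbb{R}$ is a reduced separated scheme of finite type over $\mathbb{R}$, and $X(\mathbb{R})$ denotes its set of real points with the analytic topology and its Borel $\sigma$-algebra. Let $X$ be a smooth variety over $\mathbb{R}$ (not necessarily irreducible or equidimensional). For a regular top differential form $\omega$ on an open subscheme $D\subset X$, let $|\omega|$ be the Borel measure on $D(\mathbb{R})$ which in every analytic chart $\Psi$ from an open $W\subset\mathbb{R}^n$ onto an open subset of $D(\mathbb{R})$, with $\Psi^*\omega=g\,dx_1\wedge\dots\wedge dx_n$, is given by $|g|\,dx_1\cdots dx_n$. A (positive) measure $\mu$ on $X(\mathbb{R})$ has continuous density if every point of $X(\mathbb{R})$ has a Zariski-open neighbourhood $D\subset X$ with a nowhere vanishing top form $\omega$ on $D$ and a continuous $g:D(\mathbb{R})\to[0,\infty)$ such that $\mu|_{D(\mathbb{R})}=g\,|\omega|$. It is compactly supported if there is a compact $K\subset X(\mathbb{R})$ such that $\mu(A)=0$ for every measurable $A$ with $A\cap K=\emptyset$. **Theorem.** Let $\varphi:X\to Y$ be a smooth morphism of smooth varieties over $\mathbb{R}$. 1. If $\mu$ is a compactly supported measure with continuous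 density on $X(\mathbb{R})$, then $\varphi_*\mu$ is a compactly supported measure with continuous density on $Y(\mathbb{R})$. 2. Let $\omega_X$ and $\omega_Y$ be regular top differential forms on $X$ and $Y$, with $\omega_Y$ nowhere vanishing. There is a unique relative top differential form $\eta=\frac{\omega_X}{\varphi^*\omega_Y}\in\Gamma(X,\Omega^{\mathrm{top}}_{X/Y})$ such that $\eta\otimes\varphi^*\omega_Y$ corresponds to $\omega_X$ under the isomorphism $\Omega^{\mathrm{top}}_{X/Y}\otimes\varphi^*\Omega^{\mathrm{top}}_Y\cong\Omega^{\mathrm{top}}_X$. Let $f:X(\mathbb{R})\to\mathbb{R}$ be continuous and compactly supported. Then $f$ is integrable with respect to $|\omega_X|$ and, for every $y\in Y(\mathbb{R})$, with respect to the measure $\bigl|\eta|_{\varphi^{-1}(y)}\bigr|$ on $\varphi^{-1}(y)(\mathbb{R})$. The signed measure $\varphi_*(f|\omega_X|)$ is absolutely continuous with respect to $|\omega_Y|$, and its density is the continuous, $|\omega_Y|$-integrable function $$y\longmapsto\int_{\varphi^{-1}(y)(\mathbb{R})}f\,\left|\frac{\omega_X}{\varphi^*\omega_Y}\Big|_{\varphi^{-1}(y)}\right|.$$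 -/

import Mathlib

open CategoryTheory AlgebraicGeometry MeasureTheory
open scoped NNReal ENNReal Topology

noncomputable section

namespace RealVar

section Algebra

/-- `k`-forms of the `R`-algebra `A`: the `k`-th exterior power of the Kähler differentials. -/
abbrev Form (R A : Type) [CommRing R] [CommRing A] [Algebra R A] (k : ℕ) : Type :=
  ⋀[A]^k Ω[A⁄R]

variable {R A R' A' : Type} [CommRing R] [CommRing A] [Algebra R A]
  [CommRing R'] [CommRing A'] [Algebra R' A']

/-- The pullback of forms `a₀ da₁ ∧ ⋯ ∧ daₖ ↦ h(a₀) dh(a₁) ∧ ⋯ ∧ dh(aₖ)` along a commutative square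
`g : R → R'`, `h : A → A'` of rings. -/
def Form.map (k : ℕ) (g : R →+* R') (h : A →+* A')
    (comm : ∀ r, h (algebraMap R A r) = algebraMap R' A' (g r)) :
    Form R A k → Form R' A' k :=
  letI : Algebra R R' := g.toAlgebra
  letI : Algebra A A' := h.toAlgebra
  letI : Algebra R A' := ((algebraMap R' A').comp g).toAlgebra
  haveI : IsScalarTower R A A' := IsScalarTower.of_algebraMap_eq fun r => (comm r).symm
  haveI : IsScalarTower R R' A' := IsScalarTower.of_algebraMap_eq fun _ => rfl
  haveI : SMulCommClass R' A A' :=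
    ⟨fun s a b => by simp only [Algebra.smul_def]; ring⟩
  letI : Module A (Form R' A' k) := Module.compHom _ h
  let f : Ω[A'⁄R'] [⋀^Fin k]→ₗ[A'] Form R' A' k := exteriorPower.ιMulti A' k
  let fA : Ω[A⁄R] [⋀^Fin k]→ₗ[A] Form R' A' k :=
    { toFun := fun m => f fun i => KaehlerDifferential.map R R' A A' (m i)
      map_update_add' := by
        intro _ m i x y
        have e : ∀ z, (fun j => KaehlerDifferential.map R R' A A' (Function.update m i z j)) =
            Function.update (fun j => KaehlerDifferential.map R R' A A' (m j)) i
              (KaehlerDifferential.map R R' A A' z) := by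
          intro z; ext j; by_cases hj : j = i
          · subst hj; simp
          · simp [hj]
        convert f.map_update_add (fun j => KaehlerDifferential.map R R' A A' (m j)) i
          (KaehlerDifferential.map R R' A A' x) (KaehlerDifferential.map R R' A A' y) using 1
        · rw [← map_add, ← e]
        · rw [← e, ← e]
      map_update_smul' := by
        intro _ m i a x
        have e : ∀ z, (fun j => KaehlerDifferential.map R R' A A' (Function.update m i z j)) =
            Function.update (fun j => KaehlerDifferential.map R R' A A' (m j)) i
              (KaehlerDifferential.map R R' A A' z) := by
          intro z; ext j; by_cases hj : j = i
          · subst hj; simp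
          · simp [hj]
        have hs : KaehlerDifferential.map R R' A A' (a • x) =
            h a • KaehlerDifferential.map R R' A A' x := by
          rw [map_smul, ← algebraMap_smul A' a]; rfl
        convert f.map_update_smul (fun j => KaehlerDifferential.map R R' A A' (m j)) i (h a)
          (KaehlerDifferential.map R R' A A' x) using 1
        · rw [← hs, ← e]
        · rw [← e]; congr!
      map_eq_zero_of_eq' := by
        intro m i j hij hne
        exact f.map_eq_zero_of_eq _ (by simp only [hij]) hne }
  exteriorPower.alternatingMapLinearEquiv fA

/-- `v : A → ℝ` is an `R`-linear tangent vector at the real point `ev` of `Spec A`, that is, a point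
derivation that kills `R`. -/
structure IsTangent (R : Type) {A : Type} [CommRing R] [CommRing A] [Algebra R A]
    (ev : A →+* ℝ) (v : A → ℝ) : Prop where
  add : ∀ a b, v (a + b) = v a + v b
  leibniz : ∀ a b, v (a * b) = ev a * v b + ev b * v a
  const : ∀ r, v (algebraMap R A r) = 0

/-- The value of a `k`-form at a real point `ev` on tangent vectors `v₁, …, vₖ`; it sends
`a₀ da₁ ∧ ⋯ ∧ daₖ` to `a₀(ev) · det (vⱼ(aᵢ))`. -/
def formEval {k : ℕ} (ev : A →+* ℝ) (v : Fin k → A → ℝ) (hv : ∀ j, IsTangent R ev (v j)) :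
    Form R A k → ℝ :=
  letI : Algebra A ℝ := ev.toAlgebra
  letI : Algebra R ℝ := (ev.comp (algebraMap R A)).toAlgebra
  haveI : IsScalarTower R A ℝ := IsScalarTower.of_algebraMap_eq fun _ => rfl
  let D : Fin k → Derivation R A ℝ := fun j =>
    Derivation.mk'
      { toFun := v j
        map_add' := (hv j).add
        map_smul' := fun r a => by
          rw [Algebra.smul_def, (hv j).leibniz, (hv j).const, mul_zero, add_zero]; rfl }
      (fun a b => (hv j).leibniz a b)
  let L : Ω[A⁄R] →ₗ[A] (Fin k → ℝ) := LinearMap.pi fun j => (D j).liftKaehlerDifferential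
  let det : (Fin k → ℝ) [⋀^Fin k]→ₗ[ℝ] ℝ := Matrix.detRowAlternating
  let detA : (Fin k → ℝ) [⋀^Fin k]→ₗ[A] ℝ :=
    { det.toMultilinearMap.restrictScalars A with
      map_eq_zero_of_eq' := fun m _ _ h hne => det.map_eq_zero_of_eq m h hne }
  exteriorPower.alternatingMapLinearEquiv (detA.compLinearMap L)

end Algebra

/-- Schemes over `ℝ`. -/
abbrev RScheme := Over (Spec (CommRingCat.of ℝ))

/-- `X(ℝ)`: the real points of `X`, that is, the sections of `X → Spec ℝ`. -/
def RealPoints (X : RScheme) : Type :=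
  (Over.mk (𝟙 (Spec (CommRingCat.of ℝ))) : RScheme) ⟶ X

/-- The ring `Γ(X, U)` of regular functions on `U`. -/
def Sec (X : RScheme) (U : X.left.Opens) : Type := Γ(X.left, U)

instance (X : RScheme) (U : X.left.Opens) : CommRing (Sec X U) :=
  inferInstanceAs (CommRing Γ(X.left, U))

/-- The structure map `ℝ → Γ(X, U)`. -/
def structureHom (X : RScheme) (U : X.left.Opens) : ℝ →+* Sec X U :=
  ((Scheme.ΓSpecIso (CommRingCat.of ℝ)).inv ≫ Scheme.Hom.appLE X.hom ⊤ U le_top).hom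

instance (X : RScheme) (U : X.left.Opens) : Algebra ℝ (Sec X U) := (structureHom X U).toAlgebra

/-- Restriction `Γ(X, U) → Γ(X, U')` for `U' ≤ U`. -/
def res (X : RScheme) {U U' : X.left.Opens} (h : U' ≤ U) : Sec X U →+* Sec X U' :=
  (X.left.presheaf.map (homOfLE h).op).hom

/-- The pullback of functions `φ^* : Γ(Y, V) → Γ(X, U)` for `U ≤ φ⁻¹ V`. -/
def pull {X Y : RScheme} (φ : X ⟶ Y) (V : Y.left.Opens) (U : X.left.Opens)
    (h : U ≤ φ.left ⁻¹ᵁ V) : Sec Y V →+* Sec X U :=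
  (φ.left.appLE V U h).hom

/-- `U(ℝ)` as a subset of `X(ℝ)`. -/
def onOpen (X : RScheme) (U : X.left.Opens) : Set (RealPoints X) :=
  {x | (⊤ : (Spec (CommRingCat.of ℝ)).Opens) ≤ Over.Hom.left x ⁻¹ᵁ U}

/-- Evaluation of regular functions at a real point of `U`. -/
def evalHom (X : RScheme) (U : X.left.Opens) (x : RealPoints X) (hx : x ∈ onOpen X U) :
    Sec X U →+* ℝ :=
  (Scheme.Hom.appLE (Y := X.left) (X := Spec (CommRingCat.of ℝ)) (Over.Hom.left x) U ⊤ hx ≫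
    (Scheme.ΓSpecIso (CommRingCat.of ℝ)).hom).hom

open Classical in
/-- The function `x ↦ a(x)` on `U(ℝ)`, with the value `0` outside `U(ℝ)`. -/
def evalAt (X : RScheme) {U : X.left.Opens} (a : Sec X U) (x : RealPoints X) : ℝ :=
  if hx : x ∈ onOpen X U then evalHom X U x hx a else 0

theorem evalAt_of_mem (X : RScheme) {U : X.left.Opens} (a : Sec X U) {x : RealPoints X}
    (hx : x ∈ onOpen X U) : evalAt X a x = evalHom X U x hx a := dif_pos hx

/-- The analytic topology on `X(ℝ)`: the coarsest one for which every `U(ℝ)` is open and every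
regular function on `U` is continuous on `U(ℝ)`. -/
instance (X : RScheme) : TopologicalSpace (RealPoints X) :=
  TopologicalSpace.generateFrom
    {S | ∃ (U : X.left.Opens) (a : Sec X U) (O : Set ℝ), IsOpen O ∧
      S = {x | x ∈ onOpen X U ∧ evalAt X a x ∈ O}}

instance (X : RScheme) : MeasurableSpace (RealPoints X) := borel _

instance (X : RScheme) : BorelSpace (RealPoints X) := ⟨rfl⟩

/-- The map `X(ℝ) → Y(ℝ)` induced by a morphism. -/
def realMap {X Y : RScheme} (φ : X ⟶ Y) (x : RealPoints X) : RealPoints Y :=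
  CategoryStruct.comp (obj := RScheme) x φ

/-- The real points of the fibre `φ⁻¹(y)`, as a subset of `X(ℝ)`. -/
def fibre {X Y : RScheme} (φ : X ⟶ Y) (y : RealPoints Y) : Set (RealPoints X) :=
  {x | realMap φ x = y}

theorem evalHom_structureHom (X : RScheme) (U : X.left.Opens) (x : RealPoints X)
    (hx : x ∈ onOpen X U) (r : ℝ) : evalHom X U x hx (algebraMap ℝ (Sec X U) r) = r := by
  have hw : Over.Hom.left x ≫ X.hom = 𝟙 (Spec (CommRingCat.of ℝ)) := Over.w x
  have key : (Scheme.ΓSpecIso (CommRingCat.of ℝ)).inv ≫ Scheme.Hom.appLE X.hom ⊤ U le_top ≫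
      Scheme.Hom.appLE (Y := X.left) (X := Spec (CommRingCat.of ℝ)) (Over.Hom.left x) U ⊤ hx ≫
      (Scheme.ΓSpecIso (CommRingCat.of ℝ)).hom = 𝟙 _ := by
    have h1 : Scheme.Hom.appLE X.hom ⊤ U le_top ≫
        Scheme.Hom.appLE (Y := X.left) (X := Spec (CommRingCat.of ℝ)) (Over.Hom.left x) U ⊤ hx =
        Scheme.Hom.appLE (Over.Hom.left x ≫ X.hom) ⊤ ⊤ le_top :=
      Scheme.Hom.appLE_comp_appLE _ _ _ _ _ _ _
    have h2 : Scheme.Hom.appLE (𝟙 (Spec (CommRingCat.of ℝ))) ⊤ ⊤ le_top = 𝟙 _ :=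
      (Scheme.Hom.app_eq_appLE _).symm.trans (Scheme.Hom.id_app _)
    rw [← Category.assoc (Scheme.Hom.appLE X.hom ⊤ U le_top), h1]
    simp only [hw]
    rw [h2, Category.id_comp, Iso.inv_hom_id]
  exact congrArg (fun f => f.hom r) key

theorem pull_structureHom {X Y : RScheme} (φ : X ⟶ Y) (V : Y.left.Opens) (U : X.left.Opens)
    (h : U ≤ φ.left ⁻¹ᵁ V) (r : ℝ) :
    pull φ V U h (algebraMap ℝ (Sec Y V) r) = algebraMap ℝ (Sec X U) r := by
  have hw : φ.left ≫ Y.hom = X.hom := Over.w φ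
  have key : Scheme.Hom.appLE Y.hom ⊤ V le_top ≫ φ.left.appLE V U h =
      Scheme.Hom.appLE X.hom ⊤ U le_top := by
    have h1 : Scheme.Hom.appLE Y.hom ⊤ V le_top ≫ φ.left.appLE V U h =
        Scheme.Hom.appLE (φ.left ≫ Y.hom) ⊤ U le_top := Scheme.Hom.appLE_comp_appLE _ _ _ _ _ _ _
    rw [h1]
    simp only [hw]
  exact congrArg (fun f => f.hom ((Scheme.ΓSpecIso (CommRingCat.of ℝ)).inv.hom r)) key

theorem res_structureHom (X : RScheme) {U U' : X.left.Opens} (h : U' ≤ U) (r : ℝ) :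
    res X h (algebraMap ℝ (Sec X U) r) = algebraMap ℝ (Sec X U') r := by
  have key : Scheme.Hom.appLE X.hom ⊤ U le_top ≫ X.left.presheaf.map (homOfLE h).op =
      Scheme.Hom.appLE X.hom ⊤ U' le_top := Scheme.Hom.appLE_map _ _ _
  exact congrArg (fun f => f.hom ((Scheme.ΓSpecIso (CommRingCat.of ℝ)).inv.hom r)) key

theorem res_pull {X Y : RScheme} (φ : X ⟶ Y) {V V' : Y.left.Opens} {U U' : X.left.Opens}
    (h : U ≤ φ.left ⁻¹ᵁ V) (h' : U' ≤ φ.left ⁻¹ᵁ V') (hV : V' ≤ V) (hU : U' ≤ U) (b : Sec Y V) :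
    res X hU (pull φ V U h b) = pull φ V' U' h' (res Y hV b) := by
  have key : φ.left.appLE V U h ≫ X.left.presheaf.map (homOfLE hU).op =
      Y.left.presheaf.map (homOfLE hV).op ≫ φ.left.appLE V' U' h' := by
    rw [Scheme.Hom.appLE_map, Scheme.Hom.map_appLE]
  exact congrArg (fun f => f.hom b) key

theorem realMap_mem_onOpen {X Y : RScheme} (φ : X ⟶ Y) (V : Y.left.Opens) (U : X.left.Opens)
    (h : U ≤ φ.left ⁻¹ᵁ V) {x : RealPoints X} (hx : x ∈ onOpen X U) :
    realMap φ x ∈ onOpen Y V :=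
  fun _ hp => h (hx hp)

theorem evalAt_pull {X Y : RScheme} (φ : X ⟶ Y) (V : Y.left.Opens) (U : X.left.Opens)
    (h : U ≤ φ.left ⁻¹ᵁ V) (b : Sec Y V) {x : RealPoints X} (hx : x ∈ onOpen X U) :
    evalAt X (pull φ V U h b) x = evalAt Y b (realMap φ x) := by
  rw [evalAt_of_mem _ _ hx, evalAt_of_mem _ _ (realMap_mem_onOpen φ V U h hx)]
  have key : φ.left.appLE V U h ≫
      Scheme.Hom.appLE (Y := X.left) (X := Spec (CommRingCat.of ℝ)) (Over.Hom.left x) U ⊤ hx =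
      Scheme.Hom.appLE (Y := Y.left) (X := Spec (CommRingCat.of ℝ))
        (Over.Hom.left (realMap φ x)) V ⊤ (realMap_mem_onOpen φ V U h hx) :=
    Scheme.Hom.appLE_comp_appLE _ _ _ _ _ _ _
  exact congrArg (fun f => (Scheme.ΓSpecIso (CommRingCat.of ℝ)).hom.hom (f.hom b)) key

/-- An analytic chart, with values in `ℝᵏ`, of the subset `F` of `X(ℝ)` inside `U(ℝ)`: a
homeomorphism between an open subset of `F ∩ U(ℝ)` and an open subset of `ℝᵏ` whose inverse `ψ` is
an analytic immersion. It is used for an affine open `U`, where the regular functions embed `U(ℝ)`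
into an affine space, and for a `k`-dimensional analytic submanifold `F ∩ U(ℝ)`. -/
structure Chart (X : RScheme) (F : Set (RealPoints X)) (U : X.left.Opens) (k : ℕ) where
  toChart : OpenPartialHomeomorph F (Fin k → ℝ)
  source_subset : ∀ x ∈ toChart.source, (x : RealPoints X) ∈ onOpen X U
  analytic : ∀ a : Sec X U,
    AnalyticOnNhd ℝ (fun w => evalAt X a (toChart.symm w)) toChart.target
  immersion : ∀ w ∈ toChart.target, ∀ v : Fin k → ℝ,
    (∀ a : Sec X U, fderiv ℝ (fun w => evalAt X a (toChart.symm w)) w v = 0) → v = 0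

namespace Chart

variable {X : RScheme} {F : Set (RealPoints X)} {U : X.left.Opens} {k : ℕ}

/-- The parametrization `ψ` of an open subset of `F`. -/
def param (c : Chart X F U k) (w : Fin k → ℝ) : RealPoints X := c.toChart.symm w

theorem param_mem (c : Chart X F U k) {w : Fin k → ℝ} (hw : w ∈ c.toChart.target) :
    c.param w ∈ onOpen X U :=
  c.source_subset _ (c.toChart.map_target hw)

/-- The coordinate tangent vector `∂/∂wⱼ` at `ψ(w)`, which sends a regular function `a` to
`∂(a ∘ ψ)/∂wⱼ (w)`. -/
def frame (c : Chart X F U k) (w : Fin k → ℝ) (j : Fin k) (a : Sec X U) : ℝ :=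
  fderiv ℝ (fun w => evalAt X a (c.param w)) w (Pi.single j 1)

theorem frame_isTangent (c : Chart X F U k) {R : Type} [CommRing R] [Algebra R (Sec X U)]
    (hR : ∀ r : R, ∃ t : ℝ, ∀ x ∈ F, x ∈ onOpen X U →
      evalAt X (algebraMap R (Sec X U) r) x = t)
    {w : Fin k → ℝ} (hw : w ∈ c.toChart.target) (j : Fin k) :
    IsTangent R (evalHom X U (c.param w) (c.param_mem hw)) (c.frame w j) := by
  have hd : ∀ a : Sec X U, DifferentiableAt ℝ (fun w => evalAt X a (c.param w)) w :=
    fun a => (c.analytic a w hw).differentiableAt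
  have hn : c.toChart.target ∈ 𝓝 w := c.toChart.open_target.mem_nhds hw
  refine ⟨fun a b => ?_, fun a b => ?_, fun r => ?_⟩
  · have : (fun w => evalAt X (a + b) (c.param w)) =ᶠ[𝓝 w]
        (fun w => evalAt X a (c.param w)) + fun w => evalAt X b (c.param w) := by
      filter_upwards [hn] with u hu
      simp [evalAt_of_mem X _ (c.param_mem hu)]
    simp only [frame]
    rw [this.fderiv_eq, fderiv_add (hd a) (hd b)]
    rfl
  · have : (fun w => evalAt X (a * b) (c.param w)) =ᶠ[𝓝 w]
        (fun w => evalAt X a (c.param w)) * fun w => evalAt X b (c.param w) := by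
      filter_upwards [hn] with u hu
      simp [evalAt_of_mem X _ (c.param_mem hu)]
    simp only [frame]
    rw [this.fderiv_eq, fderiv_mul (hd a) (hd b)]
    simp [evalAt_of_mem X _ (c.param_mem hw)]
  · obtain ⟨t, ht⟩ := hR r
    have : (fun w => evalAt X (algebraMap R (Sec X U) r) (c.param w)) =ᶠ[𝓝 w] fun _ => t := by
      filter_upwards [hn] with u hu
      exact ht _ (c.toChart.symm u).2 (c.param_mem hu)
    simp only [frame]
    rw [this.fderiv_eq]
    simp

open Classical in
/-- The coefficient `g` in `ψ^* θ = g dw₁ ∧ ⋯ ∧ dw_k`, for a `k`-form `θ` of `Γ(X, U)` over a ring `R`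
of functions that are constant on `F`. -/
def coeff (c : Chart X F U k) {R : Type} [CommRing R] [Algebra R (Sec X U)]
    (hR : ∀ r : R, ∃ t : ℝ, ∀ x ∈ F, x ∈ onOpen X U →
      evalAt X (algebraMap R (Sec X U) r) x = t)
    (θ : Form R (Sec X U) k) (w : Fin k → ℝ) : ℝ :=
  if hw : w ∈ c.toChart.target then
    formEval (evalHom X U (c.param w) (c.param_mem hw)) (c.frame w)
      (fun j => c.frame_isTangent hR hw j) θ
  else 0

/-- The measure `|θ|` on the domain of the chart: the image under `ψ` of `|g| dw₁ ⋯ dw_k`. -/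
def measure (c : Chart X F U k) {R : Type} [CommRing R] [Algebra R (Sec X U)]
    (hR : ∀ r : R, ∃ t : ℝ, ∀ x ∈ F, x ∈ onOpen X U →
      evalAt X (algebraMap R (Sec X U) r) x = t)
    (θ : Form R (Sec X U) k) : Measure (RealPoints X) :=
  Measure.map c.param
    ((volume.restrict c.toChart.target).withDensity fun w => ENNReal.ofReal |c.coeff hR θ w|)

end Chart

/-- A regular top differential form on the open subscheme `D` of the smooth `ℝ`-scheme `X`: a
compatible family of `n`-forms on the affine opens `U ≤ D` that are standard smooth of relative
dimension `n` over `ℝ`. These `U` are a basis of the topology of `D`, and `n` may vary with `U` if `X`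
is not equidimensional. -/
@[ext]
structure TopForm (X : RScheme) (D : X.left.Opens) where
  val : ∀ (U : X.left.Opens) (n : ℕ), IsAffineOpen U → U ≤ D →
    Algebra.IsStandardSmoothOfRelativeDimension n ℝ (Sec X U) → Form ℝ (Sec X U) n
  compat : ∀ (U U' : X.left.Opens) (n : ℕ) (hU : IsAffineOpen U) (hU' : IsAffineOpen U')
    (hD : U ≤ D) (h : U' ≤ U) (hn : Algebra.IsStandardSmoothOfRelativeDimension n ℝ (Sec X U))
    (hn' : Algebra.IsStandardSmoothOfRelativeDimension n ℝ (Sec X U')),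
    Form.map n (RingHom.id ℝ) (res X h) (res_structureHom X h) (val U n hU hD hn) =
      val U' n hU' (h.trans hD) hn'

namespace TopForm

variable {X : RScheme} {D : X.left.Opens}

/-- The form `ω` vanishes nowhere on `D`: it generates the line bundle of top forms. -/
def NowhereVanishing (ω : TopForm X D) : Prop :=
  ∀ (U : X.left.Opens) (n : ℕ) (hU : IsAffineOpen U) (hD : U ≤ D)
    (hn : Algebra.IsStandardSmoothOfRelativeDimension n ℝ (Sec X U)),
    Submodule.span (Sec X U) {ω.val U n hU hD hn} = ⊤

/-- The measure `|ω|`, as a measure on `X(ℝ)` that is concentrated on `D(ℝ)`: the measure glued from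
the measures `|g| dw₁ ⋯ dwₙ` in analytic charts of `X(ℝ)`. As these agree on overlaps, the glued
measure is their supremum, the least measure that dominates all of them. -/
def measure (ω : TopForm X D) : Measure (RealPoints X) :=
  ⨆ (U : X.left.Opens) (n : ℕ) (hU : IsAffineOpen U) (hD : U ≤ D)
    (hn : Algebra.IsStandardSmoothOfRelativeDimension n ℝ (Sec X U))
    (c : Chart X Set.univ U n),
    c.measure (R := ℝ)
      (fun r => ⟨r, fun x _ hx => by rw [evalAt_of_mem X _ hx, evalHom_structureHom]⟩)
      (ω.val U n hU hD hn)

end TopForm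

/-- Affine opens `V` of `Y` and `U` of `X` with `U ≤ φ⁻¹ V`, where `V` is standard smooth over `ℝ`. -/
structure RelPatch {X Y : RScheme} (φ : X ⟶ Y) where
  V : Y.left.Opens
  U : X.left.Opens
  affineV : IsAffineOpen V
  affineU : IsAffineOpen U
  le : U ≤ φ.left ⁻¹ᵁ V
  smoothV : ∃ m, Algebra.IsStandardSmoothOfRelativeDimension m ℝ (Sec Y V)

namespace RelPatch

variable {X Y : RScheme} {φ : X ⟶ Y}

/-- The ring `Γ(Y, V)`. -/
abbrev B (P : RelPatch φ) : Type := Sec Y P.V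

/-- The ring `Γ(X, U)`. -/
abbrev A (P : RelPatch φ) : Type := Sec X P.U

/-- The map `φ^* : Γ(Y, V) → Γ(X, U)`. -/
def hom (P : RelPatch φ) : P.B →+* P.A := pull φ P.V P.U P.le

instance (P : RelPatch φ) : Algebra P.B P.A := P.hom.toAlgebra

/-- `Γ(X, U)` is standard smooth of relative dimension `k` over `Γ(Y, V)`. -/
abbrev IsSmooth (P : RelPatch φ) (k : ℕ) : Prop :=
  Algebra.IsStandardSmoothOfRelativeDimension k P.B P.A

theorem const_on_fibre (P : RelPatch φ) (y : RealPoints Y) (b : P.B) :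
    ∃ t : ℝ, ∀ x ∈ fibre φ y, x ∈ onOpen X P.U → evalAt X (algebraMap P.B P.A b) x = t :=
  ⟨evalAt Y b y, fun x hx hxU => by
    rw [← show realMap φ x = y from hx]; exact evalAt_pull φ P.V P.U P.le b hxU⟩

end RelPatch

/-- A relative top differential form of the smooth morphism `φ`, that is, a global section of
`Ω^top_{X/Y}`: a compatible family of relative `k`-forms in `⋀ᵏ Ω[Γ(X, U)⁄Γ(Y, V)]`, where `Γ(X, U)` is
standard smooth of relative dimension `k` over `Γ(Y, V)`. -/
@[ext]
structure RelTopForm {X Y : RScheme} (φ : X ⟶ Y) where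
  val : ∀ (P : RelPatch φ) (k : ℕ), P.IsSmooth k → Form P.B P.A k
  compat : ∀ (P P' : RelPatch φ) (k : ℕ) (hV : P'.V ≤ P.V) (hU : P'.U ≤ P.U)
    (hk : P.IsSmooth k) (hk' : P'.IsSmooth k),
    Form.map k (res Y hV) (res X hU) (res_pull φ P.le P'.le hV hU) (val P k hk) = val P' k hk'

/-- The relative form `η` is `ω_X / φ^* ω_Y`: the isomorphism
`Ω^top_{X/Y} ⊗ φ^* Ω^top_Y ≅ Ω^top_X` sends `η ⊗ φ^* ω_Y` to `ω_X`. Locally, it sends `η ⊗ φ^* ω_Y` to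
`θ ∧ φ^* ω_Y` for any lift `θ` of `η` to a form over `ℝ`. -/
def IsQuotient {X Y : RScheme} (φ : X ⟶ Y) (ωX : TopForm X ⊤) (ωY : TopForm Y ⊤)
    (η : RelTopForm φ) : Prop :=
  ∀ (P : RelPatch φ) (k m : ℕ) (hk : P.IsSmooth k)
    (hm : Algebra.IsStandardSmoothOfRelativeDimension m ℝ P.B)
    (hkm : Algebra.IsStandardSmoothOfRelativeDimension (k + m) ℝ P.A),
    ∃ θ : Form ℝ P.A k,
      Form.map k (algebraMap ℝ P.B) (RingHom.id P.A)
        (fun r => (pull_structureHom φ P.V P.U P.le r).symm) θ = η.val P k hk ∧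
      (θ : ExteriorAlgebra P.A Ω[P.A⁄ℝ]) *
        (Form.map m (RingHom.id ℝ) P.hom (pull_structureHom φ P.V P.U P.le)
          (ωY.val P.V m P.affineV le_top hm) : ExteriorAlgebra P.A Ω[P.A⁄ℝ]) =
        (ωX.val P.U (k + m) P.affineU le_top hkm : ExteriorAlgebra P.A Ω[P.A⁄ℝ])

/-- The measure `|η|_{φ⁻¹(y)}|` of the restriction of the relative top form `η` to the fibre over `y`,
as a measure on `X(ℝ)` that is concentrated on `φ⁻¹(y)(ℝ)`: the measure glued from the measures
`|g| dw₁ ⋯ dw_k` in analytic charts of `φ⁻¹(y)(ℝ)`. -/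
def RelTopForm.fibreMeasure {X Y : RScheme} {φ : X ⟶ Y} (η : RelTopForm φ) (y : RealPoints Y) :
    Measure (RealPoints X) :=
  ⨆ (P : RelPatch φ) (k : ℕ) (hk : P.IsSmooth k) (c : Chart X (fibre φ y) P.U k),
    c.measure (P.const_on_fibre y) (η.val P k hk)

/-- The measure `μ` on `X(ℝ)` has continuous density: locally in the Zariski topology, it has a
continuous density with respect to `|ω|` for a nowhere vanishing top form `ω`. -/
def HasContinuousDensity (X : RScheme) (μ : Measure (RealPoints X)) : Prop :=
  ∀ x : RealPoints X, ∃ D : X.left.Opens, x ∈ onOpen X D ∧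
    ∃ ω : TopForm X D, ω.NowhereVanishing ∧
      ∃ g : RealPoints X → ℝ≥0, ContinuousOn g (onOpen X D) ∧
        μ.restrict (onOpen X D) = ω.measure.withDensity fun x => (g x : ℝ≥0∞)

/-- The measure `μ` is compactly supported: it vanishes on the sets disjoint from a compact `K`. -/
def IsCompactlySupported {T : Type} [TopologicalSpace T] [MeasurableSpace T]
    (μ : Measure T) : Prop :=
  ∃ K : Set T, IsCompact K ∧ ∀ S : Set T, MeasurableSet S → Disjoint S K → μ S = 0

end RealVar

end

/-! In suitable analytic coordinates a smooth morphism is a projection of a box, and there the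
theorem is Fubini's theorem.

Algebra. Let `Γ(X, U)` be standard smooth over `Γ(Y, V)`, and `Γ(Y, V)` over `ℝ`. The free variables
`x` of the first presentation and the free variables `y` of the second give a basis `dx, dy` of the
differentials of `Γ(X, U)` over `ℝ` (`exists_adapted_basis`). A generator of the top forms of the
base has `dy₁ ∧ ⋯ ∧ dyₘ` as a multiple, so each top form of `X` is `θ ∧ φ^* ω_Y` with `θ` a multiple
of `dx₁ ∧ ⋯ ∧ dxₖ` (`exists_wedge_eq`). The lift `θ` is unique up to terms that contain some `dy`,
and these die in the relative forms (`map_eq_of_wedge_eq`). Uniqueness makes the local quotients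
compatible, so `η` exists and is unique.

Geometry. The real points of a standard smooth affine open are the zeros of its relations, a
submanifold by the analytic inverse function theorem (`exists_chart_of_isStandardSmooth`). The same
theorem, applied to the functions `x` together with the pulled back coordinates of `Y`, yields boxes
`S × T` in which `φ` is the projection to `T` (`exists_box`); their slices are charts of the fibres
(`Box.exists_slice`).

Measures. Coefficients of a form in two charts differ by the Jacobian determinant, so the chart
measures agree on overlaps. By second countability they glue along a countable disjoint cover, and
their supremum restricts to each of them (`iSup_measure_inter`).

Integration. In a box the coefficient of `ω_X` at `(s, t)` is the coefficient of `η` on the slice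
times that of `ω_Y` at `t`, by a block triangular determinant (`Box.coeff_mul`). For `f` supported
in the box, integration over `S` therefore gives the fibre integral times `|ω_Y|` (`Box.push_eq`),
continuously in `t`. A partition of unity reduces a general `f` to this case; it needs `X(ℝ)` to be
Hausdorff, which comes from separatedness (`t2_realPoints`), and locally compact, which comes from
the charts.

For push-forwards of measures with continuous density, the same partition writes `μ` as a finite sum
of measures `fᵢ |ωᵢ|` supported in boxes, and each of these has a continuous density on an affine
open of `Y` (`Box.exists_density_push`). -/

noncomputable section

namespace RealVar

/-! ### Determinants as linear forms on exterior powers. -/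

section DetForm

variable {A S M : Type*} [CommRing A] [CommRing S] [Algebra A S] [AddCommGroup M] [Module A M]

/-- The determinant as an `A`-multilinear alternating map, for an `A`-algebra `S`. -/
def detAlternating (A S : Type*) [CommRing A] [CommRing S] [Algebra A S] (k : ℕ) :
    (Fin k → S) [⋀^Fin k]→ₗ[A] S :=
  { (Matrix.detRowAlternating (R := S) (n := Fin k)).toMultilinearMap.restrictScalars A with
    map_eq_zero_of_eq' := fun m _ _ h hne =>
      (Matrix.detRowAlternating (R := S) (n := Fin k)).map_eq_zero_of_eq m h hne }

/-- The linear form `x₁ ∧ ⋯ ∧ xₖ ↦ det (Lⱼ(xᵢ))` on an exterior power. -/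
def detForm {k : ℕ} (L : M →ₗ[A] (Fin k → S)) : ⋀[A]^k M →ₗ[A] S :=
  exteriorPower.alternatingMapLinearEquiv ((detAlternating A S k).compLinearMap L)

theorem detForm_ι {k : ℕ} (L : M →ₗ[A] (Fin k → S)) (x : Fin k → M) :
    detForm L (exteriorPower.ιMulti A k x) = Matrix.det (Matrix.of fun i j => L (x i) j) := by
  rw [detForm, exteriorPower.alternatingMapLinearEquiv_apply_ιMulti]
  rfl

/-- By linearity both factors may be taken to be pure wedges. The vectors of `β` are killed by the
first `k` components of `L`, so the matrix of `L` on all `k + m` vectors is block triangular and its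
determinant is a product. -/
theorem detForm_wedge {k m : ℕ} (L : M →ₗ[A] (Fin (k + m) → S)) (L₁ : M →ₗ[A] (Fin k → S))
    (L₂ : M →ₗ[A] (Fin m → S)) (h₁ : ∀ x i, L₁ x i = L x (Fin.castAdd m i))
    (h₂ : ∀ x j, L₂ x j = L x (Fin.natAdd k j))
    (θ : ⋀[A]^k M) (β : ⋀[A]^m M)
    (hβ : β ∈ Submodule.span A (exteriorPower.ιMulti A m '' {y | ∀ j, L₁ (y j) = 0}))
    (ω : ⋀[A]^(k + m) M)
    (h : (θ : ExteriorAlgebra A M) * (β : ExteriorAlgebra A M) = (ω : ExteriorAlgebra A M)) :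
    detForm L ω = detForm L₁ θ * detForm L₂ β := by
  classical
  -- The product `θ * β` lives in the whole exterior algebra, so the determinant form is extended
  -- there, by zero in the degrees other than `k + m`.
  let Λ : ExteriorAlgebra A M →ₗ[A] S := ExteriorAlgebra.liftAlternating fun i =>
    if hi : i = k + m then
      ((detAlternating A S (k + m)).compLinearMap L).domDomCongr (finCongr hi.symm) else 0
  have hΛ : ∀ x : Fin (k + m) → M, Λ (ExteriorAlgebra.ιMulti A (k + m) x) =
      Matrix.det (Matrix.of fun i j => L (x i) j) := by
    intro x
    simp only [Λ, ExteriorAlgebra.liftAlternating_apply_ιMulti]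
    rfl
  have hω : ∀ ω : ⋀[A]^(k + m) M, Λ ω = detForm L ω := by
    intro ω
    have : Λ ∘ₗ (⋀[A]^(k + m) M).subtype = detForm L := by
      apply exteriorPower.linearMap_ext
      ext x
      simp only [LinearMap.compAlternatingMap_apply, LinearMap.comp_apply, detForm_ι]
      exact hΛ x
    exact LinearMap.congr_fun this ω
  rw [← hω, ← h]
  clear h ω
  induction hβ using Submodule.span_induction with
  | zero => simp
  | add x y _ _ hx hy => simp only [Submodule.coe_add, mul_add, map_add, hx, hy]
  | smul a x _ hx =>
    simp only [Submodule.coe_smul, mul_smul_comm, map_smul, hx]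
  | mem β hβ =>
    obtain ⟨y, hy, rfl⟩ := hβ
    have hθ : θ ∈ (⊤ : Submodule A (⋀[A]^k M)) := trivial
    rw [← exteriorPower.ιMulti_span] at hθ
    induction hθ using Submodule.span_induction with
    | zero => simp
    | add x y _ _ hx hy => simp only [Submodule.coe_add, add_mul, map_add, hx, hy]
    | smul a x _ hx =>
      simp only [Submodule.coe_smul, smul_mul_assoc, map_smul, hx]
    | mem θ hθ =>
      obtain ⟨x, rfl⟩ := hθ
      rw [exteriorPower.ιMulti_apply_coe, exteriorPower.ιMulti_apply_coe,
        ExteriorAlgebra.ιMulti_mul_ιMulti, hΛ, detForm_ι, detForm_ι,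
        ← Matrix.det_reindex_self finSumFinEquiv.symm, ← Matrix.det_fromBlocks_zero₂₁ _
          (Matrix.of fun i j => L (x i) (Fin.natAdd k j))]
      congr 1
      ext i j
      rcases i with i | i <;> rcases j with j | j <;>
        simp [h₁, h₂]
      simpa [h₁] using congrFun (hy i) j

theorem detForm_basis {n : ℕ} (b : Module.Basis (Fin n) A M) :
    detForm (b.equivFun : M →ₗ[A] (Fin n → A)) (exteriorPower.ιMulti A n b) = 1 := by
  rw [detForm_ι, ← Matrix.det_one (n := Fin n)]
  congr 1
  ext i j
  simp [Matrix.one_apply]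

/-- A top form is determined by its value on a basis. -/
theorem topForm_eq_smul {n : ℕ} (b : Module.Basis (Fin n) A M) (ω : ⋀[A]^n M) :
    ω = detForm (b.equivFun : M →ₗ[A] (Fin n → A)) ω • exteriorPower.ιMulti A n b := by
  have : LinearMap.id = (detForm (b.equivFun : M →ₗ[A] (Fin n → A))).smulRight
      (exteriorPower.ιMulti A n b) := by
    apply exteriorPower.linearMap_ext
    -- Only injective families of basis vectors need checking; `n` of them form a permutation of the
    -- basis, and both sides change by its sign.
    refine Module.Basis.ext_alternating b fun v hv => ?_
    have hb : Function.Bijective v := Finite.injective_iff_bijective.1 hv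
    let σ := Equiv.ofBijective v hb
    simp only [LinearMap.compAlternatingMap_apply, LinearMap.smulRight_apply, LinearMap.id_apply]
    have e : ∀ f : M [⋀^Fin n]→ₗ[A] ⋀[A]^n M, f (fun i => b (v i)) = Equiv.Perm.sign σ • f b :=
      fun f => f.map_perm b σ
    rw [e, Units.smul_def, map_zsmul, detForm_basis, smul_assoc, one_smul]
  exact LinearMap.congr_fun this ω

end DetForm

/-! ### Functoriality of forms and their values on tangent vectors. -/

section Algebra

variable {R A R' A' : Type} [CommRing R] [CommRing A] [Algebra R A]
  [CommRing R'] [CommRing A'] [Algebra R' A']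

/-- Every form is a sum of forms `a₀ da₁ ∧ ⋯ ∧ daₖ`. -/
theorem Form.induction {k : ℕ} {p : Form R A k → Prop} (zero : p 0)
    (add : ∀ x y, p x → p y → p (x + y)) (smul : ∀ (a : A) x, p x → p (a • x))
    (ι : ∀ a : Fin k → A, p (exteriorPower.ιMulti A k fun i => KaehlerDifferential.D R A (a i)))
    (x : Form R A k) : p x := by
  have h := exteriorPower.ιMulti_span_of_span A k Ω[A⁄R]
    (KaehlerDifferential.span_range_derivation R A)
  have hx : x ∈ (⊤ : Submodule A (Form R A k)) := trivial
  rw [← h] at hx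
  induction hx using Submodule.span_induction with
  | mem x hx =>
    obtain ⟨m, hm, rfl⟩ := hx
    choose a ha using fun i => hm ⟨i, rfl⟩
    simpa only [ha] using ι a
  | zero => exact zero
  | add x y _ _ hx hy => exact add x y hx hy
  | smul a x _ hx => exact smul a x hx

namespace Form

variable {k : ℕ} {g : R →+* R'} {h : A →+* A'}
  (comm : ∀ r, h (algebraMap R A r) = algebraMap R' A' (g r))

theorem map_add (x y : Form R A k) :
    Form.map k g h comm (x + y) = Form.map k g h comm x + Form.map k g h comm y := by
  unfold Form.map
  exact _root_.map_add _ _ _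

theorem map_zero : Form.map k g h comm 0 = 0 := by
  unfold Form.map
  exact _root_.map_zero _

theorem map_smul (a : A) (x : Form R A k) :
    Form.map k g h comm (a • x) = h a • Form.map k g h comm x := by
  unfold Form.map
  let : Module A (Form R' A' k) := Module.compHom _ h
  exact LinearMap.map_smul (R := A) (M₂ := Form R' A' k) _ a x

theorem map_ι (a : Fin k → A) :
    Form.map k g h comm (exteriorPower.ιMulti A k fun i => KaehlerDifferential.D R A (a i)) =
      exteriorPower.ιMulti A' k fun i => KaehlerDifferential.D R' A' (h (a i)) := by
  unfold Form.map
  let : Algebra R R' := g.toAlgebra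
  let : Algebra A A' := h.toAlgebra
  let : Algebra R A' := ((algebraMap R' A').comp g).toAlgebra
  have : IsScalarTower R A A' := IsScalarTower.of_algebraMap_eq fun r => (comm r).symm
  have : IsScalarTower R R' A' := IsScalarTower.of_algebraMap_eq fun _ => rfl
  have : SMulCommClass R' A A' :=
    ⟨fun s a b => by simp only [Algebra.smul_def]; ring⟩
  let : Module A (Form R' A' k) := Module.compHom _ h
  refine (exteriorPower.alternatingMapLinearEquiv_apply_ιMulti (R := A) (N := Form R' A' k)
    _ _).trans ?_
  refine congrArg (exteriorPower.ιMulti A' k) (funext fun i => ?_)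
  exact KaehlerDifferential.map_D R R' A A' (a i)

theorem map_map {R'' A'' : Type} [CommRing R''] [CommRing A''] [Algebra R'' A'']
    {g' : R' →+* R''} {h' : A' →+* A''}
    (comm' : ∀ r, h' (algebraMap R' A' r) = algebraMap R'' A'' (g' r))
    {g'' : R →+* R''} {h'' : A →+* A''}
    (comm'' : ∀ r, h'' (algebraMap R A r) = algebraMap R'' A'' (g'' r))
    (hh : ∀ a, h'' a = h' (h a)) (x : Form R A k) :
    Form.map k g' h' comm' (Form.map k g h comm x) = Form.map k g'' h'' comm'' x := by
  induction x using Form.induction with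
  | zero => simp only [map_zero]
  | add x y hx hy => simp only [map_add, hx, hy]
  | smul a x hx => simp only [map_smul, hx, hh]
  | ι a => simp only [map_ι, hh]

end Form

section Eval

variable {k : ℕ} (ev : A →+* ℝ) (v : Fin k → A → ℝ) (hv : ∀ j, IsTangent R ev (v j))

theorem formEval_add (x y : Form R A k) :
    formEval ev v hv (x + y) = formEval ev v hv x + formEval ev v hv y := by
  unfold formEval
  exact map_add _ _ _

theorem formEval_zero : formEval ev v hv 0 = 0 := by
  unfold formEval
  exact map_zero _

theorem formEval_smul (a : A) (x : Form R A k) :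
    formEval ev v hv (a • x) = ev a * formEval ev v hv x := by
  unfold formEval
  let : Algebra A ℝ := ev.toAlgebra
  exact LinearMap.map_smul (R := A) (M₂ := ℝ) _ a x

theorem formEval_ι (a : Fin k → A) :
    formEval ev v hv (exteriorPower.ιMulti A k fun i => KaehlerDifferential.D R A (a i)) =
      Matrix.det (Matrix.of fun i j => v j (a i)) := by
  unfold formEval
  let : Algebra A ℝ := ev.toAlgebra
  let : Algebra R ℝ := (ev.comp (algebraMap R A)).toAlgebra
  have : IsScalarTower R A ℝ := IsScalarTower.of_algebraMap_eq fun _ => rfl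
  refine (exteriorPower.alternatingMapLinearEquiv_apply_ιMulti (R := A) (N := ℝ) _ _).trans ?_
  refine congrArg Matrix.det ?_
  ext i j
  exact Derivation.liftKaehlerDifferential_comp_D _ _

theorem formEval_congr {ev' : A →+* ℝ} {v' : Fin k → A → ℝ}
    (hv' : ∀ j, IsTangent R ev' (v' j)) (h : ev = ev') (h' : v = v') (x : Form R A k) :
    formEval ev v hv x = formEval ev' v' hv' x := by
  subst h h'; rfl

theorem formEval_map {g : R →+* R'} {h : A →+* A'}
    (comm : ∀ r, h (algebraMap R A r) = algebraMap R' A' (g r))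
    (ev' : A' →+* ℝ) (v' : Fin k → A' → ℝ) (hv' : ∀ j, IsTangent R' ev' (v' j))
    (hev : ∀ a, ev a = ev' (h a)) (hvv : ∀ j a, v j a = v' j (h a)) (x : Form R A k) :
    formEval ev' v' hv' (Form.map k g h comm x) = formEval ev v hv x := by
  induction x using Form.induction with
  | zero => simp only [Form.map_zero, formEval_zero]
  | add x y hx hy => simp only [Form.map_add, formEval_add, hx, hy]
  | smul a x hx => simp only [Form.map_smul, formEval_smul, hx, hev]
  | ι a => simp only [Form.map_ι, formEval_ι, hvv]

/-- Multiplicativity of the determinant on forms `da₁ ∧ ⋯ ∧ daₖ`. This is the algebraic source of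
the Jacobian factor between charts. -/
theorem formEval_linear_comb (c : Matrix (Fin k) (Fin k) ℝ) {v' : Fin k → A → ℝ}
    (hv' : ∀ j, IsTangent R ev (v' j)) (h : ∀ j a, v' j a = ∑ i, v i a * c i j) (x : Form R A k) :
    formEval ev v' hv' x = formEval ev v hv x * c.det := by
  induction x using Form.induction with
  | zero => simp only [formEval_zero, zero_mul]
  | add x y hx hy => simp only [formEval_add, hx, hy, add_mul]
  | smul a x hx => simp only [formEval_smul, hx, mul_assoc]
  | ι a =>
    rw [formEval_ι, formEval_ι, ← Matrix.det_mul]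
    congr 1
    ext i j
    simp [Matrix.mul_apply, h]

end Eval

/-- A wedge product with the pullback of a form is evaluated on vectors adapted to the pullback as a
product. -/
theorem formEval_wedge {k m : ℕ} {g : R' →+* R} {h : A' →+* A}
    (comm : ∀ r, h (algebraMap R' A' r) = algebraMap R A (g r))
    (ev : A →+* ℝ) (v : Fin (k + m) → A → ℝ) (hv : ∀ j, IsTangent R ev (v j))
    (hz : ∀ i a, v (Fin.castAdd m i) (h a) = 0)
    (θ : Form R A k) (β : Form R' A' m) (ω : Form R A (k + m))
    (hω : (θ : ExteriorAlgebra A Ω[A⁄R]) *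
      (Form.map m g h comm β : ExteriorAlgebra A Ω[A⁄R]) = (ω : ExteriorAlgebra A Ω[A⁄R])) :
    formEval ev v hv ω = formEval ev (fun i => v (Fin.castAdd m i)) (fun _ => hv _) θ *
      formEval ev (fun j => v (Fin.natAdd k j)) (fun _ => hv _) (Form.map m g h comm β) := by
  let : Algebra A ℝ := ev.toAlgebra
  let : Algebra R ℝ := (ev.comp (algebraMap R A)).toAlgebra
  have : IsScalarTower R A ℝ := IsScalarTower.of_algebraMap_eq fun _ => rfl
  let D : Fin (k + m) → Derivation R A ℝ := fun j =>
    Derivation.mk'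
      { toFun := v j
        map_add' := (hv j).add
        map_smul' := fun r a => by
          rw [Algebra.smul_def, (hv j).leibniz, (hv j).const, mul_zero, add_zero]; rfl }
      (fun a b => (hv j).leibniz a b)
  have hD : ∀ j a, (D j).liftKaehlerDifferential (KaehlerDifferential.D R A a) = v j a :=
    fun j a => Derivation.liftKaehlerDifferential_comp_D _ _
  refine detForm_wedge (A := A) (S := ℝ) (M := Ω[A⁄R])
    (LinearMap.pi fun j => (D j).liftKaehlerDifferential)
    (LinearMap.pi fun i => (D (Fin.castAdd m i)).liftKaehlerDifferential)
    (LinearMap.pi fun j => (D (Fin.natAdd k j)).liftKaehlerDifferential)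
    (fun _ _ => rfl) (fun _ _ => rfl) θ _ ?_ ω hω
  clear hω
  induction β using Form.induction with
  | zero => rw [Form.map_zero]; exact Submodule.zero_mem _
  | add x y hx hy => rw [Form.map_add]; exact Submodule.add_mem _ hx hy
  | smul a x hx => rw [Form.map_smul]; exact Submodule.smul_mem _ _ hx
  | ι a =>
    rw [Form.map_ι]
    -- The pullback is a wedge of differentials `d(h a)`, and the first `k` tangent vectors vanish
    -- on the image of `h`.
    refine Submodule.subset_span ⟨_, fun j => ?_, rfl⟩
    ext i
    simp [hD, hz]

end Algebra
end RealVar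

namespace RealVar

/-! ### Kähler bases of standard smooth algebras, and division of top forms. -/

section Algebra

/-- The variables outside the range of `P.map` are the free ones: the Jacobian of the relations in
the remaining variables is invertible, so the differentials of the free variables form a basis.
There are as many as the dimension of the presentation. -/
theorem exists_basis_kaehlerDifferential {R A : Type} [CommRing R] [CommRing A] [Algebra R A]
    {n : ℕ} (h : Algebra.IsStandardSmoothOfRelativeDimension n R A) :
    ∃ (x : Fin n → A) (b : Module.Basis (Fin n) A Ω[A⁄R]),
      ∀ i, b i = KaehlerDifferential.D R A (x i) := by
  obtain ⟨ι, σ, _, _, P, hP⟩ := h.out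
  have hc : Nat.card ((Set.range P.map)ᶜ : Set ι) = n := by
    rw [Nat.card_coe_set_eq, Set.ncard_compl, Set.ncard_range_of_injective P.map_inj, ← hP,
      Algebra.Presentation.dimension]
  let e := Finite.equivFinOfCardEq hc
  exact ⟨fun i => P.val (e.symm i), P.basisKaehler.reindex e, fun i => by simp⟩

/-- The composite of two submersive presentations has as free variables those of `A` over `B`
together with those of `B` over `R`. This is the splitting of `A ⊗ Ω[B⁄R] → Ω[A⁄R] → Ω[A⁄B]` in
explicit coordinates. -/
theorem exists_adapted_basis (R B A : Type) [CommRing R] [CommRing B] [CommRing A]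
    [Algebra R B] [Algebra B A] [Algebra R A] [IsScalarTower R B A] {k m : ℕ}
    (hk : Algebra.IsStandardSmoothOfRelativeDimension k B A)
    (hm : Algebra.IsStandardSmoothOfRelativeDimension m R B) :
    ∃ (x : Fin k → A) (y : Fin m → B) (b₁ : Module.Basis (Fin k) A Ω[A⁄B])
      (b₂ : Module.Basis (Fin m) B Ω[B⁄R]) (b : Module.Basis (Fin (k + m)) A Ω[A⁄R]),
      (∀ i, b₁ i = KaehlerDifferential.D B A (x i)) ∧
      (∀ i, b₂ i = KaehlerDifferential.D R B (y i)) ∧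
      (∀ i, b (Fin.castAdd m i) = KaehlerDifferential.D R A (x i)) ∧
      ∀ i, b (Fin.natAdd k i) = KaehlerDifferential.D R A (algebraMap B A (y i)) := by
  obtain ⟨ι, σ, _, _, P, hP⟩ := hk.out
  obtain ⟨ι', σ', _, _, Q, hQ⟩ := hm.out
  have hc : Nat.card ((Set.range P.map)ᶜ : Set ι) = k := by
    rw [Nat.card_coe_set_eq, Set.ncard_compl, Set.ncard_range_of_injective P.map_inj, ← hP,
      Algebra.Presentation.dimension]
  have hc' : Nat.card ((Set.range Q.map)ᶜ : Set ι') = m := by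
    rw [Nat.card_coe_set_eq, Set.ncard_compl, Set.ncard_range_of_injective Q.map_inj, ← hQ,
      Algebra.Presentation.dimension]
  let e := Finite.equivFinOfCardEq hc
  let e' := Finite.equivFinOfCardEq hc'
  let f : Fin k ⊕ Fin m → ι ⊕ ι' := Sum.map (fun i => (e.symm i : ι)) (fun i => (e'.symm i : ι'))
  have hf : Function.Injective f :=
    (Subtype.val_injective.comp e.symm.injective).sumMap
      (Subtype.val_injective.comp e'.symm.injective)
  have hmap : (P.comp Q).map = Sum.map P.map Q.map := by
    ext i; rcases i with i | i <;> rfl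
  have hcompl : IsCompl (Set.range f) (Set.range (P.comp Q).map) := by
    have : Set.range f = (Set.range (P.comp Q).map)ᶜ := by
      rw [hmap]
      ext i
      rcases i with i | i
      · simp only [f, Set.mem_range, Sum.exists, Sum.map_inl, Sum.map_inr, Sum.inl.injEq,
          reduceCtorEq, exists_false, or_false, Set.mem_compl_iff]
        constructor
        · rintro ⟨j, rfl⟩
          exact (e.symm j).2
        · intro hi
          exact ⟨e ⟨i, hi⟩, by simp⟩
      · simp only [f, Set.mem_range, Sum.exists, Sum.map_inl, Sum.map_inr, Sum.inr.injEq,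
          reduceCtorEq, exists_false, false_or, Set.mem_compl_iff]
        constructor
        · rintro ⟨j, rfl⟩
          exact (e'.symm j).2
        · intro hi
          exact ⟨e' ⟨i, hi⟩, by simp⟩
    rw [this]
    exact isCompl_compl.symm
  refine ⟨fun i => P.val (e.symm i), fun i => Q.val (e'.symm i), P.basisKaehler.reindex e,
    Q.basisKaehler.reindex e',
    ((P.comp Q).basisKaehlerOfIsCompl hf hcompl).reindex finSumFinEquiv,
    fun i => by simp, fun i => by simp, fun i => ?_, fun i => ?_⟩
  · rw [Module.Basis.reindex_apply, finSumFinEquiv_symm_apply_castAdd,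
      Algebra.SubmersivePresentation.basisKaehlerOfIsCompl_apply]
    rfl
  · rw [Module.Basis.reindex_apply, finSumFinEquiv_symm_apply_natAdd,
      Algebra.SubmersivePresentation.basisKaehlerOfIsCompl_apply]
    rfl

theorem relativeDimension_unique {R A : Type} [CommRing R] [CommRing A] [Algebra R A] [Nontrivial A]
    {n n' : ℕ} (h : Algebra.IsStandardSmoothOfRelativeDimension n R A)
    (h' : Algebra.IsStandardSmoothOfRelativeDimension n' R A) : n = n' := by
  obtain ⟨_, b, _⟩ := exists_basis_kaehlerDifferential h
  obtain ⟨_, b', _⟩ := exists_basis_kaehlerDifferential h'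
  simpa using Fintype.card_congr (b.indexEquiv b')

/-- A form that spans the top forms is a unit times any given generator. -/
theorem exists_smul_eq_of_span_eq_top {B M : Type*} [CommRing B] [AddCommGroup M] [Module B M]
    {m : ℕ} {ω : ⋀[B]^m M} (h : Submodule.span B {ω} = ⊤) (x : ⋀[B]^m M) : ∃ c : B, c • ω = x :=
  Submodule.mem_span_singleton.1 (h ▸ Submodule.mem_top)

section Quotient

variable {R B A : Type} [CommRing R] [CommRing B] [CommRing A]
    [Algebra R B] [Algebra B A] [Algebra R A] [IsScalarTower R B A] {k m : ℕ}
    (hk : Algebra.IsStandardSmoothOfRelativeDimension k B A)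
    (hm : Algebra.IsStandardSmoothOfRelativeDimension m R B)
    {ωB : Form R B m} (hB : Submodule.span B {ωB} = ⊤)
    (comm : ∀ r, algebraMap B A (algebraMap R B r) = algebraMap R A (RingHom.id R r))
    (comm' : ∀ r, RingHom.id A (algebraMap R A r) = algebraMap B A (algebraMap R B r))

include hk hm hB in
-- In an adapted basis `ω = u dx ∧ dy` and `dy = c ω_B` for some `c` in `B`, so `θ = u c dx` works.
theorem exists_wedge_eq (ω : Form R A (k + m)) :
    ∃ θ : Form R A k, (θ : ExteriorAlgebra A Ω[A⁄R]) *
      (Form.map m (RingHom.id R) (algebraMap B A) comm ωB : ExteriorAlgebra A Ω[A⁄R]) =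
        (ω : ExteriorAlgebra A Ω[A⁄R]) := by
  obtain ⟨x, y, b₁, b₂, b, h₁, h₂, h₃, h₄⟩ := exists_adapted_basis R B A hk hm
  obtain ⟨c, hc⟩ := exists_smul_eq_of_span_eq_top hB (exteriorPower.ιMulti B m b₂)
  refine ⟨(detForm (b.equivFun : _ →ₗ[A] (Fin (k + m) → A)) ω * algebraMap B A c) •
    exteriorPower.ιMulti A k (fun i => b (Fin.castAdd m i)), ?_⟩
  conv_rhs => rw [topForm_eq_smul b ω]
  have e : b = Fin.append (fun i => b (Fin.castAdd m i)) (fun i => b (Fin.natAdd k i)) := by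
    ext i; refine Fin.addCases (fun i => ?_) (fun i => ?_) i <;> simp
  have e2 : algebraMap B A c • Form.map m (RingHom.id R) (algebraMap B A) comm ωB =
      exteriorPower.ιMulti A m (fun i => b (Fin.natAdd k i)) := by
    rw [← Form.map_smul, hc, show (b₂ : Fin m → _) = _ from funext h₂, Form.map_ι]
    congr 1
    ext i
    rw [h₄]
  rw [mul_smul, Submodule.coe_smul, Submodule.coe_smul, smul_mul_assoc, smul_mul_assoc,
    ← mul_smul_comm, ← Submodule.coe_smul _ (Form.map _ _ _ _ _), e2, Submodule.coe_smul]
  rw [exteriorPower.ιMulti_apply_coe, exteriorPower.ιMulti_apply_coe,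
    ExteriorAlgebra.ιMulti_mul_ιMulti, ← e]
  rfl

include hk hm hB in
-- The wedge product determines the `dx` coefficient of `θ`, since the `dy` coefficient of the
-- pullback of `ω_B` is invertible. The `dx` coefficient is also all that the image in the relative
-- forms remembers, as the projection `L₁` to the `dx` coordinates kills `d` of every element of
-- `B`.
theorem map_eq_of_wedge_eq (θ θ' : Form R A k) (h : (θ : ExteriorAlgebra A Ω[A⁄R]) *
      (Form.map m (RingHom.id R) (algebraMap B A) comm ωB : ExteriorAlgebra A Ω[A⁄R]) =
      (θ' : ExteriorAlgebra A Ω[A⁄R]) *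
      (Form.map m (RingHom.id R) (algebraMap B A) comm ωB : ExteriorAlgebra A Ω[A⁄R])) :
    Form.map k (algebraMap R B) (RingHom.id A) comm' θ =
      Form.map k (algebraMap R B) (RingHom.id A) comm' θ' := by
  obtain ⟨x, y, b₁, b₂, b, h₁, h₂, h₃, h₄⟩ := exists_adapted_basis R B A hk hm
  obtain ⟨c, hc⟩ := exists_smul_eq_of_span_eq_top hB (exteriorPower.ιMulti B m b₂)
  let L : Ω[A⁄R] →ₗ[A] (Fin (k + m) → A) := b.equivFun
  let L₁ : Ω[A⁄R] →ₗ[A] (Fin k → A) := LinearMap.pi fun i => LinearMap.proj (Fin.castAdd m i) ∘ₗ L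
  let L₂ : Ω[A⁄R] →ₗ[A] (Fin m → A) := LinearMap.pi fun i => LinearMap.proj (Fin.natAdd k i) ∘ₗ L
  have e2 : algebraMap B A c • Form.map m (RingHom.id R) (algebraMap B A) comm ωB =
      exteriorPower.ιMulti A m (fun i => b (Fin.natAdd k i)) := by
    rw [← Form.map_smul, hc, show (b₂ : Fin m → _) = _ from funext h₂, Form.map_ι]
    congr 1
    ext i
    rw [h₄]
  have hL₁ : ∀ i, L₁ (b (Fin.natAdd k i)) = 0 := by
    intro i
    ext j
    simp [L₁, L, Fin.ext_iff]
    omega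
  -- The factor `c` is an inverse of the `dy` coefficient of the pulled back `ω_B`, which allows
  -- cancelling it below.
  have hu : algebraMap B A c * detForm L₂ (Form.map m (RingHom.id R) (algebraMap B A) comm ωB)
      = 1 := by
    rw [← smul_eq_mul, ← map_smul, e2, detForm_ι, ← Matrix.det_one (n := Fin m)]
    congr 1
    ext i j
    simp [Matrix.one_apply, L₂, L]
  have hdB : ∀ z : B, L₁ (KaehlerDifferential.D R A (algebraMap B A z)) = 0 := by
    intro z
    have : KaehlerDifferential.D R A (algebraMap B A z) =
        KaehlerDifferential.map R R B A (KaehlerDifferential.D R B z) :=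
      (KaehlerDifferential.map_D R R B A z).symm
    rw [this, ← b₂.sum_repr (KaehlerDifferential.D R B z), map_sum, map_sum]
    refine Finset.sum_eq_zero fun i _ => ?_
    rw [map_smul, h₂, KaehlerDifferential.map_D, ← h₄, ← algebraMap_smul A, map_smul, hL₁, smul_zero]
  have hspan : Form.map m (RingHom.id R) (algebraMap B A) comm ωB ∈
      Submodule.span A (exteriorPower.ιMulti A m '' {y | ∀ j, L₁ (y j) = 0}) := by
    clear hu e2 hc hB h
    induction ωB using Form.induction with
    | zero => rw [Form.map_zero]; exact Submodule.zero_mem _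
    | add x y hx hy => rw [Form.map_add]; exact Submodule.add_mem _ hx hy
    | smul a x hx => rw [Form.map_smul]; exact Submodule.smul_mem _ _ hx
    | ι a =>
      rw [Form.map_ι]
      exact Submodule.subset_span ⟨_, fun j => hdB _, rfl⟩
  obtain ⟨ω, hω⟩ : ∃ ω : Form R A (k + m), (ω : ExteriorAlgebra A Ω[A⁄R]) =
      (θ : ExteriorAlgebra A Ω[A⁄R]) *
      (Form.map m (RingHom.id R) (algebraMap B A) comm ωB : ExteriorAlgebra A Ω[A⁄R]) := by
    refine ⟨⟨_, ?_⟩, rfl⟩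
    rw [ExteriorAlgebra.exteriorPower, pow_add]
    exact Submodule.mul_mem_mul θ.2 (Subtype.mem _)
  have w := detForm_wedge L L₁ L₂ (fun _ _ => rfl) (fun _ _ => rfl) θ _ hspan ω hω.symm
  have w' := detForm_wedge L L₁ L₂ (fun _ _ => rfl) (fun _ _ => rfl) θ' _ hspan ω
    (h ▸ hω.symm)
  have hdet : detForm L₁ θ = detForm L₁ θ' := by
    calc detForm L₁ θ = detForm L ω * algebraMap B A c := by
          rw [w, mul_assoc, mul_comm _ (algebraMap B A c), hu, mul_one]
      _ = detForm L₁ θ' := by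
          rw [w', mul_assoc, mul_comm _ (algebraMap B A c), hu, mul_one]
  have hcomp : ∀ z, (b₁.equivFun : Ω[A⁄B] →ₗ[A] (Fin k → A))
      (KaehlerDifferential.D B A z) = L₁ (KaehlerDifferential.D R A z) := by
    have : (b₁.equivFun : Ω[A⁄B] →ₗ[A] (Fin k → A)) ∘ₗ KaehlerDifferential.map R B A A = L₁ := by
      refine b.ext fun i => ?_
      refine Fin.addCases (fun i => ?_) (fun i => ?_) i
      · rw [LinearMap.comp_apply, h₃, KaehlerDifferential.map_D, ← h₃]
        change b₁.equivFun (KaehlerDifferential.D B A (x i)) = _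
        rw [← h₁]
        ext j
        simp [L₁, L]
      · rw [hL₁, LinearMap.comp_apply, h₄, KaehlerDifferential.map_D]
        change b₁.equivFun (KaehlerDifferential.D B A (algebraMap B A (y i))) = _
        simp
    intro z
    rw [← this, LinearMap.comp_apply, KaehlerDifferential.map_D]
    rfl
  have hdm : ∀ z : Form R A k, detForm (b₁.equivFun : Ω[A⁄B] →ₗ[A] (Fin k → A))
      (Form.map k (algebraMap R B) (RingHom.id A) comm' z) = detForm L₁ z := by
    intro z
    induction z using Form.induction with
    | zero => simp only [Form.map_zero, map_zero]
    | add x y hx hy => simp only [Form.map_add, map_add, hx, hy]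
    | smul a x hx => simp only [Form.map_smul, map_smul, hx, RingHom.id_apply]
    | ι a => simp only [Form.map_ι, detForm_ι, hcomp, RingHom.id_apply]
  rw [topForm_eq_smul b₁ (Form.map _ _ _ _ θ), topForm_eq_smul b₁ (Form.map _ _ _ _ θ'), hdm, hdm,
    hdet]

include hk hm hB in
/-- Pullback along a map of relative dimension `0` preserves generators of the top forms. -/
theorem span_map_eq_top (h0 : k = 0) : Submodule.span A
      {Form.map m (RingHom.id R) (algebraMap B A) comm ωB} = ⊤ := by
  subst h0
  obtain ⟨x, y, b₁, b₂, b, h₁, h₂, h₃, h₄⟩ := exists_adapted_basis R B A hk hm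
  obtain ⟨c, hc⟩ := exists_smul_eq_of_span_eq_top hB (exteriorPower.ιMulti B m b₂)
  have e2 : algebraMap B A c • Form.map m (RingHom.id R) (algebraMap B A) comm ωB =
      exteriorPower.ιMulti A m (fun i => b (Fin.natAdd 0 i)) := by
    rw [← Form.map_smul, hc, show (b₂ : Fin m → _) = _ from funext h₂, Form.map_ι]
    congr 1
    ext i
    rw [h₄]
  rw [eq_top_iff]
  intro z _
  let b' := b.reindex (finCongr (Nat.zero_add m))
  have hb' : (fun i => b (Fin.natAdd 0 i)) = b' := by
    ext i
    rw [Module.Basis.reindex_apply]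
    congr 2
    ext; simp
  rw [topForm_eq_smul b' z, ← hb', ← e2]
  exact Submodule.smul_mem _ _ (Submodule.smul_mem _ _ (Submodule.mem_span_singleton_self _))

end Quotient

end Algebra
end RealVar

/-! ### Real points as ring maps to the reals, and regular functions as fractions. -/

namespace RealVar

/-- The morphism `Spec ℝ ⟶ X` of a real point. -/
abbrev specMap {X : RScheme} (x : RealPoints X) : Spec (CommRingCat.of ℝ) ⟶ X.left :=
  Over.Hom.left x

/-- The underlying point of the scheme `X` of a real point. -/
def pt {X : RScheme} (x : RealPoints X) : X.left :=
  specMap x (show PrimeSpectrum ℝ from default)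

theorem mem_onOpen {X : RScheme} {U : X.left.Opens} {x : RealPoints X} :
    x ∈ onOpen X U ↔ pt x ∈ U := by
  constructor
  · intro h
    exact h (show _ ∈ (⊤ : (Spec (CommRingCat.of ℝ)).Opens) from trivial)
  · intro h p _
    have : p = (show PrimeSpectrum ℝ from default) :=
      Subsingleton.elim (α := PrimeSpectrum ℝ) _ _
    subst this
    exact h

theorem onOpen_mono {X : RScheme} {U U' : X.left.Opens} (h : U' ≤ U) : onOpen X U' ⊆ onOpen X U :=
  fun _ hx => mem_onOpen.2 (h (mem_onOpen.1 hx))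

theorem onOpen_top {X : RScheme} : onOpen X ⊤ = Set.univ :=
  Set.eq_univ_of_forall fun _ => mem_onOpen.2 trivial

theorem onOpen_inf {X : RScheme} {U U' : X.left.Opens} :
    onOpen X (U ⊓ U') = onOpen X U ∩ onOpen X U' := by
  ext x
  simp only [mem_onOpen, Set.mem_inter_iff]
  rfl

theorem evalHom_res {X : RScheme} {U U' : X.left.Opens} (h : U' ≤ U) {x : RealPoints X}
    (hx : x ∈ onOpen X U') (a : Sec X U) :
    evalHom X U' x hx (res X h a) = evalHom X U x (onOpen_mono h hx) a := by
  have key : X.left.presheaf.map (homOfLE h).op ≫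
      Scheme.Hom.appLE (Y := X.left) (X := Spec (CommRingCat.of ℝ)) (Over.Hom.left x) U' ⊤ hx =
      Scheme.Hom.appLE (Y := X.left) (X := Spec (CommRingCat.of ℝ)) (Over.Hom.left x) U ⊤
        (onOpen_mono h hx) := Scheme.Hom.map_appLE _ _ _
  exact congrArg (fun f => (Scheme.ΓSpecIso (CommRingCat.of ℝ)).hom.hom (f.hom a)) key

theorem evalAt_res {X : RScheme} {U U' : X.left.Opens} (h : U' ≤ U) {x : RealPoints X}
    (hx : x ∈ onOpen X U') (a : Sec X U) : evalAt X (res X h a) x = evalAt X a x := by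
  rw [evalAt_of_mem _ _ hx, evalAt_of_mem _ _ (onOpen_mono h hx), evalHom_res]

/-- The preimage of a basic open set under `Spec ℝ ⟶ X` is the basic open set of the value of `f`,
and the only prime of `ℝ` is zero. -/
theorem mem_onOpen_basicOpen {X : RScheme} {U : X.left.Opens} (f : Sec X U) {x : RealPoints X}
    (hx : x ∈ onOpen X U) : x ∈ onOpen X (X.left.basicOpen (U := U) f) ↔ evalAt X f x ≠ 0 := by
  rw [evalAt_of_mem _ _ hx]
  let F : Spec (CommRingCat.of ℝ) ⟶ X.left := Over.Hom.left x
  let p : PrimeSpectrum ℝ := default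
  have h1 : (F ⁻¹ᵁ X.left.basicOpen (U := U) f) = (Spec (CommRingCat.of ℝ)).basicOpen
      ((F.app U).hom f) := Scheme.preimage_basicOpen F f
  have h2 : (F.appLE U ⊤ hx) = F.app U ≫ (Spec (CommRingCat.of ℝ)).presheaf.map (homOfLE hx).op :=
    rfl
  have h3 : (Spec (CommRingCat.of ℝ)).basicOpen ((F.appLE U ⊤ hx).hom f) =
      (Spec (CommRingCat.of ℝ)).basicOpen ((F.app U).hom f) := by
    rw [h2]
    have := Scheme.basicOpen_res (X := Spec (CommRingCat.of ℝ)) ((F.app U).hom f) (homOfLE hx).op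
    refine this.trans ?_
    rw [inf_eq_right]
    exact le_top
  have h4 : x ∈ onOpen X (X.left.basicOpen (U := U) f) ↔ (p : Spec (CommRingCat.of ℝ)) ∈
      (Spec (CommRingCat.of ℝ)).basicOpen ((F.appLE U ⊤ hx).hom f) := by
    rw [mem_onOpen, h3, ← h1]
    rfl
  have h5 := congrArg (fun W : (Spec (CommRingCat.of ℝ)).Opens =>
    (p : Spec (CommRingCat.of ℝ)) ∈ W)
    (basicOpen_eq_of_affine' ((F.appLE U ⊤ hx).hom f))
  rw [h4, h5]
  change evalHom X U x hx f ∉ p.asIdeal ↔ _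
  have hp : p.asIdeal = ⊥ := (Ideal.eq_bot_or_top _).resolve_right p.2.ne_top
  rw [hp, Ideal.mem_bot]

/-- The morphism `Spec T ⟶ X` given by a ring map out of the sections on an affine open. -/
def specOf {X : RScheme} {U : X.left.Opens} (hU : IsAffineOpen U) {T : Type} [CommRing T]
    (i : Sec X U →+* T) : Spec (CommRingCat.of T) ⟶ X.left :=
  Spec.map (show Γ(X.left, U) ⟶ CommRingCat.of T from CommRingCat.ofHom i) ≫ hU.fromSpec

theorem map_specOf {X : RScheme} {U : X.left.Opens} (hU : IsAffineOpen U) {T T' : Type} [CommRing T]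
    [CommRing T'] (i : Sec X U →+* T) (j : T →+* T') :
    Spec.map (CommRingCat.ofHom j) ≫ specOf hU i = specOf hU (j.comp i) := by
  unfold specOf
  rw [← Category.assoc, ← Spec.map_comp]
  rfl

theorem specOf_injective {X : RScheme} {U : X.left.Opens} (hU : IsAffineOpen U) {T : Type}
    [CommRing T] {i j : Sec X U →+* T} (h : specOf hU i = specOf hU j) : i = j := by
  unfold specOf at h
  rw [cancel_mono] at h
  exact congrArg CommRingCat.Hom.hom (Spec.map_injective h)

theorem specOf_hom {X : RScheme} {U : X.left.Opens} (hU : IsAffineOpen U) {T : Type}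
    [CommRing T] (i : Sec X U →+* T) (g : ℝ →+* T) (h : ∀ r, i (algebraMap ℝ (Sec X U) r) = g r) :
    specOf hU i ≫ X.hom = Spec.map (CommRingCat.ofHom g) := by
  have e := (isAffineOpen_top (Spec (CommRingCat.of ℝ))).SpecMap_appLE_fromSpec X.hom hU le_top
  rw [IsAffineOpen.fromSpec_top, Scheme.isoSpec_Spec_inv] at e
  unfold specOf
  rw [Category.assoc, ← e, ← Spec.map_comp, ← Spec.map_comp]
  congr 1
  ext r
  exact h r

theorem specMap_eq {X : RScheme} {U : X.left.Opens} (hU : IsAffineOpen U) {x : RealPoints X}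
    (hx : x ∈ onOpen X U) : specMap x = specOf hU (evalHom X U x hx) := by
  have h := hU.SpecMap_appLE_fromSpec (specMap x) (isAffineOpen_top _) hx
  rw [IsAffineOpen.fromSpec_top, Scheme.isoSpec_Spec_inv] at h
  have e : (show Γ(X.left, U) ⟶ CommRingCat.of ℝ from CommRingCat.ofHom (evalHom X U x hx)) =
    (specMap x).appLE U ⊤ hx ≫ (Scheme.ΓSpecIso (CommRingCat.of ℝ)).hom := rfl
  unfold specOf
  rw [e, Spec.map_comp, Category.assoc, h, ← Category.assoc, ← Spec.map_comp, Iso.inv_hom_id,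
    Spec.map_id, Category.id_comp]

theorem specMap_injective {X : RScheme} {x y : RealPoints X} (h : specMap x = specMap y) : x = y :=
  Over.OverMorphism.ext h

theorem realPoint_ext {X : RScheme} {U : X.left.Opens} (hU : IsAffineOpen U) {x y : RealPoints X}
    (hx : x ∈ onOpen X U) (hy : y ∈ onOpen X U) (h : ∀ a : Sec X U, evalAt X a x = evalAt X a y) :
    x = y := by
  apply specMap_injective
  rw [specMap_eq hU hx, specMap_eq hU hy]
  congr 1
  ext a
  simpa only [evalAt_of_mem _ _ hx, evalAt_of_mem _ _ hy] using h a

theorem exists_realPoint {X : RScheme} {U : X.left.Opens} (hU : IsAffineOpen U) (h : Sec X U →+* ℝ)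
    (hr : ∀ r, h (algebraMap ℝ (Sec X U) r) = r) :
    ∃ (x : RealPoints X) (hx : x ∈ onOpen X U), evalHom X U x hx = h := by
  have hw : specOf hU h ≫ X.hom = 𝟙 (Spec (CommRingCat.of ℝ)) :=
    (specOf_hom hU h (RingHom.id ℝ) hr).trans (Spec.map_id _)
  let x : RealPoints X := Over.homMk (specOf hU h) hw
  have hxl : specMap x = specOf hU h := rfl
  have hx : x ∈ onOpen X U := by
    rw [mem_onOpen]
    have : (pt x : X.left) ∈ Set.range hU.fromSpec := ⟨_, rfl⟩
    rwa [hU.range_fromSpec] at this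
  exact ⟨x, hx, (specOf_injective hU (hxl.symm.trans (specMap_eq hU hx))).symm⟩

/-- Basic open sets are a basis at a point of an affine scheme, and sections on a basic open set are
a localization. The same denominator `f` serves for all functions on `W`, so continuity and
analyticity of functions on any open set can be tested on one affine open. -/
theorem exists_fraction {X : RScheme} {U : X.left.Opens} (hU : IsAffineOpen U)
    (W : X.left.Opens) {x : RealPoints X} (hx : x ∈ onOpen X U) (hxW : x ∈ onOpen X W) :
    ∃ f : Sec X U, evalAt X f x ≠ 0 ∧ (∀ z ∈ onOpen X U, evalAt X f z ≠ 0 → z ∈ onOpen X W) ∧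
      ∀ a : Sec X W, ∃ (b : Sec X U) (n : ℕ), ∀ z ∈ onOpen X U, evalAt X f z ≠ 0 →
        evalAt X a z = evalAt X b z / evalAt X f z ^ n := by
  obtain ⟨f, hf, hxf⟩ : ∃ f : Sec X U, X.left.basicOpen (U := U) f ≤ W ∧
      pt x ∈ X.left.basicOpen (U := U) f :=
    hU.exists_basicOpen_le ⟨pt x, mem_onOpen.1 hxW⟩ (mem_onOpen.1 hx)
  have hfU : X.left.basicOpen (U := U) f ≤ U := Scheme.basicOpen_le _ _
  refine ⟨f, (mem_onOpen_basicOpen f hx).1 (mem_onOpen.2 hxf), fun z hz hzf =>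
    onOpen_mono hf ((mem_onOpen_basicOpen f hz).2 hzf), fun a => ?_⟩
  obtain ⟨b, n, hb⟩ : ∃ (b : Sec X U) (n : ℕ), res X hf a * res X hfU (f ^ n) = res X hfU b := by
    have : ∀ (f : Γ(X.left, U)) (c : Γ(X.left, X.left.basicOpen f)), ∃ (b : Γ(X.left, U)) (n : ℕ),
        c * algebraMap Γ(X.left, U) Γ(X.left, X.left.basicOpen f) (f ^ n) = algebraMap _ _ b := by
      intro f c
      have := hU.isLocalization_basicOpen f
      obtain ⟨⟨b, ⟨_, n, rfl⟩⟩, hb⟩ := IsLocalization.surj (Submonoid.powers f) c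
      exact ⟨b, n, hb⟩
    exact this f (res X hf a)
  refine ⟨b, n, fun z hz hzf => ?_⟩
  have hz' : z ∈ onOpen X (X.left.basicOpen (U := U) f) := (mem_onOpen_basicOpen f hz).2 hzf
  have := congrArg (evalHom X _ z hz') hb
  rw [map_mul, map_pow (res X hfU), map_pow] at this
  simp only [evalHom_res] at this
  rw [evalAt_of_mem _ _ hz] at hzf ⊢
  rw [evalAt_of_mem _ _ hz, evalAt_of_mem _ _ (onOpen_mono hf hz'), eq_div_iff (pow_ne_zero _ hzf)]
  exact this

/-! ### The analytic topology: coordinates, countability, separation. -/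

section Topology

variable {X Y : RScheme}

theorem isOpen_evalAt {U : X.left.Opens} (a : Sec X U) {O : Set ℝ} (hO : IsOpen O) :
    IsOpen {x | x ∈ onOpen X U ∧ evalAt X a x ∈ O} :=
  TopologicalSpace.isOpen_generateFrom_of_mem ⟨U, a, O, hO, rfl⟩

theorem isOpen_onOpen (U : X.left.Opens) : IsOpen (onOpen X U) := by
  simpa using isOpen_evalAt (0 : Sec X U) isOpen_univ

theorem continuousOn_evalAt {U : X.left.Opens} (a : Sec X U) :
    ContinuousOn (evalAt X a) (onOpen X U) := by
  rw [continuousOn_open_iff (isOpen_onOpen U)]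
  exact fun O hO => isOpen_evalAt a hO

theorem continuous_realMap (φ : X ⟶ Y) : Continuous (realMap φ) := by
  refine continuous_generateFrom_iff.2 ?_
  rintro _ ⟨V, b, O, hO, rfl⟩
  convert isOpen_evalAt (pull φ V (φ.left ⁻¹ᵁ V) le_rfl b) hO using 1
  ext x
  have e : realMap φ x ∈ onOpen Y V ↔ x ∈ onOpen X (φ.left ⁻¹ᵁ V) := by
    simp only [mem_onOpen]
    rfl
  simp only [Set.mem_preimage, Set.mem_ofPred_eq, e]
  refine and_congr_right fun hx => ?_
  rw [evalAt_pull φ V _ le_rfl b hx]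

theorem evalAt_aeval {U : X.left.Opens} {ι : Type*} (a : ι → Sec X U) (p : MvPolynomial ι ℝ)
    {x : RealPoints X} (hx : x ∈ onOpen X U) :
    evalAt X (MvPolynomial.aeval a p) x = MvPolynomial.eval (fun i => evalAt X (a i) x) p := by
  simp only [evalAt_of_mem _ _ hx]
  have : (evalHom X U x hx).comp (MvPolynomial.aeval a).toRingHom =
      MvPolynomial.eval (fun i => evalHom X U x hx (a i)) := by
    apply MvPolynomial.ringHom_ext
    · intro r
      simp [evalHom_structureHom]
    · intro i
      simp
  exact RingHom.congr_fun this p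

/-- Regular functions on `U` are polynomials in the generators, hence continuous for the topology of
the coordinates. Those on other open sets are locally quotients of functions on `U`, so they add no
further open sets. -/
theorem isInducing_evalAt {U : X.left.Opens} (hU : IsAffineOpen U) {ι : Type*} (a : ι → Sec X U)
    (ha : Function.Surjective (MvPolynomial.aeval a : MvPolynomial ι ℝ →ₐ[ℝ] Sec X U)) :
    Topology.IsInducing (fun (x : onOpen X U) i => evalAt X (a i) x) := by
  constructor
  apply le_antisymm
  · rw [← continuous_iff_le_induced]
    exact continuous_pi fun i => continuousOn_iff_continuous_domRestrict.1 (continuousOn_evalAt (a i))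
  · have h := @continuous_generateFrom_iff (onOpen X U) (RealPoints X) Subtype.val
      (TopologicalSpace.induced (fun (x : onOpen X U) i => evalAt X (a i) x) inferInstance)
      {S | ∃ (U : X.left.Opens) (a : Sec X U) (O : Set ℝ), IsOpen O ∧
        S = {x | x ∈ onOpen X U ∧ evalAt X a x ∈ O}}
    let : TopologicalSpace (onOpen X U) :=
      TopologicalSpace.induced (fun (x : onOpen X U) i => evalAt X (a i) x) inferInstance
    have hc : ∀ b : Sec X U, Continuous (fun x : onOpen X U => evalAt X b x) := by
      intro b
      obtain ⟨p, rfl⟩ := ha b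
      have : (fun x : onOpen X U => evalAt X (MvPolynomial.aeval a p) x) =
          (fun z => MvPolynomial.eval z p) ∘ fun (x : onOpen X U) i => evalAt X (a i) x := by
        ext x
        exact evalAt_aeval a p x.2
      rw [this]
      exact (MvPolynomial.continuous_eval p).comp continuous_induced_dom
    refine continuous_iff_le_induced.1 (h.2 ?_)
    rintro _ ⟨W, b, O, hO, rfl⟩
    rw [isOpen_iff_forall_mem_open]
    rintro x ⟨hxW, hxO⟩
    obtain ⟨f, hf, hfW, hfr⟩ := exists_fraction hU W x.2 hxW
    obtain ⟨c, n, hcn⟩ := hfr b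
    have hcont : ContinuousOn (fun x : onOpen X U => evalAt X c x / evalAt X f x ^ n)
        {z | evalAt X f z ≠ 0} :=
      (hc c).continuousOn.div ((hc f).pow n).continuousOn fun z hz => pow_ne_zero _ hz
    refine ⟨{z | evalAt X f z ≠ 0} ∩ (fun x : onOpen X U => evalAt X c x / evalAt X f x ^ n) ⁻¹' O,
      ?_, hcont.isOpen_inter_preimage (isOpen_ne.preimage (hc f)) hO, hf, ?_⟩
    · rintro z ⟨hz, hzO⟩
      refine ⟨hfW z z.2 hz, ?_⟩
      rw [hcn z z.2 hz]
      exact hzO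
    · rw [Set.mem_preimage, ← hcn x x.2 hf]
      exact hxO

theorem exists_affine_mem (x : RealPoints X) (D : X.left.Opens) (hx : x ∈ onOpen X D) :
    ∃ U : X.left.Opens, IsAffineOpen U ∧ x ∈ onOpen X U ∧ U ≤ D := by
  obtain ⟨U, hU, h, h'⟩ := exists_isAffineOpen_mem_and_subset (mem_onOpen.1 hx)
  exact ⟨U, hU, mem_onOpen.2 h, h'⟩

theorem exists_generators [Smooth X.hom] {U : X.left.Opens} (hU : IsAffineOpen U) :
    ∃ (n : ℕ) (a : Fin n → Sec X U),
      Function.Surjective (MvPolynomial.aeval a : MvPolynomial (Fin n) ℝ →ₐ[ℝ] Sec X U) := by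
  have h1 := X.hom.smooth_appLE (isAffineOpen_top _) hU le_top
  have h2 : (structureHom X U).Smooth := by
    refine RingHom.Smooth.comp (RingHom.Smooth.of_bijective ?_) h1
    exact (ConcreteCategory.bijective_of_isIso (Scheme.ΓSpecIso (CommRingCat.of ℝ)).inv)
  have h3 : Algebra.FiniteType ℝ (Sec X U) :=
    RingHom.FiniteType.of_finitePresentation h2.finitePresentation
  obtain ⟨n, f, hf⟩ := Algebra.FiniteType.iff_quotient_mvPolynomial''.1 h3
  refine ⟨n, fun i => f (MvPolynomial.X i), ?_⟩
  convert hf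
  ext i
  simp

/-- Finitely many affine opens cover `X` by quasi-compactness, and the real points of each embed
into some `ℝⁿ`. -/
theorem secondCountable_realPoints (X : RScheme) [QuasiCompact X.hom] [Smooth X.hom] :
    SecondCountableTopology (RealPoints X) := by
  have : CompactSpace X.left := (quasiCompact_iff_compactSpace X.hom).1 inferInstance
  have hcov : ∀ p : X.left, ∃ U : X.left.Opens, IsAffineOpen U ∧ p ∈ U := fun p => by
    obtain ⟨U, hU, h, -⟩ := exists_isAffineOpen_mem_and_subset (X := X.left) (x := p) (U := ⊤) trivial
    exact ⟨U, hU, h⟩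
  choose U hU hp using hcov
  obtain ⟨t, ht⟩ := isCompact_univ.elim_finite_subcover (fun p => (U p : Set X.left))
    (fun p => (U p).isOpen) (fun p _ => Set.mem_iUnion.2 ⟨p, hp p⟩)
  have : ∀ p : t, SecondCountableTopology (onOpen X (U p)) := by
    intro p
    obtain ⟨n, a, ha⟩ := exists_generators (hU p)
    exact (isInducing_evalAt (hU p) a ha).secondCountableTopology
  refine TopologicalSpace.secondCountableTopology_of_countable_cover
    (U := fun p : t => onOpen X (U p)) (fun p => isOpen_onOpen _) ?_
  refine Set.eq_univ_of_forall fun x => ?_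
  obtain ⟨p, hpt, hx⟩ := Set.mem_iUnion₂.1 (ht (Set.mem_univ (pt x)))
  exact Set.mem_iUnion.2 ⟨⟨p, hpt⟩, mem_onOpen.2 hx⟩

/-- Evaluation at pairs of real points is continuous. -/
theorem exists_continuousOn_tensor {U U' : X.left.Opens} (t : TensorProduct ℝ (Sec X U) (Sec X U')) :
    ∃ F : RealPoints X × RealPoints X → ℝ, ContinuousOn F (onOpen X U ×ˢ onOpen X U') ∧
      ∀ (x y : RealPoints X) (hx : x ∈ onOpen X U) (hy : y ∈ onOpen X U')
        (h : TensorProduct ℝ (Sec X U) (Sec X U') →+* ℝ),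
        (∀ a, h (a ⊗ₜ 1) = evalHom X U x hx a) → (∀ b, h (1 ⊗ₜ b) = evalHom X U' y hy b) →
          h t = F (x, y) := by
  induction t using TensorProduct.induction_on with
  | zero => exact ⟨0, continuousOn_const, fun x y hx hy h _ _ => map_zero h⟩
  | add s t hs ht =>
    obtain ⟨F, hF, hF'⟩ := hs
    obtain ⟨G, hG, hG'⟩ := ht
    exact ⟨F + G, hF.add hG, fun x y hx hy h h₁ h₂ => by
      rw [map_add, hF' x y hx hy h h₁ h₂, hG' x y hx hy h h₁ h₂]; rfl⟩
  | tmul a b =>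
    refine ⟨fun z => evalAt X a z.1 * evalAt X b z.2,
      ((continuousOn_evalAt a).comp continuousOn_fst fun _ h => h.1).mul
        ((continuousOn_evalAt b).comp continuousOn_snd fun _ h => h.2),
      fun x y hx hy h h₁ h₂ => ?_⟩
    rw [← mul_one a, ← one_mul b, ← Algebra.TensorProduct.tmul_mul_tmul, map_mul, h₁, h₂, mul_one,
      one_mul, ← evalAt_of_mem _ _ hx, ← evalAt_of_mem _ _ hy]

/-- On `U × U'` the diagonal is a closed subscheme, because `X` is separated. If `x ≠ y`, some
function `t` in its ideal does not vanish at `(x, y)`. It is continuous on pairs of real points and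
zero on the diagonal, so the set where `t ≠ 0` contains a product of disjoint neighbourhoods. -/
theorem t2_realPoints (X : RScheme) [IsSeparated X.hom] : T2Space (RealPoints X) := by
  refine ⟨fun x y hxy => ?_⟩
  obtain ⟨U, hU, hx, -⟩ := exists_affine_mem x ⊤ (onOpen_top ▸ Set.mem_univ x)
  obtain ⟨U', hU', hy, -⟩ := exists_affine_mem y ⊤ (onOpen_top ▸ Set.mem_univ y)
  let T := TensorProduct ℝ (Sec X U) (Sec X U')
  let i₁ : Sec X U →+* T := (Algebra.TensorProduct.includeLeft : Sec X U →ₐ[ℝ] T).toRingHom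
  let i₂ : Sec X U' →+* T := (Algebra.TensorProduct.includeRight : Sec X U' →ₐ[ℝ] T).toRingHom
  let Z : RScheme := Over.mk (Spec.map (CommRingCat.ofHom (algebraMap ℝ T)))
  let f : Z ⟶ X := Over.homMk (specOf hU i₁) (specOf_hom hU i₁ _ fun r => AlgHom.commutes _ r)
  let g : Z ⟶ X := Over.homMk (specOf hU' i₂) (specOf_hom hU' i₂ _ fun r => AlgHom.commutes _ r)
  -- The equalizer of the two projections `Spec T ⟶ X` is the diagonal restricted to `U × U'`; as a
  -- closed subscheme of `Spec T` it is cut out by an ideal `I`.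
  obtain ⟨I, e, he⟩ := (IsClosedImmersion.Spec_iff
    (f := (Limits.equalizer.ι f g).left)).1 inferInstance
  have hpair : ∀ (x y : RealPoints X) (hx : x ∈ onOpen X U) (hy : y ∈ onOpen X U'),
      ∃ h : T →+* ℝ, (∀ a, h (a ⊗ₜ 1) = evalHom X U x hx a) ∧
        (∀ b, h (1 ⊗ₜ b) = evalHom X U' y hy b) ∧ ∀ r, h (algebraMap ℝ T r) = r := by
    intro x y hx hy
    let a₁ : Sec X U →ₐ[ℝ] ℝ := { evalHom X U x hx with
      commutes' := fun r => evalHom_structureHom X U x hx r }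
    let a₂ : Sec X U' →ₐ[ℝ] ℝ := { evalHom X U' y hy with
      commutes' := fun r => evalHom_structureHom X U' y hy r }
    let h := Algebra.TensorProduct.lift a₁ a₂ (fun _ _ => Commute.all _ _)
    refine ⟨h.toRingHom, fun a => ?_, fun b => ?_, fun r => h.commutes r⟩
    · change h (a ⊗ₜ 1) = a₁ a
      simp [h]
    · change h (1 ⊗ₜ b) = a₂ b
      simp [h]
  have hfst : ∀ (x y : RealPoints X) (hx : x ∈ onOpen X U) (hy : y ∈ onOpen X U') (h : T →+* ℝ),
      (∀ a, h (a ⊗ₜ 1) = evalHom X U x hx a) → (∀ b, h (1 ⊗ₜ b) = evalHom X U' y hy b) →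
      Spec.map (CommRingCat.ofHom h) ≫ f.left = specMap x ∧
      Spec.map (CommRingCat.ofHom h) ≫ g.left = specMap y := by
    intro x y hx hy h h₁ h₂
    rw [specMap_eq hU hx, specMap_eq hU' hy]
    exact ⟨(map_specOf hU i₁ h).trans (congrArg (specOf hU) (RingHom.ext h₁)),
      (map_specOf hU' i₂ h).trans (congrArg (specOf hU') (RingHom.ext h₂))⟩
  -- the diagonal points are killed by `I`
  have hdiag : ∀ z (hz : z ∈ onOpen X U) (hz' : z ∈ onOpen X U') (h : T →+* ℝ),
      (∀ a, h (a ⊗ₜ 1) = evalHom X U z hz a) → (∀ b, h (1 ⊗ₜ b) = evalHom X U' z hz' b) →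
      (∀ r, h (algebraMap ℝ T r) = r) → ∀ t ∈ I, h t = 0 := by
    intro z hz hz' h h₁ h₂ hr t ht
    let w : (Over.mk (𝟙 (Spec (CommRingCat.of ℝ))) : RScheme) ⟶ Z :=
      Over.homMk (Spec.map (CommRingCat.ofHom h)) (by
        refine (Spec.map_comp _ _).symm.trans ((congrArg Spec.map ?_).trans (Spec.map_id _))
        ext r
        exact hr r)
    have hwfg : w ≫ f = w ≫ g := by
      apply Over.OverMorphism.ext
      obtain ⟨e₁, e₂⟩ := hfst z z hz hz' h h₁ h₂
      exact e₁.trans e₂.symm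
    have hl := congrArg CommaMorphism.left (Limits.equalizer.lift_ι w hwfg)
    change (Limits.equalizer.lift w hwfg).left ≫ (Limits.equalizer.ι f g).left = _ at hl
    rw [he, ← Category.assoc] at hl
    obtain ⟨q, hq⟩ := Spec.map_surjective ((Limits.equalizer.lift w hwfg).left ≫ e.hom)
    rw [← hq] at hl
    have hl' : CommRingCat.ofHom (Ideal.Quotient.mk I) ≫ q = CommRingCat.ofHom h :=
      Spec.map_injective ((Spec.map_comp _ _).trans hl)
    have := congrArg (fun f => f.hom t) hl'
    change q.hom (Ideal.Quotient.mk I t) = h t at this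
    rw [← this, Ideal.Quotient.eq_zero_iff_mem.2 ht, map_zero]
  obtain ⟨h, h₁, h₂, hr⟩ := hpair x y hx hy
  -- If `I` vanished at `(x, y)`, this point would factor through the equalizer, and the two
  -- projections `x` and `y` would coincide.
  obtain ⟨t, htI, ht⟩ : ∃ t ∈ I, h t ≠ 0 := by
    by_contra! hI
    apply hxy
    let q : T ⧸ I →+* ℝ := Ideal.Quotient.lift I h hI
    have hfg : (Limits.equalizer.ι f g).left ≫ f.left = (Limits.equalizer.ι f g).left ≫ g.left :=
      congrArg CommaMorphism.left (Limits.equalizer.condition f g)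
    have hs : Spec.map (CommRingCat.ofHom h) =
        (Spec.map (CommRingCat.ofHom q) ≫ e.inv) ≫ (Limits.equalizer.ι f g).left := by
      rw [he, Category.assoc, Iso.inv_hom_id_assoc]
      refine Eq.trans (congrArg Spec.map ?_) (Spec.map_comp _ _)
      exact CommRingCat.hom_ext (RingHom.ext fun t => rfl)
    obtain ⟨e₁, e₂⟩ := hfst x y hx hy h h₁ h₂
    apply Over.OverMorphism.ext
    change specMap x = specMap y
    rw [← e₁, ← e₂, hs]
    simp only [Category.assoc, hfg]
  obtain ⟨F, hF, hFh⟩ := exists_continuousOn_tensor t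
  have hFxy : F (x, y) ≠ 0 := hFh x y hx hy h h₁ h₂ ▸ ht
  have hopen := hF.isOpen_inter_preimage ((isOpen_onOpen U).prod (isOpen_onOpen U'))
    (isOpen_ne (x := (0 : ℝ)))
  obtain ⟨N, N', hN, hN', hxN, hyN, hsub⟩ := isOpen_prod_iff.1 hopen x y ⟨⟨hx, hy⟩, hFxy⟩
  refine ⟨N, N', hN, hN', hxN, hyN, Set.disjoint_left.2 fun z hz hz' => ?_⟩
  obtain ⟨⟨hzU, hzU'⟩, hzF⟩ := hsub (Set.mk_mem_prod hz hz')
  obtain ⟨h, h₁, h₂, hr⟩ := hpair z z hzU hzU'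
  exact hzF ((hFh z z hzU hzU' h h₁ h₂).symm.trans (hdiag z hzU hzU' h h₁ h₂ hr t htI))

end Topology
end RealVar

namespace RealVar

/-! ### Localization of the base ring, and wedge products of forms. -/

section Algebra

/-- Standard smoothness over a ring passes to a localization of that ring. -/
theorem isStandardSmooth_of_localization {B B' A' : Type} [CommRing B] [CommRing B'] [CommRing A']
    [Algebra B B'] [Algebra B A'] [Algebra B' A'] [IsScalarTower B B' A'] (M : Submonoid B)
    [IsLocalization M B'] {k : ℕ} (h : Algebra.IsStandardSmoothOfRelativeDimension k B A') :
    Algebra.IsStandardSmoothOfRelativeDimension k B' A' := by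
  let f : TensorProduct B B' A' →ₐ[B'] A' :=
    Algebra.TensorProduct.lift (Algebra.ofId B' A') (AlgHom.id B A') fun _ _ => Commute.all _ _
  have hf : ∀ b a, f (b ⊗ₜ a) = b • a := by
    intro b a
    simp [f, Algebra.ofId_apply, Algebra.smul_def]
  -- Denominators from `B'` are already invertible on `A'`, so they can be moved across the tensor
  -- sign. Hence `B' ⊗ A' ≅ A'`, and the claim is base change.
  have key : ∀ t : TensorProduct B B' A', t = 1 ⊗ₜ f t := by
    intro t
    induction t using TensorProduct.induction_on with
    | zero => simp
    | add x y hx hy => rw [map_add, TensorProduct.tmul_add, ← hx, ← hy]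
    | tmul b' a =>
      obtain ⟨⟨b, s⟩, hs⟩ := IsLocalization.surj M b'
      obtain ⟨u, hu⟩ := IsLocalization.map_units B' s
      have ha : a = (s : B) • ((↑u⁻¹ : B') • a) := by
        rw [← algebraMap_smul B', ← hu, smul_smul, Units.mul_inv, one_smul]
      have hb : b' • a = b • ((↑u⁻¹ : B') • a) := by
        rw [← algebraMap_smul B' b, ← hs, ← hu, smul_smul, mul_assoc, Units.mul_inv, mul_one]
      rw [hf, hb]
      generalize (↑u⁻¹ : B') • a = z at ha
      conv_lhs => rw [ha]
      rw [TensorProduct.tmul_smul, TensorProduct.tmul_smul, TensorProduct.smul_tmul',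
        TensorProduct.smul_tmul', Algebra.smul_def, Algebra.smul_def, mul_one, mul_comm, hs]
  have hbij : Function.Bijective f := by
    refine ⟨fun s t hst => ?_, fun a => ⟨1 ⊗ₜ a, by rw [hf, one_smul]⟩⟩
    rw [key s, key t, hst]
  exact Algebra.IsStandardSmoothOfRelativeDimension.of_algEquiv k (AlgEquiv.ofBijective f hbij)

/-- The exterior product of forms. -/
def Form.wedge {R A : Type} [CommRing R] [CommRing A] [Algebra R A] {k m : ℕ} (θ : Form R A k)
    (β : Form R A m) : Form R A (k + m) :=
  ⟨(θ : ExteriorAlgebra A Ω[A⁄R]) * (β : ExteriorAlgebra A Ω[A⁄R]), by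
    rw [ExteriorAlgebra.exteriorPower, pow_add]
    exact Submodule.mul_mem_mul θ.2 β.2⟩

theorem Form.map_wedge {R A R' A' : Type} [CommRing R] [CommRing A] [Algebra R A] [CommRing R']
    [CommRing A'] [Algebra R' A'] {k m : ℕ} {g : R →+* R'} {h : A →+* A'}
    (comm : ∀ r, h (algebraMap R A r) = algebraMap R' A' (g r)) (θ : Form R A k) (β : Form R A m) :
    Form.map (k + m) g h comm (θ.wedge β) =
      (Form.map k g h comm θ).wedge (Form.map m g h comm β) := by
  induction θ using Form.induction with
  | zero =>
    have e : ∀ {R A : Type} [CommRing R] [CommRing A] [Algebra R A] (β : Form R A m),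
      (0 : Form R A k).wedge β = 0 := fun β => Subtype.ext (by simp [Form.wedge])
    rw [e, Form.map_zero, Form.map_zero, e]
  | add x y hx hy =>
    have e : ∀ {R A : Type} [CommRing R] [CommRing A] [Algebra R A] (x y : Form R A k)
      (β : Form R A m), (x + y).wedge β = x.wedge β + y.wedge β :=
        fun x y β => Subtype.ext (by simp [Form.wedge, add_mul])
    rw [e, Form.map_add, Form.map_add, e, hx, hy]
  | smul a x hx =>
    have e : ∀ {R A : Type} [CommRing R] [CommRing A] [Algebra R A] (a : A) (x : Form R A k)
      (β : Form R A m), (a • x).wedge β = a • x.wedge β :=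
        fun a x β => Subtype.ext (by simp [Form.wedge])
    rw [e, Form.map_smul, Form.map_smul, e, hx]
  | ι a =>
    induction β using Form.induction with
    | zero =>
      have e : ∀ {R A : Type} [CommRing R] [CommRing A] [Algebra R A] (x : Form R A k),
        x.wedge (0 : Form R A m) = 0 := fun β => Subtype.ext (by simp [Form.wedge])
      rw [e, Form.map_zero, Form.map_zero, e]
    | add x y hx hy =>
      have e : ∀ {R A : Type} [CommRing R] [CommRing A] [Algebra R A] (β : Form R A k)
        (x y : Form R A m), β.wedge (x + y) = β.wedge x + β.wedge y :=
          fun x y β => Subtype.ext (by simp [Form.wedge, mul_add])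
      rw [e, Form.map_add, Form.map_add, e, hx, hy]
    | smul a x hx =>
      have e : ∀ {R A : Type} [CommRing R] [CommRing A] [Algebra R A] (β : Form R A k)
        (a : A) (x : Form R A m), β.wedge (a • x) = a • β.wedge x :=
          fun β a x => Subtype.ext (by simp [Form.wedge])
      rw [e, Form.map_smul, Form.map_smul, e, hx]
    | ι b =>
      have e : ∀ {R A : Type} [CommRing R] [CommRing A] [Algebra R A] (a : Fin k → A)
        (b : Fin m → A),
        Form.wedge (exteriorPower.ιMulti A k fun i => KaehlerDifferential.D R A (a i))
        (exteriorPower.ιMulti A m fun i => KaehlerDifferential.D R A (b i)) =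
        exteriorPower.ιMulti A (k + m) fun i => KaehlerDifferential.D R A (Fin.append a b i) := by
          intro R A _ _ _ a b
          apply Subtype.ext
          refine (ExteriorAlgebra.ιMulti_mul_ιMulti _ _).trans ?_
          refine congrArg (ExteriorAlgebra.ιMulti A (k + m)) (funext fun i => ?_)
          refine Fin.addCases (fun i => ?_) (fun i => ?_) i <;> simp
      rw [e, Form.map_ι, Form.map_ι, Form.map_ι, e]
      congr 1
      ext i
      refine Fin.addCases (fun i => ?_) (fun i => ?_) i <;> simp

end Algebra

/-! ### Shrinking of patches, and the quotient form. -/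

section Patches

variable {X Y : RScheme}

theorem nontrivial_sec {U : X.left.Opens} {x : RealPoints X} (hx : x ∈ onOpen X U) :
    Nontrivial (Sec X U) :=
  (evalHom X U x hx).domain_nontrivial

/-- Relative dimension is not determined over the zero ring. This disposes of such patches in
comparisons of dimensions. -/
theorem subsingleton_form {R A : Type} [CommRing R] [CommRing A] [Algebra R A] {k : ℕ}
    (h : ¬ Nontrivial A) (x y : Form R A k) : x = y := by
  have := not_nontrivial_iff_subsingleton.1 h
  exact (Module.subsingleton A (Form R A k)).elim x y

/-- The inclusion of an open subscheme is étale, and étale means standard smooth of relative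
dimension `0`. -/
theorem res_relativeDimension_zero {U U' : X.left.Opens} (hU : IsAffineOpen U)
    (hU' : IsAffineOpen U') (h : U' ≤ U) :
    (res X h).IsStandardSmoothOfRelativeDimension 0 := by
  rw [← RingHom.etale_iff_isStandardSmoothOfRelativeDimension_zero]
  have := (𝟙 X.left : X.left ⟶ X.left).etale_appLE hU hU' h
  exact this

theorem isStandardSmooth_res {U U' : X.left.Opens} (hU : IsAffineOpen U)
    (hU' : IsAffineOpen U') (h : U' ≤ U) {n : ℕ}
    (hn : Algebra.IsStandardSmoothOfRelativeDimension n ℝ (Sec X U)) :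
    Algebra.IsStandardSmoothOfRelativeDimension n ℝ (Sec X U') := by
  let : Algebra (Sec X U) (Sec X U') := (res X h).toAlgebra
  have : IsScalarTower ℝ (Sec X U) (Sec X U') :=
    IsScalarTower.of_algebraMap_eq fun r => (res_structureHom X h r).symm
  have h0 : Algebra.IsStandardSmoothOfRelativeDimension 0 (Sec X U) (Sec X U') :=
    res_relativeDimension_zero hU hU' h
  exact zero_add n ▸ Algebra.IsStandardSmoothOfRelativeDimension.trans n 0 ℝ (Sec X U) (Sec X U')

theorem relativeDimension_eq_of_mem {U U' : X.left.Opens} (hU : IsAffineOpen U)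
    (hU' : IsAffineOpen U') {x : RealPoints X} (hx : x ∈ onOpen X U) (hx' : x ∈ onOpen X U')
    {n n' : ℕ} (hn : Algebra.IsStandardSmoothOfRelativeDimension n ℝ (Sec X U))
    (hn' : Algebra.IsStandardSmoothOfRelativeDimension n' ℝ (Sec X U')) : n = n' := by
  obtain ⟨W, hW, hxW, hWU⟩ := exists_affine_mem x (U ⊓ U') (onOpen_inf ▸ ⟨hx, hx'⟩)
  have := nontrivial_sec hxW
  exact relativeDimension_unique (isStandardSmooth_res hU hW (hWU.trans inf_le_left) hn)
    (isStandardSmooth_res hU' hW (hWU.trans inf_le_right) hn')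

theorem TopForm.span_map_eq_top {U U' : X.left.Opens} (hU : IsAffineOpen U)
    (hU' : IsAffineOpen U') (h : U' ≤ U) {n : ℕ}
    (hn : Algebra.IsStandardSmoothOfRelativeDimension n ℝ (Sec X U)) {ω : Form ℝ (Sec X U) n}
    (hω : Submodule.span (Sec X U) {ω} = ⊤) : Submodule.span (Sec X U')
      {Form.map n (RingHom.id ℝ) (res X h) (res_structureHom X h) ω} = ⊤ := by
  let : Algebra (Sec X U) (Sec X U') := (res X h).toAlgebra
  have : IsScalarTower ℝ (Sec X U) (Sec X U') :=
    IsScalarTower.of_algebraMap_eq fun r => (res_structureHom X h r).symm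
  have h0 : Algebra.IsStandardSmoothOfRelativeDimension 0 (Sec X U) (Sec X U') :=
    res_relativeDimension_zero hU hU' h
  exact RealVar.span_map_eq_top h0 hn hω (res_structureHom X h) rfl

/-- Around every real point, there is a nowhere vanishing top form on a Zariski open set. -/
theorem TopForm.exists_nowhereVanishing {V : X.left.Opens} (hV : IsAffineOpen V) {m : ℕ}
    (hm : Algebra.IsStandardSmoothOfRelativeDimension m ℝ (Sec X V)) :
    ∃ ω : TopForm X V, ω.NowhereVanishing := by
  obtain ⟨_, b, -⟩ := exists_basis_kaehlerDifferential hm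
  let ω₀ : Form ℝ (Sec X V) m := exteriorPower.ιMulti (Sec X V) m b
  have hω₀ : Submodule.span (Sec X V) {ω₀} = ⊤ := by
    rw [eq_top_iff]
    intro z _
    rw [topForm_eq_smul b z]
    exact Submodule.smul_mem _ _ (Submodule.mem_span_singleton_self _)
  -- The value `0` for `n ≠ m` is a dummy: on a nonzero ring of relative dimension `n` the equality
  -- `m = n` is forced.
  let val : ∀ (U : X.left.Opens) (n : ℕ), U ≤ V → Form ℝ (Sec X U) n := fun U n h =>
    if e : m = n then e ▸ Form.map m (RingHom.id ℝ) (res X h) (res_structureHom X h) ω₀ else 0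
  have hval : ∀ (U : X.left.Opens) (h : U ≤ V), val U m h =
      Form.map m (RingHom.id ℝ) (res X h) (res_structureHom X h) ω₀ := fun U h => dif_pos rfl
  have hmn : ∀ (U : X.left.Opens) (n : ℕ), IsAffineOpen U → U ≤ V →
      Algebra.IsStandardSmoothOfRelativeDimension n ℝ (Sec X U) → Nontrivial (Sec X U) → m = n :=
    fun U n hU h hn _ => relativeDimension_unique (isStandardSmooth_res hV hU h hm) hn
  refine ⟨⟨fun U n _ h _ => val U n h, fun U U' n hU hU' hD h hn hn' => ?_⟩,
    fun U n hU hD hn => ?_⟩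
  · by_cases hnt : Nontrivial (Sec X U')
    · obtain rfl := hmn U' n hU' (h.trans hD) hn' hnt
      rw [hval, hval]
      exact Form.map_map _ _ _ (fun a => by
        change _ = ((X.left.presheaf.map _) ≫ (X.left.presheaf.map _)).hom a
        rw [← Functor.map_comp]; rfl) _
    · exact subsingleton_form hnt _ _
  · by_cases hnt : Nontrivial (Sec X U)
    · obtain rfl := hmn U n hU hD hn hnt
      change Submodule.span (Sec X U) {val U m hD} = ⊤
      rw [hval]
      exact TopForm.span_map_eq_top hV hU hD hm hω₀
    · rw [eq_top_iff]
      intro z _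
      rw [subsingleton_form hnt z 0]
      exact Submodule.zero_mem _

variable {φ : X ⟶ Y}

instance (P : RelPatch φ) : IsScalarTower ℝ P.B P.A :=
  IsScalarTower.of_algebraMap_eq fun r => (pull_structureHom φ P.V P.U P.le r).symm

theorem RelPatch.relativeDimension_add (P : RelPatch φ) {k m : ℕ} (hk : P.IsSmooth k)
    (hm : Algebra.IsStandardSmoothOfRelativeDimension m ℝ P.B) :
    Algebra.IsStandardSmoothOfRelativeDimension (k + m) ℝ P.A :=
  add_comm m k ▸ Algebra.IsStandardSmoothOfRelativeDimension.trans m k ℝ P.B P.A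

/-- Shrinking `U` composes with an étale map, which adds `0` to the relative dimension. Shrinking
`V` to a basic open set localizes the base, and standard smoothness over a ring passes to its
localization. -/
theorem RelPatch.isSmooth_mono {P P' : RelPatch φ} (hU : P'.U ≤ P.U) (f : P.B)
    (hV : P'.V = Y.left.basicOpen (U := P.V) f) {k : ℕ} (hk : P.IsSmooth k) : P'.IsSmooth k := by
  have hV' : P'.V ≤ P.V := hV ▸ Scheme.basicOpen_le _ _
  let : Algebra P.A P'.A := (res X hU).toAlgebra
  let : Algebra P.B P'.B := (res Y hV').toAlgebra
  let : Algebra P.B P'.A := ((res X hU).comp P.hom).toAlgebra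
  have : IsScalarTower P.B P.A P'.A := IsScalarTower.of_algebraMap_eq fun _ => rfl
  have : IsScalarTower P.B P'.B P'.A :=
    IsScalarTower.of_algebraMap_eq fun b => res_pull φ P.le P'.le hV' hU b
  have h0 : Algebra.IsStandardSmoothOfRelativeDimension 0 P.A P'.A :=
    res_relativeDimension_zero P.affineU P'.affineU hU
  have h1 : Algebra.IsStandardSmoothOfRelativeDimension k P.B P'.A :=
    zero_add k ▸ Algebra.IsStandardSmoothOfRelativeDimension.trans k 0 P.B P.A P'.A
  have hloc : IsLocalization.Away (R := P.B) f P'.B := by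
    have h := P.affineV.isLocalization_basicOpen f
    obtain ⟨V', U', a1, a2, a3, a4⟩ := P'
    dsimp only at hV
    subst hV
    exact h
  exact isStandardSmooth_of_localization (Submonoid.powers f) h1

/-- Two patches around a real point have a common refinement. -/
theorem RelPatch.exists_refinement (P P' : RelPatch φ) {x : RealPoints X} (hx : x ∈ onOpen X P.U)
    (hx' : x ∈ onOpen X P'.U) : ∃ Q : RelPatch φ, x ∈ onOpen X Q.U ∧ Q.V ≤ P.V ∧ Q.V ≤ P'.V ∧
      Q.U ≤ P.U ∧ Q.U ≤ P'.U ∧ (∀ k, P.IsSmooth k → Q.IsSmooth k) ∧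
      ∀ k, P'.IsSmooth k → Q.IsSmooth k := by
  have hy := realMap_mem_onOpen φ P.V P.U P.le hx
  have hy' := realMap_mem_onOpen φ P'.V P'.U P'.le hx'
  -- The new base must be a basic open set of both `P.V` and `P'.V` at once, so that it is a
  -- localization of both rings.
  obtain ⟨f, g, hfg, hyf⟩ := exists_basicOpen_le_affine_inter P.affineV P'.affineV
    (pt (realMap φ x)) ⟨mem_onOpen.1 hy, mem_onOpen.1 hy'⟩
  have hxf : x ∈ onOpen X (φ.left ⁻¹ᵁ Y.left.basicOpen f) := mem_onOpen.2 hyf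
  obtain ⟨U, hU, hxU, hUle⟩ := exists_affine_mem x (P.U ⊓ P'.U ⊓ φ.left ⁻¹ᵁ Y.left.basicOpen f)
    (by rw [onOpen_inf, onOpen_inf]; exact ⟨⟨hx, hx'⟩, hxf⟩)
  have hV : Y.left.basicOpen f ≤ P.V := Scheme.basicOpen_le _ _
  have hV' : Y.left.basicOpen f ≤ P'.V := hfg ▸ Scheme.basicOpen_le _ _
  have haff : IsAffineOpen (Y.left.basicOpen f) := P.affineV.basicOpen f
  have hsm : ∃ m, Algebra.IsStandardSmoothOfRelativeDimension m ℝ (Sec Y (Y.left.basicOpen f)) := by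
    obtain ⟨m, hm⟩ := P.smoothV
    exact ⟨m, isStandardSmooth_res P.affineV haff hV hm⟩
  let Q : RelPatch φ := ⟨Y.left.basicOpen f, U, haff, hU, hUle.trans inf_le_right, hsm⟩
  refine ⟨Q, hxU, hV, hV', hUle.trans (inf_le_left.trans inf_le_left),
    hUle.trans (inf_le_left.trans inf_le_right), fun k hk => ?_, fun k hk => ?_⟩
  · exact RelPatch.isSmooth_mono (P' := Q) (hUle.trans (inf_le_left.trans inf_le_left)) f rfl hk
  · exact RelPatch.isSmooth_mono (P' := Q) (hUle.trans (inf_le_left.trans inf_le_right)) g hfg hk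

theorem RelPatch.relativeDimension_eq_of_mem (P P' : RelPatch φ) {x : RealPoints X}
    (hx : x ∈ onOpen X P.U) (hx' : x ∈ onOpen X P'.U) {k k' : ℕ} (hk : P.IsSmooth k)
    (hk' : P'.IsSmooth k') : k = k' := by
  obtain ⟨Q, hQ, -, -, -, -, h, h'⟩ := P.exists_refinement P' hx hx'
  have := nontrivial_sec hQ
  exact relativeDimension_unique (h k hk) (h' k' hk')

/-- A lift `θ` is chosen on each patch. Its image in the relative forms does not depend on the
choice, and pullback respects wedge products, so these images are compatible. -/
theorem exists_isQuotient (ωX : TopForm X ⊤) (ωY : TopForm Y ⊤) (hY : ωY.NowhereVanishing) :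
    ∃ η : RelTopForm φ, IsQuotient φ ωX ωY η := by
  have key : ∀ (P : RelPatch φ) (k m : ℕ) (hk : P.IsSmooth k)
    (hm : Algebra.IsStandardSmoothOfRelativeDimension m ℝ P.B), ∃ θ : Form ℝ P.A k,
      θ.wedge (Form.map m (RingHom.id ℝ) P.hom (pull_structureHom φ P.V P.U P.le)
          (ωY.val P.V m P.affineV le_top hm)) =
        ωX.val P.U (k + m) P.affineU le_top (P.relativeDimension_add hk hm) := by
    intro P k m hk hm
    obtain ⟨θ, hθ⟩ := exists_wedge_eq hk hm (hY P.V m P.affineV le_top hm)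
      (pull_structureHom φ P.V P.U P.le)
      (ωX.val P.U (k + m) P.affineU le_top (P.relativeDimension_add hk hm))
    exact ⟨θ, Subtype.ext hθ⟩
  choose θ hθ using key
  -- Each patch gets one dimension of its base. `IsQuotient` asks for all of them, whence the
  -- comparison with an arbitrary `m'` at the end.
  choose m hm using fun P : RelPatch φ => P.smoothV
  refine ⟨⟨fun P k hk => Form.map k (algebraMap ℝ P.B) (RingHom.id P.A)
    (fun r => (pull_structureHom φ P.V P.U P.le r).symm) (θ P k (m P) hk (hm P)), ?_⟩, ?_⟩
  · intro P P' k hV hU hk hk'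
    have : ∀ (n n' : ℕ) (hn : Algebra.IsStandardSmoothOfRelativeDimension n ℝ P.B)
        (hn' : Algebra.IsStandardSmoothOfRelativeDimension n' ℝ P'.B), n = n' →
        Form.map k (res Y hV) (res X hU) (res_pull φ P.le P'.le hV hU)
          (Form.map k (algebraMap ℝ P.B) (RingHom.id P.A)
            (fun r => (pull_structureHom φ P.V P.U P.le r).symm) (θ P k n hk hn)) =
          Form.map k (algebraMap ℝ P'.B) (RingHom.id P'.A)
            (fun r => (pull_structureHom φ P'.V P'.U P'.le r).symm) (θ P' k n' hk' hn') := by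
      rintro n _ hn hn' rfl
      have c₁ : ∀ r, res X hU (algebraMap ℝ P.A r) = algebraMap P'.B P'.A (algebraMap ℝ P'.B r) :=
        fun r => (res_structureHom X hU r).trans (pull_structureHom φ P'.V P'.U P'.le r).symm
      have c₂ : ∀ r, (res X hU).comp P.hom (algebraMap ℝ P.B r) =
          algebraMap ℝ P'.A (RingHom.id ℝ r) := fun r =>
        (congrArg (res X hU) (pull_structureHom φ P.V P.U P.le r)).trans (res_structureHom X hU r)
      have e₁ := Form.map_map (k := k) (R := ℝ) (A := P.A) (R' := P.B) (A' := P.A)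
        (g := algebraMap ℝ P.B) (h := RingHom.id P.A) (fun r => (pull_structureHom φ P.V P.U P.le r).symm)
        (res_pull φ P.le P'.le hV hU) (g'' := algebraMap ℝ P'.B) (h'' := res X hU) c₁
        (fun _ => rfl) (θ P k n hk hn)
      have e₂ := Form.map_map (k := k) (R := ℝ) (A := P.A) (R' := ℝ) (A' := P'.A)
        (g := RingHom.id ℝ) (g' := algebraMap ℝ P'.B) (h' := RingHom.id P'.A)
        (res_structureHom X hU)
        (fun r => (pull_structureHom φ P'.V P'.U P'.le r).symm) (g'' := algebraMap ℝ P'.B)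
        (h'' := res X hU) c₁ (fun _ => rfl) (θ P k n hk hn)
      have hb : Form.map n (RingHom.id ℝ) P'.hom (pull_structureHom φ P'.V P'.U P'.le)
          (ωY.val P'.V n P'.affineV le_top hn') =
          Form.map n (RingHom.id ℝ) (res X hU) (res_structureHom X hU)
            (Form.map n (RingHom.id ℝ) P.hom (pull_structureHom φ P.V P.U P.le)
              (ωY.val P.V n P.affineV le_top hn)) := by
        rw [← ωY.compat P.V P'.V n P.affineV P'.affineV le_top hV hn hn']
        exact (Form.map_map (h' := P'.hom) (g' := RingHom.id ℝ) (res_structureHom Y hV)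
          (pull_structureHom φ P'.V P'.U P'.le) c₂
            (fun b => res_pull φ P.le P'.le hV hU b) _).trans
          (Form.map_map (h := P.hom) (g := RingHom.id ℝ) (pull_structureHom φ P.V P.U P.le)
            (res_structureHom X hU) c₂ (fun b => rfl) _).symm
      refine e₁.trans (e₂.symm.trans ?_)
      -- The restriction of the lift on `P` and the lift chosen on `P'` have the same wedge with the
      -- pullback of `ω_Y`, namely `ω_X` on `P'.U`.
      refine map_eq_of_wedge_eq hk' hn' (hY P'.V n P'.affineV le_top hn')
        (pull_structureHom φ P'.V P'.U P'.le) _ _ _ ?_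
      refine congrArg Subtype.val ((?_ : Form.wedge _ _ = _).trans (hθ P' k n hk' hn').symm)
      change Form.wedge _ (Form.map n (RingHom.id ℝ) P'.hom (pull_structureHom φ P'.V P'.U P'.le)
        (ωY.val P'.V n P'.affineV le_top hn')) = _
      rw [hb, ← Form.map_wedge, hθ]
      exact ωX.compat P.U P'.U (k + n) P.affineU P'.affineU le_top hU _ _
    by_cases hnt : Nontrivial P'.A
    · have hntB : Nontrivial P'.B := P'.hom.domain_nontrivial
      have e : m P = m P' := relativeDimension_unique
        (isStandardSmooth_res P.affineV P'.affineV hV (hm P)) (hm P')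
      refine this (m P) (m P') (hm P) (hm P') e
    · exact subsingleton_form hnt _ _
  · intro P k m' hk hm' hkm
    refine ⟨θ P k m' hk hm', ?_, congrArg Subtype.val (hθ P k m' hk hm')⟩
    by_cases hnt : Nontrivial P.A
    · have hntB : Nontrivial P.B := P.hom.domain_nontrivial
      have : ∀ (m₁ m₂ : ℕ) (h₁ : Algebra.IsStandardSmoothOfRelativeDimension m₁ ℝ P.B)
          (h₂ : Algebra.IsStandardSmoothOfRelativeDimension m₂ ℝ P.B), m₁ = m₂ →
          θ P k m₁ hk h₁ = θ P k m₂ hk h₂ := by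
        rintro m₁ m₂ h₁ h₂ rfl
        rfl
      rw [this m' (m P) hm' (hm P) (relativeDimension_unique hm' (hm P))]
    · exact subsingleton_form hnt _ _

theorem isQuotient_unique (ωX : TopForm X ⊤) (ωY : TopForm Y ⊤) (hY : ωY.NowhereVanishing)
    {η η' : RelTopForm φ} (h : IsQuotient φ ωX ωY η) (h' : IsQuotient φ ωX ωY η') : η = η' := by
  refine RelTopForm.ext (funext fun P => funext fun k => funext fun hk => ?_)
  obtain ⟨m, hm⟩ := P.smoothV
  obtain ⟨θ, hθ, hw⟩ := h P k m hk hm (P.relativeDimension_add hk hm)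
  obtain ⟨θ', hθ', hw'⟩ := h' P k m hk hm (P.relativeDimension_add hk hm)
  rw [← hθ, ← hθ']
  exact map_eq_of_wedge_eq hk hm (hY P.V m P.affineV le_top hm)
    (pull_structureHom φ P.V P.U P.le) _ θ θ' (hw.trans hw'.symm)

end Patches
end RealVar

/-! ### Analytic inverse functions, point derivations, and the construction of charts. -/

namespace RealVar

theorem exists_analytic_local_inverse {E F : Type*} [NormedAddCommGroup E] [NormedSpace ℝ E]
    [CompleteSpace E] [NormedAddCommGroup F] [NormedSpace ℝ F] [CompleteSpace F] {f : E → F} {a : E}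
    (hf : AnalyticAt ℝ f a) {f' : E ≃L[ℝ] F} (hf' : HasFDerivAt f (f' : E →L[ℝ] F) a) :
    ∃ e : OpenPartialHomeomorph E F, a ∈ e.source ∧ (∀ x, e x = f x) ∧
      AnalyticOnNhd ℝ e.symm e.target := by
  have hs : HasStrictFDerivAt f (f' : E →L[ℝ] F) a := by
    rw [← hf'.fderiv]; exact hf.hasStrictFDerivAt
  let e₀ := hs.toOpenPartialHomeomorph
  have ha : a ∈ e₀.source := hs.mem_toOpenPartialHomeomorph_source
  have h₀ : (e₀ : E → F) = f := hs.toOpenPartialHomeomorph_coe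
  have hA : AnalyticAt ℝ e₀.symm (e₀ a) :=
    e₀.analyticAt_symm' ha (h₀ ▸ hf) (i := f') (h₀ ▸ hf'.fderiv)
  -- The inverse is known to be analytic only at the image of `a`; analyticity is an open condition,
  -- so the homeomorphism is shrunk to where it holds.
  let e := (e₀.symm.restrOpen {y | AnalyticAt ℝ e₀.symm y} (isOpen_analyticAt ℝ _)).symm
  refine ⟨e, ?_, fun x => congrFun h₀ x, ?_⟩
  · have : e₀ a ∈ e.target := ⟨e₀.map_source ha, hA⟩
    have := e.map_target this
    change e₀.symm (e₀ a) ∈ e.source at this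
    rwa [e₀.left_inv ha] at this
  · exact fun y hy => hy.2

section Tangent

variable {R A : Type} [CommRing R] [CommRing A] [Algebra R A]

/-- A point derivation factors through the Kähler differentials, where it is determined on a basis.
-/
theorem IsTangent.eq_zero {ev : A →+* ℝ} {v : A → ℝ} (hv : IsTangent R ev v) {n : ℕ}
    (b : Module.Basis (Fin n) A Ω[A⁄R]) {x : Fin n → A}
    (hb : ∀ i, b i = KaehlerDifferential.D R A (x i)) (h : ∀ i, v (x i) = 0) (a : A) : v a = 0 := by
  let : Algebra A ℝ := ev.toAlgebra
  let : Algebra R ℝ := (ev.comp (algebraMap R A)).toAlgebra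
  have : IsScalarTower R A ℝ := IsScalarTower.of_algebraMap_eq fun _ => rfl
  let D : Derivation R A ℝ :=
    Derivation.mk'
      { toFun := v
        map_add' := hv.add
        map_smul' := fun r a => by
          rw [Algebra.smul_def, hv.leibniz, hv.const, mul_zero, add_zero]; rfl }
      (fun a b => hv.leibniz a b)
  have hD : ∀ a, D.liftKaehlerDifferential (KaehlerDifferential.D R A a) = v a :=
    fun a => Derivation.liftKaehlerDifferential_comp_D _ _
  have : D.liftKaehlerDifferential = 0 := by
    refine b.ext fun i => ?_
    rw [hb, hD, h, LinearMap.zero_apply]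
  rw [← hD, this, LinearMap.zero_apply]

theorem exists_presentation {n : ℕ} (h : Algebra.IsStandardSmoothOfRelativeDimension n R A) :
    ∃ (ι σ : Type) (_ : Fintype ι) (_ : Fintype σ) (a : ι → A) (r : σ → MvPolynomial ι R)
      (e : Fin n → ι) (b : Module.Basis (Fin n) A Ω[A⁄R]),
      Function.Surjective (MvPolynomial.aeval a : MvPolynomial ι R →ₐ[R] A) ∧
      Ideal.span (Set.range r) = RingHom.ker (MvPolynomial.aeval a : MvPolynomial ι R →ₐ[R] A) ∧
      Fintype.card ι = Fintype.card σ + n ∧ ∀ i, b i = KaehlerDifferential.D R A (a (e i)) := by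
  obtain ⟨ι, σ, _, _, P, hP⟩ := h.out
  have hc : Nat.card ((Set.range P.map)ᶜ : Set ι) = n := by
    rw [Nat.card_coe_set_eq, Set.ncard_compl, Set.ncard_range_of_injective P.map_inj, ← hP,
      Algebra.Presentation.dimension]
  let e := Finite.equivFinOfCardEq hc
  let _ := Fintype.ofFinite ι
  let _ := Fintype.ofFinite σ
  have hA : (algebraMap P.Ring A : P.Ring → A) =
      (MvPolynomial.aeval P.val : MvPolynomial ι R →ₐ[R] A) := by
    rw [P.algebraMap_eq]; rfl
  refine ⟨ι, σ, inferInstance, inferInstance, P.val, P.relation, fun i => e.symm i,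
    P.basisKaehler.reindex e, ?_, ?_, ?_, fun i => by simp⟩
  · rw [← hA]; exact P.algebraMap_surjective
  · rw [P.span_range_relation_eq_ker]
    ext p
    change algebraMap P.Ring A p = 0 ↔ (MvPolynomial.aeval P.val : MvPolynomial ι R →ₐ[R] A) p = 0
    rw [hA]
  · have h1 := hP
    have h2 : Nat.card σ ≤ Nat.card ι := Nat.card_le_card_of_injective _ P.map_inj
    rw [Algebra.Presentation.dimension] at h1
    simp only [← Nat.card_eq_fintype_card]
    omega

end Tangent

section Polynomial

variable {ι : Type} [Fintype ι]

theorem analyticAt_eval (p : MvPolynomial ι ℝ) (z : ι → ℝ) :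
    AnalyticAt ℝ (fun z : ι → ℝ => MvPolynomial.eval z p) z :=
  AnalyticOnNhd.eval_mvPolynomial p z trivial

/-- A tangent vector to the zero set of the relations of an algebra is a point derivation. -/
theorem isTangent_of_relations {A : Type} [CommRing A] [Algebra ℝ A] {a : ι → A}
    (ha : Function.Surjective (MvPolynomial.aeval a : MvPolynomial ι ℝ →ₐ[ℝ] A)) {σ : Type}
    {r : σ → MvPolynomial ι ℝ}
    (hr : Ideal.span (Set.range r) = RingHom.ker (MvPolynomial.aeval a : MvPolynomial ι ℝ →ₐ[ℝ] A))
    {ev : A →+* ℝ} (hev : ∀ r, ev (algebraMap ℝ A r) = r) {v : ι → ℝ}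
    (hv : ∀ j, fderiv ℝ (fun z => MvPolynomial.eval z (r j)) (fun i => ev (a i)) v = 0) :
    ∃ D : A → ℝ, IsTangent ℝ ev D ∧ ∀ i, D (a i) = v i := by
  set z₀ : ι → ℝ := fun i => ev (a i) with hz₀
  -- The derivative of polynomials in direction `v` at the point. It kills the relations, hence by
  -- the Leibniz rule the ideal that they span, and descends to `A`.
  let T : MvPolynomial ι ℝ → ℝ := fun p => fderiv ℝ (fun z => MvPolynomial.eval z p) z₀ v
  have hd : ∀ p : MvPolynomial ι ℝ, DifferentiableAt ℝ (fun z => MvPolynomial.eval z p) z₀ :=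
    fun p => (analyticAt_eval p z₀).differentiableAt
  have hT_add : ∀ p q, T (p + q) = T p + T q := by
    intro p q
    simp only [T, map_add]
    rw [fderiv_fun_add (hd p) (hd q)]
    rfl
  have hT_mul : ∀ p q, T (p * q) = MvPolynomial.eval z₀ p * T q + MvPolynomial.eval z₀ q * T p := by
    intro p q
    simp only [T, map_mul]
    rw [fderiv_fun_mul (hd p) (hd q)]
    simp
  have hT_C : ∀ c, T (MvPolynomial.C c) = 0 := by
    intro c
    simp [T]
  have hT_X : ∀ i, T (MvPolynomial.X i) = v i := by
    intro i
    simp only [T, MvPolynomial.eval_X]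
    rw [(hasFDerivAt_apply (𝕜 := ℝ) i z₀).fderiv]
    rfl
  have hTz : T 0 = 0 := by simpa using hT_C 0
  have heval : ∀ p, MvPolynomial.eval z₀ p = ev (MvPolynomial.aeval a p) := by
    intro p
    have : MvPolynomial.eval z₀ = ev.comp (MvPolynomial.aeval a).toRingHom := by
      apply MvPolynomial.ringHom_ext
      · intro c
        simp [hev]
      · intro i
        simp [hz₀]
    rw [this]; rfl
  have hker : ∀ p, MvPolynomial.aeval a p = 0 → T p = 0 := by
    intro p hp
    have hp' : p ∈ Ideal.span (Set.range r) := by rw [hr]; exact hp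
    induction hp' using Submodule.span_induction with
    | mem x hx =>
      obtain ⟨j, rfl⟩ := hx
      exact hv j
    | zero => exact hTz
    | add x y hx hy hx' hy' =>
      rw [hT_add, hx' (by rw [← RingHom.mem_ker, ← hr]; exact hx),
        hy' (by rw [← RingHom.mem_ker, ← hr]; exact hy), add_zero]
    | smul c x hx hx' =>
      have h0 : MvPolynomial.aeval a x = 0 := by rw [← RingHom.mem_ker, ← hr]; exact hx
      rw [smul_eq_mul, hT_mul, hx' h0, heval x, h0, map_zero, mul_zero, zero_mul, add_zero]
  have hwd : ∀ p q, MvPolynomial.aeval a p = MvPolynomial.aeval a q → T p = T q := by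
    intro p q hpq
    have h1 : T (p - q) = 0 := hker _ (by rw [map_sub, hpq, sub_self])
    have h2 := hT_add (p - q) q
    rw [sub_add_cancel, h1, zero_add] at h2
    exact h2
  choose s hs using ha
  refine ⟨fun x => T (s x), ⟨fun x y => ?_, fun x y => ?_, fun c => ?_⟩, fun i => ?_⟩
  · rw [← hT_add]
    exact hwd _ _ (by rw [map_add, hs, hs, hs])
  · have := hwd (s (x * y)) (s x * s y) (by rw [map_mul, hs, hs, hs])
    change T (s (x * y)) = ev x * T (s y) + ev y * T (s x)
    rw [this, hT_mul, heval, heval, hs, hs]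
  · refine (hwd _ (MvPolynomial.C c) ?_).trans (hT_C c)
    rw [hs, MvPolynomial.aeval_C]
  · refine (hwd _ (MvPolynomial.X i) ?_).trans (hT_X i)
    rw [hs, MvPolynomial.aeval_X]

end Polynomial

section Charts

variable {X : RScheme}

theorem continuousOn_of_evalAt {U : X.left.Opens} (hU : IsAffineOpen U) {Z : Type*}
    [TopologicalSpace Z] {S : Set Z} {f : Z → RealPoints X} (hf : ∀ z ∈ S, f z ∈ onOpen X U)
    (h : ∀ a : Sec X U, ContinuousOn (fun z => evalAt X a (f z)) S) : ContinuousOn f S := by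
  rw [continuousOn_iff_continuous_domRestrict]
  have hi := isInducing_evalAt hU (id : Sec X U → Sec X U) fun a =>
    ⟨MvPolynomial.X a, by simp⟩
  have : Continuous fun z : S => (⟨f z, hf z z.2⟩ : onOpen X U) := by
    rw [hi.continuous_iff]
    exact continuous_pi fun a => continuousOn_iff_continuous_domRestrict.1 (h a)
  exact continuous_subtype_val.comp this

/-- Construction of a chart from a parametrization `p` and its inverse `q`. -/
theorem exists_chart {F : Set (RealPoints X)} {U : X.left.Opens} {k : ℕ} (hU : IsAffineOpen U)
    (hF : F.Nonempty) {T : Set (Fin k → ℝ)} (hT : IsOpen T) (p : (Fin k → ℝ) → RealPoints X)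
    (q : RealPoints X → (Fin k → ℝ)) {O : Set (RealPoints X)} (hO : IsOpen O)
    (hOU : ∀ x ∈ F, x ∈ O → x ∈ onOpen X U) (hpF : ∀ w ∈ T, p w ∈ F) (hpO : ∀ w ∈ T, p w ∈ O)
    (hq : ∀ x ∈ F, x ∈ O → q x ∈ T) (hqp : ∀ w ∈ T, q (p w) = w)
    (hpq : ∀ x ∈ F, x ∈ O → p (q x) = x) (qc : ContinuousOn q (F ∩ O))
    (an : ∀ a : Sec X U, AnalyticOnNhd ℝ (fun w => evalAt X a (p w)) T)
    (im : ∀ w ∈ T, ∀ v : Fin k → ℝ,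
      (∀ a : Sec X U, fderiv ℝ (fun w => evalAt X a (p w)) w v = 0) → v = 0) :
    ∃ c : Chart X F U k, c.toChart.target = T ∧ (∀ w ∈ T, c.param w = p w) ∧
      (∀ x : F, x ∈ c.toChart.source ↔ (x : RealPoints X) ∈ O) ∧
      ∀ x : F, c.toChart x = q x := by
  classical
  obtain ⟨x₀, hx₀⟩ := hF
  -- The inverse of an `OpenPartialHomeomorph` is a total function; `x₀` is a filler value off `T`.
  let s : (Fin k → ℝ) → F := fun w => if h : w ∈ T then ⟨p w, hpF w h⟩ else ⟨x₀, hx₀⟩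
  have hs : ∀ w ∈ T, (s w : RealPoints X) = p w := fun w hw => by simp [s, hw]
  have heq : ∀ a : Sec X U, ∀ w ∈ T,
      (fun w => evalAt X a (p w)) =ᶠ[𝓝 w] (fun w => evalAt X a (s w)) := by
    intro a w hw
    filter_upwards [hT.mem_nhds hw] with u hu
    rw [hs u hu]
  have pc : ContinuousOn p T := continuousOn_of_evalAt hU (fun w hw => hOU _ (hpF w hw) (hpO w hw))
    fun a => (an a).continuousOn
  let c : Chart X F U k :=
    { toChart :=
        { toFun := fun x => q x
          invFun := s
          source := {x | (x : RealPoints X) ∈ O}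
          target := T
          map_source' := fun x hx => hq x x.2 hx
          map_target' := fun w hw => by
            change (s w : RealPoints X) ∈ O
            rw [hs w hw]; exact hpO w hw
          left_inv' := fun x hx => Subtype.ext (by rw [hs _ (hq x x.2 hx)]; exact hpq x x.2 hx)
          right_inv' := fun w hw => by rw [hs w hw]; exact hqp w hw
          open_source := hO.preimage continuous_subtype_val
          open_target := hT
          continuousOn_toFun := qc.comp continuous_subtype_val.continuousOn fun x hx => ⟨x.2, hx⟩
          continuousOn_invFun := by
            rw [Topology.IsInducing.subtypeVal.continuousOn_iff]
            exact pc.congr fun w hw => hs w hw }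
      source_subset := fun x hx => hOU x x.2 hx
      analytic := fun a w hw => (an a w hw).congr (heq a w hw)
      immersion := fun w hw v hv => im w hw v fun a => by
        rw [(heq a w hw).fderiv_eq]; exact hv a }
  exact ⟨c, rfl, hs, fun x => Iff.rfl, fun x => rfl⟩

end Charts
end RealVar

namespace RealVar

section ChartExistence

variable {X : RScheme}

/-- Evaluation of polynomials at `z` kills the kernel of the presentation and so descends to a ring
map from the sections to `ℝ`. -/
theorem exists_realPoint_of_relations {U : X.left.Opens} (hU : IsAffineOpen U) {ι σ : Type}
    {a : ι → Sec X U} {r : σ → MvPolynomial ι ℝ}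
    (ha : Function.Surjective (MvPolynomial.aeval a : MvPolynomial ι ℝ →ₐ[ℝ] Sec X U))
    (hr : Ideal.span (Set.range r) =
      RingHom.ker (MvPolynomial.aeval a : MvPolynomial ι ℝ →ₐ[ℝ] Sec X U))
    {z : ι → ℝ} (hz : ∀ j, MvPolynomial.eval z (r j) = 0) :
    ∃ x ∈ onOpen X U, ∀ i, evalAt X (a i) x = z i := by
  have hker : RingHom.ker (MvPolynomial.aeval a : MvPolynomial ι ℝ →ₐ[ℝ] Sec X U).toRingHom ≤
      RingHom.ker (MvPolynomial.eval z) := by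
    change RingHom.ker (MvPolynomial.aeval a : MvPolynomial ι ℝ →ₐ[ℝ] Sec X U) ≤ _
    rw [← hr, Ideal.span_le]
    rintro _ ⟨j, rfl⟩
    exact hz j
  let h : Sec X U →+* ℝ := RingHom.liftOfSurjective
    (MvPolynomial.aeval a : MvPolynomial ι ℝ →ₐ[ℝ] Sec X U).toRingHom ha ⟨_, hker⟩
  have hh : ∀ p, h (MvPolynomial.aeval a p) = MvPolynomial.eval z p := fun p =>
    RingHom.liftOfRightInverse_comp_apply _ _ _ ⟨_, hker⟩ p
  obtain ⟨x, hx, hxh⟩ := exists_realPoint hU h fun r => by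
    have := hh (MvPolynomial.C r)
    rwa [MvPolynomial.aeval_C, MvPolynomial.eval_C] at this
  refine ⟨x, hx, fun i => ?_⟩
  have := hh (MvPolynomial.X i)
  rw [MvPolynomial.aeval_X, MvPolynomial.eval_X] at this
  rw [evalAt_of_mem _ _ hx, hxh, this]

/-- The real points of a standard smooth affine scheme have charts. -/
theorem exists_chart_of_isStandardSmooth {U : X.left.Opens} (hU : IsAffineOpen U) {n : ℕ}
    (hn : Algebra.IsStandardSmoothOfRelativeDimension n ℝ (Sec X U)) {x₀ : RealPoints X}
    (hx₀ : x₀ ∈ onOpen X U) :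
    ∃ c : Chart X Set.univ U n, ⟨x₀, trivial⟩ ∈ c.toChart.source := by
  classical
  obtain ⟨ι, σ, _, _, a, r, e, b, ha, hr, hcard, hb⟩ := exists_presentation hn
  let z : RealPoints X → ι → ℝ := fun x i => evalAt X (a i) x
  have hzc : ContinuousOn z (onOpen X U) := continuousOn_pi.2 fun i => continuousOn_evalAt (a i)
  have hzr : ∀ x ∈ onOpen X U, ∀ j, MvPolynomial.eval (z x) (r j) = 0 := by
    intro x hx j
    rw [← evalAt_aeval a (r j) hx]
    have : r j ∈ RingHom.ker (MvPolynomial.aeval a : MvPolynomial ι ℝ →ₐ[ℝ] Sec X U) :=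
      hr ▸ Ideal.subset_span ⟨j, rfl⟩
    rw [RingHom.mem_ker.1 this, evalAt_of_mem _ _ hx, map_zero]
  -- The relations together with the `n` free variables are to be coordinates of the ambient space
  -- near the point.
  let G : (ι → ℝ) → (σ → ℝ) × (Fin n → ℝ) := fun u =>
    (fun j => MvPolynomial.eval u (r j), fun i => u (e i))
  let L : (ι → ℝ) →L[ℝ] (σ → ℝ) × (Fin n → ℝ) :=
    (ContinuousLinearMap.pi fun j => fderiv ℝ (fun u => MvPolynomial.eval u (r j)) (z x₀)).prod
      (ContinuousLinearMap.pi fun i => ContinuousLinearMap.proj (e i))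
  have hGL : HasFDerivAt G L (z x₀) := by
    refine HasFDerivAt.prodMk (hasFDerivAt_pi.2 fun j => ?_) (hasFDerivAt_pi.2 fun i => ?_)
    · exact (analyticAt_eval (r j) _).differentiableAt.hasFDerivAt
    · exact hasFDerivAt_apply (e i) (z x₀)
  have hGa : AnalyticAt ℝ G (z x₀) := by
    refine AnalyticAt.prod (AnalyticAt.pi fun j => analyticAt_eval (r j) _)
      (AnalyticAt.pi fun i => ?_)
    exact (ContinuousLinearMap.proj (R := ℝ) (φ := fun _ : ι => ℝ) (e i)).analyticAt _
  -- A vector killed by the differentials of all relations is a point derivation. If its free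
  -- components vanish too, it vanishes on a basis of the differentials, hence altogether.
  have hLinj : Function.Injective L := by
    rw [injective_iff_map_eq_zero]
    intro v hv
    have h1 : ∀ j, fderiv ℝ (fun u => MvPolynomial.eval u (r j)) (z x₀) v = 0 :=
      fun j => congrFun (congrArg Prod.fst hv) j
    have h2 : ∀ i, v (e i) = 0 := fun i => congrFun (congrArg Prod.snd hv) i
    have hz₀ : z x₀ = fun i => evalHom X U x₀ hx₀ (a i) :=
      funext fun i => evalAt_of_mem _ _ hx₀
    rw [hz₀] at h1
    obtain ⟨D, hD, hDv⟩ := isTangent_of_relations ha hr (evalHom_structureHom X U x₀ hx₀) h1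
    ext i
    rw [← hDv, hD.eq_zero b hb (fun i => by rw [hDv, h2])]
    rfl
  let L' : (ι → ℝ) ≃L[ℝ] (σ → ℝ) × (Fin n → ℝ) :=
    (LinearMap.linearEquivOfInjective (L : (ι → ℝ) →ₗ[ℝ] _) hLinj
      (by simp [hcard])).toContinuousLinearEquiv
  have hL' : (L' : (ι → ℝ) →L[ℝ] (σ → ℝ) × (Fin n → ℝ)) = L := by
    ext v <;> rfl
  obtain ⟨E, hE₀, hEG, hEa⟩ := exists_analytic_local_inverse hGa (f' := L') (hL'.symm ▸ hGL)
  -- In the coordinates `E` the real points of `U` are the slice where all relations are zero.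
  let T : Set (Fin n → ℝ) := {w | ((0 : σ → ℝ), w) ∈ E.target}
  have hT : IsOpen T := E.open_target.preimage (by fun_prop)
  have hGE : ∀ w ∈ T, G (E.symm (0, w)) = (0, w) := fun w hw => by
    rw [← hEG]; exact E.right_inv hw
  have hpt : ∀ w ∈ T, ∃ x ∈ onOpen X U, ∀ i, evalAt X (a i) x = E.symm (0, w) i := fun w hw =>
    exists_realPoint_of_relations hU ha hr fun j => congrFun (congrArg Prod.fst (hGE w hw)) j
  have : Nonempty (RealPoints X) := ⟨x₀⟩
  choose! p hpU hpz using hpt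
  have hpz' : ∀ w ∈ T, z (p w) = E.symm (0, w) := fun w hw => funext (hpz w hw)
  let q : RealPoints X → (Fin n → ℝ) := fun x i => z x (e i)
  have hGz : ∀ x ∈ onOpen X U, G (z x) = (0, q x) := fun x hx =>
    Prod.ext (funext fun j => hzr x hx j) rfl
  let O : Set (RealPoints X) := onOpen X U ∩ z ⁻¹' E.source
  have hO : IsOpen O := hzc.isOpen_inter_preimage (isOpen_onOpen U) E.open_source
  have hqT : ∀ x ∈ O, q x ∈ T := fun x hx => by
    change ((0 : σ → ℝ), q x) ∈ E.target
    rw [← hGz x hx.1, ← hEG]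
    exact E.map_source hx.2
  have hqp : ∀ w ∈ T, q (p w) = w := fun w hw => by
    have := congrArg Prod.snd (hGE w hw)
    rw [← hpz' w hw] at this
    exact this
  obtain ⟨c, hcT, hcp, hcs, hcq⟩ := exists_chart (F := Set.univ) hU ⟨x₀, trivial⟩ hT p q hO
    (fun x _ hx => hx.1) (fun _ _ => trivial)
    (fun w hw => ⟨hpU w hw, by
      change z (p w) ∈ E.source
      rw [hpz' w hw]; exact E.map_target hw⟩)
    (fun x _ hx => hqT x hx) hqp
    (fun x _ hx => by
      have h1 : z (p (q x)) = z x := by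
        rw [hpz' _ (hqT x hx), ← hGz x hx.1, ← hEG]
        exact E.left_inv hx.2
      refine realPoint_ext hU (hpU _ (hqT x hx)) hx.1 fun s => ?_
      obtain ⟨P, rfl⟩ := ha s
      rw [evalAt_aeval a P (hpU _ (hqT x hx)), evalAt_aeval a P hx.1]
      exact congrArg (fun u => MvPolynomial.eval u P) h1)
    ((continuousOn_pi.2 fun i => continuousOn_evalAt (a (e i))).mono fun x hx => hx.2.1)
    (fun s w hw => by
      obtain ⟨P, rfl⟩ := ha s
      have h1 : AnalyticAt ℝ (fun w : Fin n → ℝ => MvPolynomial.eval (E.symm ((0 : σ → ℝ), w)) P) w :=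
        (analyticAt_eval P _).comp ((hEa _ hw).comp (analyticAt_const.prod analyticAt_id))
      refine h1.congr ?_
      filter_upwards [hT.mem_nhds hw] with u hu
      rw [evalAt_aeval a P (hpU u hu), ← hpz' u hu])
    (fun w hw v hv => by
      ext i
      have h1 : (fun w => evalAt X (a (e i)) (p w)) =ᶠ[𝓝 w] fun w => w i := by
        filter_upwards [hT.mem_nhds hw] with u hu
        exact congrFun (hqp u hu) i
      have h2 := hv (a (e i))
      rw [h1.fderiv_eq, (hasFDerivAt_apply (𝕜 := ℝ) i w).fderiv] at h2
      exact h2)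
  exact ⟨c, (hcs _).2 ⟨hx₀, hE₀⟩⟩

end ChartExistence

/-! ### Restriction of charts and transition maps. -/

namespace Chart

variable {X : RScheme} {F : Set (RealPoints X)} {U : X.left.Opens} {k : ℕ}

theorem continuousOn_param (c : Chart X F U k) : ContinuousOn c.param c.toChart.target :=
  continuous_subtype_val.comp_continuousOn c.toChart.continuousOn_symm

theorem analyticAt_evalAt (c : Chart X F U k) (hU : IsAffineOpen U) {W : X.left.Opens}
    (a : Sec X W) {w : Fin k → ℝ} (hw : w ∈ c.toChart.target) (hW : c.param w ∈ onOpen X W) :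
    AnalyticAt ℝ (fun w => evalAt X a (c.param w)) w := by
  obtain ⟨f, hf, hfW, hfr⟩ := exists_fraction hU W (c.param_mem hw) hW
  obtain ⟨b, n, hb⟩ := hfr a
  have h1 : AnalyticAt ℝ (fun w => evalAt X b (c.param w) / evalAt X f (c.param w) ^ n) w :=
    (c.analytic b w hw).div ((c.analytic f w hw).pow n) (pow_ne_zero _ hf)
  refine h1.congr ?_
  filter_upwards [c.toChart.open_target.mem_nhds hw,
    (c.analytic f w hw).continuousAt.eventually_ne hf] with u hu huf
  exact (hb _ (c.param_mem hu) huf).symm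

theorem param_mem_nhds (c : Chart X F U k) {N : Set (RealPoints X)} (hN : IsOpen N)
    {w : Fin k → ℝ} (hw : w ∈ c.toChart.target) (h : c.param w ∈ N) : c.param ⁻¹' N ∈ 𝓝 w :=
  (c.continuousOn_param.continuousAt (c.toChart.open_target.mem_nhds hw)).preimage_mem_nhds
    (hN.mem_nhds h)

/-- The restriction of a chart to a Zariski open subset. -/
def restr (c : Chart X F U k) (hU : IsAffineOpen U) {W : X.left.Opens} (hW : W ≤ U) :
    Chart X F W k where
  toChart := c.toChart.restrOpen {x | (x : RealPoints X) ∈ onOpen X W}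
    ((isOpen_onOpen W).preimage continuous_subtype_val)
  source_subset := fun x hx => hx.2
  analytic := fun a w hw => c.analyticAt_evalAt hU a hw.1 hw.2
  immersion := fun w hw v hv => c.immersion w hw.1 v fun a => by
    rw [← hv (res X hW a)]
    congr 1
    apply Filter.EventuallyEq.fderiv_eq
    filter_upwards [c.param_mem_nhds (isOpen_onOpen W) hw.1 hw.2] with u hu
    exact (evalAt_res hW hu a).symm

theorem mem_restr_target (c : Chart X F U k) (hU : IsAffineOpen U) {W : X.left.Opens} (hW : W ≤ U)
    {w : Fin k → ℝ} :
    w ∈ (c.restr hU hW).toChart.target ↔ w ∈ c.toChart.target ∧ c.param w ∈ onOpen X W :=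
  Iff.rfl

theorem coeff_of_mem (c : Chart X F U k) {R : Type} [CommRing R] [Algebra R (Sec X U)]
    (hR : ∀ r : R, ∃ t : ℝ, ∀ x ∈ F, x ∈ onOpen X U → evalAt X (algebraMap R (Sec X U) r) x = t)
    (θ : Form R (Sec X U) k) {w : Fin k → ℝ} (hw : w ∈ c.toChart.target) :
    c.coeff hR θ w = formEval (evalHom X U (c.param w) (c.param_mem hw)) (c.frame w)
      (fun j => c.frame_isTangent hR hw j) θ := dif_pos hw

theorem coeff_restr (c : Chart X F U k) (hU : IsAffineOpen U) {W : X.left.Opens} (hW : W ≤ U)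
    {R R' : Type} [CommRing R] [Algebra R (Sec X U)] [CommRing R'] [Algebra R' (Sec X W)]
    (hR : ∀ r : R, ∃ t : ℝ, ∀ x ∈ F, x ∈ onOpen X U → evalAt X (algebraMap R (Sec X U) r) x = t)
    (hR' : ∀ r : R', ∃ t : ℝ, ∀ x ∈ F, x ∈ onOpen X W → evalAt X (algebraMap R' (Sec X W) r) x = t)
    {g : R →+* R'} (comm : ∀ r, res X hW (algebraMap R (Sec X U) r) = algebraMap R' (Sec X W) (g r))
    (θ : Form R (Sec X U) k) {w : Fin k → ℝ} (hw : w ∈ c.toChart.target)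
    (hwW : c.param w ∈ onOpen X W) :
    (c.restr hU hW).coeff hR' (Form.map k g (res X hW) comm θ) w = c.coeff hR θ w := by
  rw [coeff_of_mem _ _ _ hw, coeff_of_mem _ _ _ ((c.mem_restr_target hU hW).2 ⟨hw, hwW⟩)]
  refine formEval_map _ _ _ comm _ _ _ (fun a => ?_) (fun j a => ?_) θ
  · exact (evalHom_res hW hwW a).symm
  · unfold frame
    congr 1
    apply Filter.EventuallyEq.fderiv_eq
    filter_upwards [c.param_mem_nhds (isOpen_onOpen W) hw hwW] with u hu
    exact (evalAt_res hW hu a).symm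

/-- There are regular functions with prescribed differentials at a point of a chart. -/
theorem exists_coordinates (c : Chart X F U k) {w : Fin k → ℝ} (hw : w ∈ c.toChart.target) :
    ∃ a : Fin k → Sec X U, ∀ i, HasFDerivAt (fun w => evalAt X (a i) (c.param w))
      (ContinuousLinearMap.proj i : (Fin k → ℝ) →L[ℝ] ℝ) w := by
  have hd : ∀ a : Sec X U, DifferentiableAt ℝ (fun w => evalAt X a (c.param w)) w :=
    fun a => (c.analytic a w hw).differentiableAt
  have hn : c.toChart.target ∈ 𝓝 w := c.toChart.open_target.mem_nhds hw
  let Φ : Sec X U →ₗ[ℝ] Module.Dual ℝ (Fin k → ℝ) :=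
    { toFun := fun a => (fderiv ℝ (fun w => evalAt X a (c.param w)) w : (Fin k → ℝ) →ₗ[ℝ] ℝ)
      map_add' := fun a b => by
        have : (fun w => evalAt X (a + b) (c.param w)) =ᶠ[𝓝 w]
            (fun w => evalAt X a (c.param w)) + fun w => evalAt X b (c.param w) := by
          filter_upwards [hn] with u hu
          simp [evalAt_of_mem X _ (c.param_mem hu)]
        rw [this.fderiv_eq, fderiv_add (hd a) (hd b)]
        rfl
      map_smul' := fun r a => by
        have : (fun w => evalAt X (r • a) (c.param w)) =ᶠ[𝓝 w]
            r • fun w => evalAt X a (c.param w) := by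
          filter_upwards [hn] with u hu
          simp [evalAt_of_mem X _ (c.param_mem hu), Algebra.smul_def, evalHom_structureHom]
        rw [this.fderiv_eq, fderiv_const_smul (hd a)]
        rfl }
  -- The immersion condition says that no nonzero vector is annihilated by all differentials of
  -- regular functions; by duality these differentials fill the dual space.
  have htop : LinearMap.range Φ = ⊤ := by
    have h0 : (LinearMap.range Φ).dualCoannihilator = ⊥ := by
      rw [eq_bot_iff]
      intro v hv
      rw [Submodule.mem_dualCoannihilator] at hv
      exact c.immersion w hw v fun a => hv _ ⟨a, rfl⟩
    rw [← Subspace.dualCoannihilator_dualAnnihilator_eq (W := LinearMap.range Φ), h0,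
      Submodule.dualAnnihilator_bot]
  have : ∀ i : Fin k, ∃ a, Φ a = LinearMap.proj i := fun i =>
    LinearMap.range_eq_top.1 htop _
  choose a ha using this
  refine ⟨a, fun i => ?_⟩
  have h1 : fderiv ℝ (fun w => evalAt X (a i) (c.param w)) w = ContinuousLinearMap.proj i :=
    ContinuousLinearMap.ext fun v => LinearMap.congr_fun (ha i) v
  exact h1 ▸ (hd (a i)).hasFDerivAt

/-- The transition map between two charts. -/
def transition {U' : X.left.Opens} (c : Chart X F U k) (c' : Chart X F U' k) (w : Fin k → ℝ) :
    Fin k → ℝ :=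
  c'.toChart (c.toChart.symm w)

theorem transition_eq {U' : X.left.Opens} (c : Chart X F U k) (c' : Chart X F U' k)
    {w w' : Fin k → ℝ} (hw' : w' ∈ c'.toChart.target) (h : c.param w = c'.param w') :
    c.transition c' w = w' := by
  have : c.toChart.symm w = c'.toChart.symm w' := Subtype.ext h
  rw [transition, this, c'.toChart.right_inv hw']

/-- The coordinates of a chart are analytic along every map that regular functions see as analytic. -/
theorem analyticAt_toChart (c : Chart X F U k) {E : Type*} [NormedAddCommGroup E] [NormedSpace ℝ E]
    {g : E → F} {z : E} (hg : ContinuousAt g z) (hz : g z ∈ c.toChart.source)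
    (ha : ∀ a : Sec X U, AnalyticAt ℝ (fun u => evalAt X a (g u)) z) :
    AnalyticAt ℝ (fun u => c.toChart (g u)) z := by
  have hw : c.toChart (g z) ∈ c.toChart.target := c.toChart.map_source hz
  obtain ⟨a, haw⟩ := c.exists_coordinates hw
  -- The differential of `G` at the point is the identity, so its analytic local inverse recovers
  -- the coordinates from the regular functions `a i`.
  let G : (Fin k → ℝ) → Fin k → ℝ := fun u i => evalAt X (a i) (c.param u)
  have hG : HasFDerivAt G ((ContinuousLinearEquiv.refl ℝ (Fin k → ℝ) : _ →L[ℝ] _))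
      (c.toChart (g z)) := by
    rw [hasFDerivAt_pi']
    exact fun i => haw i
  have hGa : AnalyticAt ℝ G (c.toChart (g z)) := AnalyticAt.pi fun i => c.analytic (a i) _ hw
  obtain ⟨e, he, heG, hea⟩ := exists_analytic_local_inverse hGa hG
  have hp : ∀ x ∈ c.toChart.source, G (c.toChart x) = fun i => evalAt X (a i) x := fun x hx => by
    funext i
    change evalAt X (a i) (c.param (c.toChart x)) = _
    rw [show c.param (c.toChart x) = x from congrArg Subtype.val (c.toChart.left_inv hx)]
  have hH : AnalyticAt ℝ (fun u i => evalAt X (a i) (g u)) z := AnalyticAt.pi fun i => ha (a i)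
  have hcc : ContinuousAt (fun u => c.toChart (g u)) z :=
    (c.toChart.continuousAt hz).comp (f := g) hg
  have heq : (fun u => c.toChart (g u)) =ᶠ[𝓝 z] fun u => e.symm (fun i => evalAt X (a i) (g u)) := by
    filter_upwards [hcc.preimage_mem_nhds (e.open_source.mem_nhds he),
      hg.preimage_mem_nhds (c.toChart.open_source.mem_nhds hz)] with u hu hus
    rw [← hp _ hus, ← heG, e.left_inv hu]
  have hv : (fun i => evalAt X (a i) (g z)) ∈ e.target := by
    rw [← hp _ hz, ← heG]
    exact e.map_source he
  exact ((hea _ hv).comp (f := fun u i => evalAt X (a i) (g u)) hH).congr heq.symm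

theorem differentiableAt_transition {U' : X.left.Opens} (c : Chart X F U k) (c' : Chart X F U' k)
    (hU : IsAffineOpen U) {w w' : Fin k → ℝ} (hw : w ∈ c.toChart.target)
    (hw' : w' ∈ c'.toChart.target) (h : c.param w = c'.param w') :
    DifferentiableAt ℝ (c.transition c') w := by
  refine (c'.analyticAt_toChart (g := c.toChart.symm) (c.toChart.symm.continuousAt hw) ?_
    fun a => c.analyticAt_evalAt hU a hw (h ▸ c'.param_mem hw')).differentiableAt
  have : c.toChart.symm w = c'.toChart.symm w' := Subtype.ext h
  rw [this]; exact c'.toChart.map_target hw'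

/-- By the chain rule the coordinate vectors of `c` are combinations of those of `c'`, with the
Jacobian matrix of the transition map as coefficients. -/
theorem coeff_transition (c c' : Chart X F U k) (hU : IsAffineOpen U) {R : Type} [CommRing R]
    [Algebra R (Sec X U)]
    (hR : ∀ r : R, ∃ t : ℝ, ∀ x ∈ F, x ∈ onOpen X U → evalAt X (algebraMap R (Sec X U) r) x = t)
    (θ : Form R (Sec X U) k) {w w' : Fin k → ℝ} (hw : w ∈ c.toChart.target)
    (hw' : w' ∈ c'.toChart.target) (h : c.param w = c'.param w') :
    c.coeff hR θ w = c'.coeff hR θ w' * (fderiv ℝ (c.transition c') w).det := by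
  rw [coeff_of_mem _ _ _ hw, coeff_of_mem _ _ _ hw']
  have hdet : (fderiv ℝ (c.transition c') w).det = (LinearMap.toMatrix'
      (fderiv ℝ (c.transition c') w : (Fin k → ℝ) →ₗ[ℝ] (Fin k → ℝ))).det :=
    (LinearMap.det_toMatrix' _).symm
  rw [hdet, ← formEval_linear_comb (evalHom X U (c'.param w') (c'.param_mem hw')) (c'.frame w')
    (fun j => c'.frame_isTangent hR hw' j) _ (v' := c.frame w)
    (fun j => by
      have := c.frame_isTangent hR hw j
      have e : evalHom X U (c.param w) (c.param_mem hw) =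
        evalHom X U (c'.param w') (c'.param_mem hw') := by congr 1
      rwa [e] at this)]
  · exact formEval_congr _ _ _ _ (by congr 1) rfl _
  · intro j a
    have hτ : c.transition c' w = w' := c.transition_eq c' hw' h
    have hsrc : c.toChart.symm w ∈ c'.toChart.source := by
      have : c.toChart.symm w = c'.toChart.symm w' := Subtype.ext h
      rw [this]; exact c'.toChart.map_target hw'
    have h1 : (fun u => evalAt X a (c.param u)) =ᶠ[𝓝 w]
        (fun u => evalAt X a (c'.param u)) ∘ c.transition c' := by
      filter_upwards [(c.toChart.symm.continuousAt hw).preimage_mem_nhds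
        (c'.toChart.open_source.mem_nhds hsrc)] with u hus
      have : c'.param (c'.toChart (c.toChart.symm u)) = c.param u :=
        congrArg Subtype.val (c'.toChart.left_inv hus)
      rw [Function.comp_apply, transition, this]
    have h2 : DifferentiableAt ℝ (fun u => evalAt X a (c'.param u)) (c.transition c' w) :=
      hτ ▸ (c'.analytic a w' hw').differentiableAt
    unfold frame
    rw [h1.fderiv_eq, fderiv_comp _ h2 (c.differentiableAt_transition c' hU hw hw' h), hτ,
      ContinuousLinearMap.comp_apply]
    rw [pi_eq_sum_univ' (fderiv ℝ (c.transition c') w (Pi.single j 1)), map_sum]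
    refine Finset.sum_congr rfl fun i _ => ?_
    rw [map_smul, smul_eq_mul, mul_comm, LinearMap.toMatrix'_apply]
    congr 2

end Chart
end RealVar

namespace RealVar

/-! ### Gluing of measures. -/

section Glue

/-- Compatible measures on a family of sets `F ∩ O i` with `O i` open glue. -/
theorem exists_glued_measure {T : Type*} [TopologicalSpace T] [SecondCountableTopology T]
    [MeasurableSpace T] [BorelSpace T] {ι : Type*} [Nonempty ι] {F : Set T} (hF : MeasurableSet F)
    {O : ι → Set T} (hO : ∀ i, IsOpen (O i)) {μ : ι → Measure T}
    (h0 : ∀ i, μ i (F ∩ O i)ᶜ = 0)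
    (hμ : ∀ i j S, MeasurableSet S → μ i (S ∩ (F ∩ O j)) = μ j (S ∩ (F ∩ O i))) :
    ∃ ν : Measure T, (∀ i S, MeasurableSet S → ν (S ∩ (F ∩ O i)) = μ i S) ∧
      ν (F ∩ ⋃ i, O i)ᶜ = 0 := by
  obtain ⟨J, hJ, hJO⟩ := TopologicalSpace.isOpen_iUnion_countable O hO
  have i₀ : ι := Classical.arbitrary ι
  -- The countable subfamily may be empty; inserting `i₀` makes it the range of a sequence.
  obtain ⟨f, hf⟩ := (hJ.insert i₀).exists_eq_range (Set.insert_nonempty _ _)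
  have hcov : ⋃ n, O (f n) = ⋃ i, O i := by
    apply (Set.iUnion_subset fun n => Set.subset_iUnion O (f n)).antisymm
    rw [← hJO]
    refine Set.iUnion₂_subset fun j hj => ?_
    have : j ∈ Set.range f := hf ▸ Set.mem_insert_of_mem _ hj
    obtain ⟨n, rfl⟩ := this
    exact Set.subset_iUnion (fun n => O (f n)) n
  have hD : ∀ i, MeasurableSet (F ∩ O i) := fun i => hF.inter (hO i).measurableSet
  -- Disjoint pieces, each inside one member of the cover. By compatibility, any `μ i` may replace
  -- `μ (f n)` on the part of the piece inside `O i`.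
  let E : ℕ → Set T := disjointed fun n => F ∩ O (f n)
  have hE : ∀ n, MeasurableSet (E n) := fun n => .disjointed (fun n => hD (f n)) n
  have hEd : Pairwise (Function.onFun Disjoint E) := disjoint_disjointed _
  have hEs : ∀ n, E n ⊆ F ∩ O (f n) := fun n => disjointed_subset _ n
  have hEU : ⋃ n, E n = F ∩ ⋃ i, O i := by
    rw [iUnion_disjointed, ← Set.inter_iUnion, hcov]
  have hconc : ∀ i S, μ i (S ∩ (F ∩ O i)) = μ i S := fun i S =>
    measure_inter_conull (h0 i)
  refine ⟨Measure.sum fun n => (μ (f n)).restrict (E n), fun i S hS => ?_, ?_⟩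
  · rw [Measure.sum_apply _ (hS.inter (hD i))]
    have h1 : ∀ n, (μ (f n)).restrict (E n) (S ∩ (F ∩ O i)) = μ i (S ∩ E n) := fun n => by
      rw [Measure.restrict_apply (hS.inter (hD i)),
        show S ∩ (F ∩ O i) ∩ E n = (S ∩ E n) ∩ (F ∩ O i) by
          rw [Set.inter_right_comm], hμ _ _ _ (hS.inter (hE n))]
      congr 1
      exact Set.inter_eq_left.2 (Set.inter_subset_right.trans (hEs n))
    simp only [h1]
    rw [← measure_iUnion (fun a b hab => (hEd hab).mono Set.inter_subset_right Set.inter_subset_right)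
      fun n => hS.inter (hE n), ← Set.inter_iUnion, hEU]
    refine measure_inter_conull (measure_mono_null ?_ (h0 i))
    exact Set.compl_subset_compl.2 (Set.inter_subset_inter_right _ (Set.subset_iUnion O i))
  · rw [← hEU]
    have hm : MeasurableSet (⋃ n, E n)ᶜ := (MeasurableSet.iUnion hE).compl
    rw [Measure.sum_apply _ hm, ENNReal.tsum_eq_zero]
    intro n
    rw [Measure.restrict_apply hm]
    have : (⋃ n, E n)ᶜ ∩ E n = ∅ := by
      rw [← Set.disjoint_iff_inter_eq_empty]
      exact disjoint_compl_left.mono_right (Set.subset_iUnion E n)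
    rw [this, measure_empty]

/-- The glued measure dominates every `μ j`, hence the supremum, and equals `μ i` on the `i`-th set;
the supremum is at least `μ i`. -/
theorem iSup_measure_inter {T : Type*} [TopologicalSpace T] [SecondCountableTopology T]
    [MeasurableSpace T] [BorelSpace T] {ι : Type*} {F : Set T} (hF : MeasurableSet F)
    {O : ι → Set T} (hO : ∀ i, IsOpen (O i)) {μ : ι → Measure T}
    (h0 : ∀ i, μ i (F ∩ O i)ᶜ = 0)
    (hμ : ∀ i j S, MeasurableSet S → μ i (S ∩ (F ∩ O j)) = μ j (S ∩ (F ∩ O i)))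
    (i : ι) {S : Set T} (hS : MeasurableSet S) : (⨆ j, μ j) (S ∩ (F ∩ O i)) = μ i S := by
  have : Nonempty ι := ⟨i⟩
  obtain ⟨ν, hν, -⟩ := exists_glued_measure hF hO h0 hμ
  have hle : ∀ j, μ j ≤ ν := fun j => Measure.le_iff.2 fun S hS => by
    rw [← hν j S hS]; exact measure_mono Set.inter_subset_left
  apply le_antisymm
  · rw [← hν i S hS]
    exact iSup_le hle _
  · rw [← measure_inter_conull (h0 i) (s := S)]
    exact le_iSup μ i _

theorem iSup_measure_compl {T : Type*} [TopologicalSpace T] [SecondCountableTopology T]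
    [MeasurableSpace T] [BorelSpace T] {ι : Type*} {F : Set T} (hF : MeasurableSet F)
    {O : ι → Set T} (hO : ∀ i, IsOpen (O i)) {μ : ι → Measure T}
    (h0 : ∀ i, μ i (F ∩ O i)ᶜ = 0)
    (hμ : ∀ i j S, MeasurableSet S → μ i (S ∩ (F ∩ O j)) = μ j (S ∩ (F ∩ O i))) :
    (⨆ j, μ j) (F ∩ ⋃ i, O i)ᶜ = 0 := by
  cases isEmpty_or_nonempty ι with
  | inl h => exact le_antisymm ((iSup_le fun i => h.elim i : ⨆ j, μ j ≤ 0) _) zero_le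
  | inr h =>
    obtain ⟨ν, hν, hν0⟩ := exists_glued_measure hF hO h0 hμ
    have hle : ∀ j, μ j ≤ ν := fun j => Measure.le_iff.2 fun S hS => by
      rw [← hν j S hS]; exact measure_mono Set.inter_subset_left
    exact le_antisymm (hν0 ▸ iSup_le hle _) zero_le

end Glue

/-! ### The measure of a form in one chart, and on overlaps. -/

namespace Chart

variable {X : RScheme} {F : Set (RealPoints X)} {U : X.left.Opens} {k : ℕ}

/-- The domain of a chart, as a subset of `X(ℝ)`. -/
def dom (c : Chart X F U k) : Set (RealPoints X) := Subtype.val '' c.toChart.source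

theorem param_mem_dom (c : Chart X F U k) {w : Fin k → ℝ} (hw : w ∈ c.toChart.target) :
    c.param w ∈ c.dom := ⟨_, c.toChart.map_target hw, rfl⟩

theorem mem_dom (c : Chart X F U k) {x : RealPoints X} :
    x ∈ c.dom ↔ ∃ w ∈ c.toChart.target, c.param w = x := by
  constructor
  · rintro ⟨x, hx, rfl⟩
    exact ⟨c.toChart x, c.toChart.map_source hx, congrArg Subtype.val (c.toChart.left_inv hx)⟩
  · rintro ⟨w, hw, rfl⟩
    exact c.param_mem_dom hw

theorem exists_dom_eq (c : Chart X F U k) : ∃ O, IsOpen O ∧ c.dom = F ∩ O := by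
  obtain ⟨O, hO, h⟩ := isOpen_induced_iff.1 c.toChart.open_source
  exact ⟨O, hO, by rw [dom, ← h, Subtype.image_preimage_coe]⟩

theorem dom_subset_onOpen (c : Chart X F U k) : c.dom ⊆ onOpen X U := by
  rintro _ ⟨x, hx, rfl⟩
  exact c.source_subset x hx

theorem measurableSet_dom (c : Chart X F U k) (hF : MeasurableSet F) : MeasurableSet c.dom := by
  obtain ⟨O, hO, h⟩ := c.exists_dom_eq
  exact h ▸ hF.inter hO.measurableSet

theorem measurableSet_target (c : Chart X F U k) : MeasurableSet c.toChart.target :=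
  c.toChart.open_target.measurableSet

theorem measurableSet_inter_preimage (c : Chart X F U k) {S : Set (RealPoints X)}
    (hS : MeasurableSet S) : MeasurableSet (c.toChart.target ∩ c.param ⁻¹' S) := by
  have := c.measurableSet_target.subtype_image
    ((continuousOn_iff_continuous_domRestrict.1 c.continuousOn_param).measurable hS)
  convert this using 1
  ext w
  simp [and_comm]

theorem injOn_param (c : Chart X F U k) : Set.InjOn c.param c.toChart.target :=
  fun _ hw _ hw' h => c.toChart.symm.injOn hw hw' (Subtype.ext h)

theorem aemeasurable_param (c : Chart X F U k) :
    AEMeasurable c.param (volume.restrict c.toChart.target) :=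
  c.continuousOn_param.aemeasurable c.measurableSet_target

variable {R : Type} [CommRing R] [Algebra R (Sec X U)]
  {hR : ∀ r : R, ∃ t : ℝ, ∀ x ∈ F, x ∈ onOpen X U → evalAt X (algebraMap R (Sec X U) r) x = t}

theorem continuousOn_coeff (c : Chart X F U k) (θ : Form R (Sec X U) k) :
    ContinuousOn (c.coeff hR θ) c.toChart.target := by
  induction θ using Form.induction with
  | zero =>
    refine continuousOn_const (c := (0 : ℝ)).congr fun w hw => ?_
    rw [coeff_of_mem _ _ _ hw, formEval_zero]
  | add x y hx hy =>
    refine (hx.add hy).congr fun w hw => ?_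
    rw [Pi.add_apply, coeff_of_mem _ _ _ hw, coeff_of_mem _ _ _ hw, coeff_of_mem _ _ _ hw,
      formEval_add]
  | smul a x hx =>
    refine ((c.analytic a).continuousOn.mul hx).congr fun w hw => ?_
    rw [Pi.mul_apply, coeff_of_mem _ _ _ hw, coeff_of_mem _ _ _ hw, formEval_smul,
      ← evalAt_of_mem]
    rfl
  | ι a =>
    have h1 : ContinuousOn (fun w => Matrix.det (Matrix.of fun i j => c.frame w j (a i)))
        c.toChart.target := by
      rw [continuousOn_iff_continuous_domRestrict]
      refine Continuous.matrix_det (continuous_matrix fun i j => ?_)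
      have : ContinuousOn (fun w => c.frame w j (a i)) c.toChart.target :=
        ((c.analytic (a i)).fderiv.continuousOn).clm_apply continuousOn_const
      exact continuousOn_iff_continuous_domRestrict.1 this
    refine h1.congr fun w hw => ?_
    rw [coeff_of_mem _ _ _ hw, formEval_ι]

theorem measurable_density (c : Chart X F U k) (θ : Form R (Sec X U) k) :
    AEMeasurable (fun w => ENNReal.ofReal |c.coeff hR θ w|) (volume.restrict c.toChart.target) :=
  (ENNReal.continuous_ofReal.comp_continuousOn
    (continuous_abs.comp_continuousOn (c.continuousOn_coeff θ))).aemeasurable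
      c.measurableSet_target

theorem measure_apply (c : Chart X F U k) (θ : Form R (Sec X U) k) {S : Set (RealPoints X)}
    (hS : MeasurableSet S) : c.measure hR θ S =
      ∫⁻ w in c.toChart.target ∩ c.param ⁻¹' S, ENNReal.ofReal |c.coeff hR θ w| := by
  have hm := c.aemeasurable_param
  have hm' : AEMeasurable c.param ((volume.restrict c.toChart.target).withDensity
      fun w => ENNReal.ofReal |c.coeff hR θ w|) :=
    hm.mono_ac (withDensity_absolutelyContinuous _ _)
  have hE := c.measurableSet_inter_preimage hS
  have hnull : ((volume.restrict c.toChart.target).withDensity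
      fun w => ENNReal.ofReal |c.coeff hR θ w|) c.toChart.targetᶜ = 0 :=
    withDensity_absolutelyContinuous _ _
      (by rw [Measure.restrict_apply c.measurableSet_target.compl]; simp)
  rw [measure, Measure.map_apply_of_aemeasurable hm' hS, ← measure_inter_conull' (t := c.toChart.target)
    (measure_mono_null (fun w hw => hw.2) hnull), Set.inter_comm, withDensity_apply _ hE,
    Measure.restrict_restrict hE]
  congr 2
  exact Set.inter_eq_left.2 Set.inter_subset_left

theorem measure_compl_dom (c : Chart X F U k) (hF : MeasurableSet F) (θ : Form R (Sec X U) k) :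
    c.measure hR θ c.domᶜ = 0 := by
  rw [measure_apply _ _ (c.measurableSet_dom hF).compl]
  have : c.toChart.target ∩ c.param ⁻¹' c.domᶜ = ∅ := by
    ext w
    simp only [Set.mem_inter_iff, Set.mem_preimage, Set.mem_compl_iff, Set.mem_empty_iff_false,
      iff_false, not_and, not_not]
    exact c.param_mem_dom
  rw [this, Measure.restrict_empty, lintegral_zero_measure]

theorem lintegral_measure (c : Chart X F U k) (θ : Form R (Sec X U) k) {f : RealPoints X → ℝ≥0∞}
    (hf : Measurable f) : ∫⁻ x, f x ∂c.measure hR θ =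
      ∫⁻ w in c.toChart.target, f (c.param w) * ENNReal.ofReal |c.coeff hR θ w| := by
  have hm := c.aemeasurable_param
  rw [measure, lintegral_map' hf.aemeasurable (hm.mono_ac (withDensity_absolutelyContinuous _ _)),
    lintegral_withDensity_eq_lintegral_mul₀ (c.measurable_density θ)
      (g := fun w => f (c.param w)) (hf.comp_aemeasurable hm)]
  simp only [Pi.mul_apply, mul_comm]

/-- Two charts whose coefficients are related by the Jacobian determinant of the transition map induce
the same measure on the overlap. -/
theorem measure_overlap {U' : X.left.Opens} (c : Chart X F U k) (c' : Chart X F U' k)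
    (hU : IsAffineOpen U) (hF : MeasurableSet F) {R' : Type} [CommRing R'] [Algebra R' (Sec X U')]
    {hR' : ∀ r : R', ∃ t : ℝ, ∀ x ∈ F, x ∈ onOpen X U' →
      evalAt X (algebraMap R' (Sec X U') r) x = t}
    (θ : Form R (Sec X U) k) (θ' : Form R' (Sec X U') k)
    (h : ∀ w ∈ c.toChart.target, ∀ w' ∈ c'.toChart.target, c.param w = c'.param w' →
      c.coeff hR θ w = c'.coeff hR' θ' w' * (fderiv ℝ (c.transition c') w).det)
    {S : Set (RealPoints X)} (hS : MeasurableSet S) :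
    c.measure hR θ (S ∩ c'.dom) = c'.measure hR' θ' (S ∩ c.dom) := by
  have hS₁ := hS.inter (c'.measurableSet_dom hF)
  have hE := c.measurableSet_inter_preimage hS₁
  rw [measure_apply _ _ hS₁, measure_apply _ _ (hS.inter (c.measurableSet_dom hF))]
  have himg : c.transition c' '' (c.toChart.target ∩ c.param ⁻¹' (S ∩ c'.dom)) =
      c'.toChart.target ∩ c'.param ⁻¹' (S ∩ c.dom) := by
    ext w'
    constructor
    · rintro ⟨w, ⟨hw, hwS, hwd⟩, rfl⟩
      obtain ⟨w', hw', hww'⟩ := c'.mem_dom.1 hwd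
      rw [c.transition_eq c' hw' hww'.symm]
      refine ⟨hw', ?_, ?_⟩
      · rw [hww']; exact hwS
      · rw [hww']; exact c.param_mem_dom hw
    · rintro ⟨hw', hwS, hwd⟩
      obtain ⟨w, hw, hww'⟩ := c.mem_dom.1 hwd
      refine ⟨w, ⟨hw, ?_, ?_⟩, c.transition_eq c' hw' hww'⟩
      · rw [hww']; exact hwS
      · rw [hww']; exact c'.param_mem_dom hw'
  have hdiff : ∀ w ∈ c.toChart.target ∩ c.param ⁻¹' (S ∩ c'.dom),
      HasFDerivWithinAt (c.transition c') (fderiv ℝ (c.transition c') w)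
        (c.toChart.target ∩ c.param ⁻¹' (S ∩ c'.dom)) w := by
    rintro w ⟨hw, hwS, hwd⟩
    obtain ⟨w', hw', hww'⟩ := c'.mem_dom.1 hwd
    exact (c.differentiableAt_transition c' hU hw hw' hww'.symm).hasFDerivAt.hasFDerivWithinAt
  have hinj : Set.InjOn (c.transition c') (c.toChart.target ∩ c.param ⁻¹' (S ∩ c'.dom)) := by
    rintro w ⟨hw, hwS, hwd⟩ u ⟨hu, huS, hud⟩ huw
    obtain ⟨w', hw', hww'⟩ := c'.mem_dom.1 hwd
    obtain ⟨u', hu', huu'⟩ := c'.mem_dom.1 hud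
    rw [c.transition_eq c' hw' hww'.symm, c.transition_eq c' hu' huu'.symm] at huw
    exact c.injOn_param hw hu (by rw [← hww', ← huu', huw])
  rw [← himg, lintegral_image_eq_lintegral_abs_det_fderiv_mul _ hE hdiff hinj]
  refine setLIntegral_congr_fun hE ?_
  rintro w ⟨hw, hwS, hwd⟩
  obtain ⟨w', hw', hww'⟩ := c'.mem_dom.1 hwd
  simp only
  rw [c.transition_eq c' hw' hww'.symm, h w hw w' hw' hww'.symm,
    ← ENNReal.ofReal_mul (abs_nonneg _), ← abs_mul, mul_comm]

/-- Charts on different affine opens are compared on a smaller `W` where both forms restrict to the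
same one. The base rings are left general, so that the argument covers top forms, over `ℝ`, and
relative forms, over the sections on the base. -/
theorem coeff_eq_mul_det {U' W : X.left.Opens} (c : Chart X F U k) (c' : Chart X F U' k)
    (hU : IsAffineOpen U) (hU' : IsAffineOpen U') (hW : IsAffineOpen W) (hWU : W ≤ U) (hWU' : W ≤ U')
    {R' R'' : Type} [CommRing R'] [Algebra R' (Sec X U')] [CommRing R''] [Algebra R'' (Sec X W)]
    {hR' : ∀ r : R', ∃ t : ℝ, ∀ x ∈ F, x ∈ onOpen X U' →
      evalAt X (algebraMap R' (Sec X U') r) x = t}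
    (hR'' : ∀ r : R'', ∃ t : ℝ, ∀ x ∈ F, x ∈ onOpen X W →
      evalAt X (algebraMap R'' (Sec X W) r) x = t)
    {g : R →+* R''} (comm : ∀ r, res X hWU (algebraMap R (Sec X U) r) = algebraMap R'' _ (g r))
    {g' : R' →+* R''} (comm' : ∀ r, res X hWU' (algebraMap R' (Sec X U') r) = algebraMap R'' _ (g' r))
    (θ : Form R (Sec X U) k) (θ' : Form R' (Sec X U') k)
    (hθ : Form.map k g (res X hWU) comm θ = Form.map k g' (res X hWU') comm' θ')
    {w w' : Fin k → ℝ} (hw : w ∈ c.toChart.target) (hw' : w' ∈ c'.toChart.target)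
    (h : c.param w = c'.param w') (hwW : c.param w ∈ onOpen X W) :
    c.coeff hR θ w = c'.coeff hR' θ' w' * (fderiv ℝ (c.transition c') w).det := by
  rw [← c.coeff_restr hU hWU hR hR'' comm θ hw hwW, hθ,
    ← c'.coeff_restr hU' hWU' hR' hR'' comm' θ' hw' (h ▸ hwW)]
  exact coeff_transition (c.restr hU hWU) (c'.restr hU' hWU') hW hR'' _ ⟨hw, hwW⟩
    ⟨hw', show c'.param w' ∈ _ from h ▸ hwW⟩ h

end Chart

/-! ### The global measures of top forms and of relative forms on fibres. -/

section GluedForms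

variable {X Y : RScheme}

theorem structure_const (F : Set (RealPoints X)) (U : X.left.Opens) (r : ℝ) :
    ∃ t : ℝ, ∀ x ∈ F, x ∈ onOpen X U → evalAt X (algebraMap ℝ (Sec X U) r) x = t :=
  ⟨r, fun x _ hx => by rw [evalAt_of_mem X _ hx, evalHom_structureHom]⟩

/-- The charts that define the measure of a top form on `D`. -/
structure TopChart (D : X.left.Opens) where
  U : X.left.Opens
  n : ℕ
  affine : IsAffineOpen U
  le : U ≤ D
  smooth : Algebra.IsStandardSmoothOfRelativeDimension n ℝ (Sec X U)
  chart : Chart X Set.univ U n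

namespace TopForm

variable {D : X.left.Opens} (ω : TopForm X D)

/-- The coefficient of the form in a chart. -/
def coeff (c : TopChart D) : (Fin c.n → ℝ) → ℝ :=
  c.chart.coeff (structure_const _ _) (ω.val c.U c.n c.affine c.le c.smooth)

/-- The measure of the form in a chart. -/
def chartMeasure (c : TopChart D) : Measure (RealPoints X) :=
  c.chart.measure (structure_const _ _) (ω.val c.U c.n c.affine c.le c.smooth)

theorem measure_eq_iSup : ω.measure = ⨆ c : TopChart D, ω.chartMeasure c := by
  apply le_antisymm
  · refine iSup_le fun U => iSup_le fun n => iSup_le fun hU => iSup_le fun hD => iSup_le fun hn =>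
      iSup_le fun c => le_iSup ω.chartMeasure ⟨U, n, hU, hD, hn, c⟩
  · refine iSup_le fun c => ?_
    unfold measure
    exact le_iSup_of_le c.U (le_iSup_of_le c.n (le_iSup_of_le c.affine (le_iSup_of_le c.le
      (le_iSup_of_le c.smooth (le_iSup_of_le c.chart le_rfl)))))

theorem chartMeasure_overlap (c c' : TopChart D) {S : Set (RealPoints X)} (hS : MeasurableSet S) :
    ω.chartMeasure c (S ∩ c'.chart.dom) = ω.chartMeasure c' (S ∩ c.chart.dom) := by
  obtain ⟨U, n, hU, hD, hn, c⟩ := c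
  obtain ⟨U', n', hU', hD', hn', c'⟩ := c'
  by_cases hnn : n = n'
  · subst hnn
    refine c.measure_overlap c' hU MeasurableSet.univ _ _ (fun w hw w' hw' h => ?_) hS
    obtain ⟨W, hW, hxW, hWU⟩ := exists_affine_mem (c.param w) (U ⊓ U')
      (onOpen_inf ▸ ⟨c.param_mem hw, h ▸ c'.param_mem hw'⟩)
    refine c.coeff_eq_mul_det c' hU hU' hW (hWU.trans inf_le_left) (hWU.trans inf_le_right)
      (structure_const _ _) (g := RingHom.id ℝ) (g' := RingHom.id ℝ) (res_structureHom X _)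
      (res_structureHom X _) _ _ ?_ hw hw' h hxW
    have hnW := isStandardSmooth_res hU hW (hWU.trans inf_le_left) hn
    rw [ω.compat U W n hU hW hD _ hn hnW, ω.compat U' W n hU' hW hD' _ hn' hnW]
  -- The relative dimension at a real point is unique, so charts of different dimensions do not
  -- meet.
  · have hd : Disjoint c.dom c'.dom := Set.disjoint_left.2 fun x hx hx' =>
      hnn (relativeDimension_eq_of_mem hU hU' (c.dom_subset_onOpen hx) (c'.dom_subset_onOpen hx')
        hn hn')
    have h1 : ω.chartMeasure ⟨U, n, hU, hD, hn, c⟩ (S ∩ c'.dom) = 0 :=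
      measure_mono_null (fun x hx hx' => Set.disjoint_left.1 hd hx' hx.2)
        (c.measure_compl_dom MeasurableSet.univ _)
    have h2 : ω.chartMeasure ⟨U', n', hU', hD', hn', c'⟩ (S ∩ c.dom) = 0 :=
      measure_mono_null (fun x hx hx' => Set.disjoint_left.1 hd hx.2 hx')
        (c'.measure_compl_dom MeasurableSet.univ _)
    exact h1.trans h2.symm

theorem measure_inter_dom [SecondCountableTopology (RealPoints X)] (c : TopChart D)
    {S : Set (RealPoints X)} (hS : MeasurableSet S) :
    ω.measure (S ∩ c.chart.dom) = ω.chartMeasure c S := by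
  choose O hO hdom using fun c : TopChart D => c.chart.exists_dom_eq
  rw [measure_eq_iSup, hdom c]
  refine iSup_measure_inter MeasurableSet.univ hO (fun i => ?_) (fun i j S hS => ?_) c hS
  · rw [← hdom i]; exact i.chart.measure_compl_dom MeasurableSet.univ _
  · rw [← hdom i, ← hdom j]; exact ω.chartMeasure_overlap i j hS

theorem measure_restrict_dom [SecondCountableTopology (RealPoints X)] (c : TopChart D) :
    ω.measure.restrict c.chart.dom = ω.chartMeasure c :=
  Measure.ext fun S hS => by rw [Measure.restrict_apply hS, ω.measure_inter_dom c hS]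

theorem measure_eq_zero [SecondCountableTopology (RealPoints X)] {S : Set (RealPoints X)}
    (hS : Disjoint S (onOpen X D)) : ω.measure S = 0 := by
  choose O hO hdom using fun c : TopChart D => c.chart.exists_dom_eq
  have h := iSup_measure_compl (μ := ω.chartMeasure) MeasurableSet.univ hO (fun i => by
    rw [← hdom i]; exact i.chart.measure_compl_dom MeasurableSet.univ _)
    (fun i j S hS => by rw [← hdom i, ← hdom j]; exact ω.chartMeasure_overlap i j hS)
  rw [measure_eq_iSup]
  refine measure_mono_null (fun x hx => ?_) h
  rintro ⟨-, hx'⟩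
  obtain ⟨c, hc⟩ := Set.mem_iUnion.1 hx'
  have : x ∈ c.chart.dom := by rw [hdom c]; exact ⟨trivial, hc⟩
  exact Set.disjoint_left.1 hS hx (onOpen_mono c.le (c.chart.dom_subset_onOpen this))

end TopForm

variable {φ : X ⟶ Y}

/-- The charts that define the measure of a relative top form on a fibre. -/
structure FibreChart (φ : X ⟶ Y) (y : RealPoints Y) where
  patch : RelPatch φ
  k : ℕ
  smooth : patch.IsSmooth k
  chart : Chart X (fibre φ y) patch.U k

namespace RelTopForm

variable (η : RelTopForm φ) {y : RealPoints Y}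

/-- The measure of the form in a chart of the fibre. -/
def chartMeasure (c : FibreChart φ y) : Measure (RealPoints X) :=
  c.chart.measure (c.patch.const_on_fibre y) (η.val c.patch c.k c.smooth)

theorem fibreMeasure_eq_iSup : η.fibreMeasure y = ⨆ c : FibreChart φ y, η.chartMeasure c := by
  apply le_antisymm
  · refine iSup_le fun P => iSup_le fun k => iSup_le fun hk =>
      iSup_le fun c => le_iSup η.chartMeasure ⟨P, k, hk, c⟩
  · refine iSup_le fun c => ?_
    unfold fibreMeasure
    exact le_iSup_of_le c.patch (le_iSup_of_le c.k (le_iSup_of_le c.smooth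
      (le_iSup_of_le c.chart le_rfl)))

theorem chartMeasure_overlap (hF : MeasurableSet (fibre φ y)) (c c' : FibreChart φ y)
    {S : Set (RealPoints X)} (hS : MeasurableSet S) :
    η.chartMeasure c (S ∩ c'.chart.dom) = η.chartMeasure c' (S ∩ c.chart.dom) := by
  obtain ⟨P, n, hn, c⟩ := c
  obtain ⟨P', n', hn', c'⟩ := c'
  by_cases hnn : n = n'
  · subst hnn
    refine c.measure_overlap c' P.affineU hF _ _ (fun w hw w' hw' h => ?_) hS
    obtain ⟨Q, hxQ, hV, hV', hU, hU', hs, -⟩ := P.exists_refinement P' (c.param_mem hw)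
      (h ▸ c'.param_mem hw')
    refine c.coeff_eq_mul_det c' P.affineU P'.affineU Q.affineU hU hU' (Q.const_on_fibre y)
      (res_pull φ P.le Q.le hV hU) (res_pull φ P'.le Q.le hV' hU') _ _ ?_ hw hw' h hxQ
    rw [η.compat P Q n hV hU hn (hs n hn), η.compat P' Q n hV' hU' hn' (hs n hn)]
  · have hd : Disjoint c.dom c'.dom := Set.disjoint_left.2 fun x hx hx' =>
      hnn (P.relativeDimension_eq_of_mem P' (c.dom_subset_onOpen hx) (c'.dom_subset_onOpen hx')
        hn hn')
    have h1 : η.chartMeasure ⟨P, n, hn, c⟩ (S ∩ c'.dom) = 0 :=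
      measure_mono_null (fun x hx hx' => Set.disjoint_left.1 hd hx' hx.2)
        (c.measure_compl_dom hF _)
    have h2 : η.chartMeasure ⟨P', n', hn', c'⟩ (S ∩ c.dom) = 0 :=
      measure_mono_null (fun x hx hx' => Set.disjoint_left.1 hd hx.2 hx')
        (c'.measure_compl_dom hF _)
    exact h1.trans h2.symm

theorem fibreMeasure_restrict_dom [SecondCountableTopology (RealPoints X)]
    (hF : MeasurableSet (fibre φ y)) (c : FibreChart φ y) :
    (η.fibreMeasure y).restrict c.chart.dom = η.chartMeasure c := by
  refine Measure.ext fun S hS => ?_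
  rw [Measure.restrict_apply hS]
  choose O hO hdom using fun c : FibreChart φ y => c.chart.exists_dom_eq
  rw [fibreMeasure_eq_iSup, hdom c]
  refine iSup_measure_inter hF hO (fun i => ?_) (fun i j S hS => ?_) c hS
  · rw [← hdom i]; exact i.chart.measure_compl_dom hF _
  · rw [← hdom i, ← hdom j]; exact η.chartMeasure_overlap hF i j hS

theorem fibreMeasure_compl_fibre [SecondCountableTopology (RealPoints X)]
    (hF : MeasurableSet (fibre φ y)) : η.fibreMeasure y (fibre φ y)ᶜ = 0 := by
  choose O hO hdom using fun c : FibreChart φ y => c.chart.exists_dom_eq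
  have h := iSup_measure_compl (μ := η.chartMeasure) hF hO (fun i => by
    rw [← hdom i]; exact i.chart.measure_compl_dom hF _)
    (fun i j S hS => by rw [← hdom i, ← hdom j]; exact η.chartMeasure_overlap hF i j hS)
  rw [fibreMeasure_eq_iSup]
  exact measure_mono_null (Set.compl_subset_compl.2 Set.inter_subset_left) h

end RelTopForm

end GluedForms

end RealVar

namespace RealVar

/-! ### Standard smooth neighbourhoods of real points. -/

section PatchExistence

variable {X Y : RScheme}

/-- A smooth algebra becomes standard smooth after inverting each of some elements that generate the
unit ideal; they cannot all vanish at `x`. -/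
theorem exists_standardSmooth_basicOpen {B : Type} [CommRing B] {U : X.left.Opens}
    (hU : IsAffineOpen U) {f : B →+* Sec X U} (hf : f.Smooth) {x : RealPoints X}
    (hx : x ∈ onOpen X U) : ∃ t : Sec X U, x ∈ onOpen X (X.left.basicOpen (U := U) t) ∧
      ∃ k, RingHom.IsStandardSmoothOfRelativeDimension k
        ((res X (X.left.basicOpen_le (U := U) t)).comp f) := by
  let : Algebra B (Sec X U) := f.toAlgebra
  have : Algebra.Smooth B (Sec X U) := hf
  obtain ⟨s, hs, h⟩ := Algebra.Smooth.exists_span_eq_top_isStandardSmooth B (Sec X U)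
  obtain ⟨t, ht, hxt⟩ : ∃ t ∈ s, evalHom X U x hx t ≠ 0 := by
    by_contra! hcon
    have : Ideal.span s ≤ RingHom.ker (evalHom X U x hx) := Ideal.span_le.2 hcon
    rw [hs] at this
    have h1 := this (Submodule.mem_top (x := (1 : Sec X U)))
    rw [RingHom.mem_ker, map_one] at h1
    exact one_ne_zero h1
  refine ⟨t, (mem_onOpen_basicOpen t hx).2 (by rwa [evalAt_of_mem _ _ hx]), ?_⟩
  let A' := Sec X (X.left.basicOpen (U := U) t)
  let i : Sec X U →+* A' := res X (X.left.basicOpen_le (U := U) t)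
  let : Algebra (Sec X U) A' := i.toAlgebra
  let : Algebra B A' := (i.comp f).toAlgebra
  have : IsScalarTower B (Sec X U) A' := IsScalarTower.of_algebraMap_eq fun _ => rfl
  have : IsLocalization.Away t A' := hU.isLocalization_basicOpen t
  let e : Localization.Away t ≃ₐ[B] A' :=
    (IsLocalization.algEquiv (Submonoid.powers t) (Localization.Away t) A').restrictScalars B
  have := h t ht
  have h2 : Algebra.IsStandardSmooth B A' := .of_algEquiv e
  obtain ⟨ι, σ, _, _, ⟨P⟩⟩ := h2.out
  exact ⟨P.dimension, ⟨ι, σ, _, ‹_›, P, rfl⟩⟩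

theorem structureHom_smooth [Smooth X.hom] {U : X.left.Opens} (hU : IsAffineOpen U) :
    (structureHom X U).Smooth :=
  RingHom.Smooth.comp (RingHom.Smooth.of_bijective
    (ConcreteCategory.bijective_of_isIso (Scheme.ΓSpecIso (CommRingCat.of ℝ)).inv))
    (X.hom.smooth_appLE (isAffineOpen_top _) hU le_top)

/-- The standard smooth affine opens are a basis of the topology. -/
theorem exists_standardSmooth_mem [Smooth X.hom] {x : RealPoints X} {D : X.left.Opens}
    (hx : x ∈ onOpen X D) : ∃ U : X.left.Opens, IsAffineOpen U ∧ x ∈ onOpen X U ∧ U ≤ D ∧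
      ∃ n, Algebra.IsStandardSmoothOfRelativeDimension n ℝ (Sec X U) := by
  obtain ⟨U, hU, hxU, hUD⟩ := exists_affine_mem x D hx
  obtain ⟨t, hxt, n, hn⟩ := exists_standardSmooth_basicOpen hU (structureHom_smooth hU) hxU
  refine ⟨_, hU.basicOpen t, hxt, (X.left.basicOpen_le (U := U) t).trans hUD, n, ?_⟩
  have : (res X (X.left.basicOpen_le (U := U) t)).comp (structureHom X U) =
      structureHom X (X.left.basicOpen (U := U) t) := RingHom.ext (res_structureHom X _)
  rw [this] at hn
  exact hn

theorem RelPatch.exists_mem (φ : X ⟶ Y) [Smooth Y.hom] [Smooth φ.left] {x : RealPoints X}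
    {D : X.left.Opens} (hx : x ∈ onOpen X D) : ∃ (P : RelPatch φ) (k m : ℕ),
      x ∈ onOpen X P.U ∧ P.U ≤ D ∧ P.IsSmooth k ∧
        Algebra.IsStandardSmoothOfRelativeDimension m ℝ P.B := by
  obtain ⟨V, hV, hyV, -, m, hm⟩ := exists_standardSmooth_mem (x := realMap φ x) (D := ⊤)
    (onOpen_top ▸ trivial)
  have hxV : x ∈ onOpen X (φ.left ⁻¹ᵁ V) := hyV
  obtain ⟨U, hU, hxU, hUD⟩ := exists_affine_mem x (φ.left ⁻¹ᵁ V ⊓ D) (onOpen_inf ▸ ⟨hxV, hx⟩)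
  have hs : (pull φ V U (hUD.trans inf_le_left)).Smooth :=
    φ.left.smooth_appLE hV hU (hUD.trans inf_le_left)
  obtain ⟨t, hxt, k, hk⟩ := exists_standardSmooth_basicOpen hU hs hxU
  have hle : X.left.basicOpen (U := U) t ≤ φ.left ⁻¹ᵁ V :=
    (X.left.basicOpen_le (U := U) t).trans (hUD.trans inf_le_left)
  have hc : (res X (X.left.basicOpen_le (U := U) t)).comp (pull φ V U (hUD.trans inf_le_left)) =
      pull φ V _ hle := RingHom.ext fun b => by
    rw [RingHom.comp_apply, res_pull φ _ hle le_rfl]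
    congr 1
    exact congrArg (fun f => f.hom b) (Y.left.presheaf.map_id _)
  rw [hc] at hk
  exact ⟨⟨V, _, hV, hU.basicOpen t, hle, m, hm⟩, k, m, hxt,
    (X.left.basicOpen_le (U := U) t).trans (hUD.trans inf_le_right), hk, hm⟩

end PatchExistence

/-! ### Change of coordinates, and the local product form of a smooth morphism. -/

namespace Chart

variable {X : RScheme} {F : Set (RealPoints X)} {U : X.left.Opens} {k : ℕ}

/-- Change of coordinates in a chart. -/
def trans (c : Chart X F U k) (e : OpenPartialHomeomorph (Fin k → ℝ) (Fin k → ℝ))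
    (he : AnalyticOnNhd ℝ e.symm e.target) (he' : ∀ w ∈ e.source, DifferentiableAt ℝ e w) :
    Chart X F U k where
  toChart := c.toChart.trans e
  source_subset := fun x hx => by
    rw [OpenPartialHomeomorph.trans_source] at hx
    exact c.source_subset x hx.1
  analytic := fun a w hw => by
    rw [OpenPartialHomeomorph.trans_target] at hw
    exact (c.analytic a _ hw.2).comp (he w hw.1)
  immersion := fun w hw v hv => by
    rw [OpenPartialHomeomorph.trans_target] at hw
    have hd : DifferentiableAt ℝ e.symm w := (he w hw.1).differentiableAt
    have h0 : fderiv ℝ e.symm w v = 0 := c.immersion _ hw.2 _ fun a => by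
      have := hv a
      change fderiv ℝ ((fun w => evalAt X a (c.toChart.symm w)) ∘ e.symm) w v = 0 at this
      rwa [fderiv_comp _ (c.analytic a _ hw.2).differentiableAt hd] at this
    have h1 : (e ∘ e.symm) =ᶠ[𝓝 w] id := by
      filter_upwards [e.open_target.mem_nhds hw.1] with u hu
      exact e.right_inv hu
    have h2 := h1.fderiv_eq (𝕜 := ℝ)
    rw [fderiv_comp _ (he' _ (e.map_target hw.1)) hd, fderiv_id] at h2
    have h3 := congrArg (fun L => L v) h2
    rw [← show _ = v from h3, ContinuousLinearMap.comp_apply, h0, map_zero]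

theorem trans_target (c : Chart X F U k) (e : OpenPartialHomeomorph (Fin k → ℝ) (Fin k → ℝ))
    (he : AnalyticOnNhd ℝ e.symm e.target) (he' : ∀ w ∈ e.source, DifferentiableAt ℝ e w) :
    (c.trans e he he').toChart.target = e.target ∩ e.symm ⁻¹' c.toChart.target :=
  OpenPartialHomeomorph.trans_target _ _

/-- The restriction of a chart to an open set of coordinates. -/
theorem exists_restrTarget (c : Chart X F U k) {T : Set (Fin k → ℝ)} (hT : IsOpen T)
    (hTc : T ⊆ c.toChart.target) :
    ∃ c' : Chart X F U k, c'.toChart.target = T ∧ c'.param = c.param := by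
  refine ⟨c.trans (OpenPartialHomeomorph.ofSet T hT) (fun w _ => analyticAt_id)
    (fun w _ => differentiableAt_id), ?_, rfl⟩
  exact (trans_target _ _ _ _).trans (Set.inter_eq_left.2 hTc)

theorem differentiableAt_evalAt (c : Chart X F U k) {w : Fin k → ℝ} (hw : w ∈ c.toChart.target)
    (a : Sec X U) : DifferentiableAt ℝ (fun w => evalAt X a (c.param w)) w :=
  (c.analytic a w hw).differentiableAt

theorem frame_sum (c : Chart X F U k) {w : Fin k → ℝ} (a : Sec X U) (v : Fin k → ℝ) :
    fderiv ℝ (fun w => evalAt X a (c.param w)) w v = ∑ j, v j * c.frame w j a := by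
  conv_lhs => rw [pi_eq_sum_univ' v, map_sum]
  refine Finset.sum_congr rfl fun i _ => ?_
  rw [map_smul, smul_eq_mul, frame]

/-- Every vector is a tangent vector of the variety. -/
theorem isTangent_fderiv (c : Chart X F U k) {w : Fin k → ℝ} (hw : w ∈ c.toChart.target)
    (v : Fin k → ℝ) : IsTangent ℝ (evalHom X U (c.param w) (c.param_mem hw))
      (fun a => fderiv ℝ (fun w => evalAt X a (c.param w)) w v) := by
  have hf := c.frame_isTangent (structure_const F U) hw
  simp only [c.frame_sum]
  refine ⟨fun a b => ?_, fun a b => ?_, fun r => ?_⟩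
  · simp only [(hf _).add, mul_add, Finset.sum_add_distrib]
  · simp only [(hf _).leibniz, mul_add, Finset.sum_add_distrib, Finset.mul_sum]
    congr 1 <;> exact Finset.sum_congr rfl fun i _ => by ring
  · simp only [(hf _).const, mul_zero, Finset.sum_const_zero]

end Chart

/-- A pair of charts of `X(ℝ)` and `Y(ℝ)` in which a smooth morphism is the projection of a box. -/
structure Box {X Y : RScheme} (φ : X ⟶ Y) where
  P : RelPatch φ
  k : ℕ
  m : ℕ
  smooth : P.IsSmooth k
  smoothBase : Algebra.IsStandardSmoothOfRelativeDimension m ℝ P.B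
  S : Set (Fin k → ℝ)
  T : Set (Fin m → ℝ)
  nonempty : S.Nonempty
  chart : Chart X Set.univ P.U (k + m)
  base : Chart Y Set.univ P.V m
  target_eq : chart.toChart.target =
    {w | (fun i => w (Fin.castAdd m i)) ∈ S ∧ (fun i => w (Fin.natAdd k i)) ∈ T}
  base_target_eq : base.toChart.target = T
  realMap_param : ∀ w ∈ chart.toChart.target,
    realMap φ (chart.param w) = base.param fun i => w (Fin.natAdd k i)

section BoxExistence

variable {X Y : RScheme} {φ : X ⟶ Y}

/-- The new coordinates are functions `f i` whose differentials are a basis relative to the base,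
followed by the coordinates of the image point. A tangent vector killed by the latter is a
derivation over the functions of the base; if it also kills the `f i`, it is zero. The inverse
function theorem applies, and the image is shrunk to a product. -/
theorem exists_box [Smooth Y.hom] [Smooth φ.left] {x : RealPoints X}
    {D : X.left.Opens} (hx : x ∈ onOpen X D) :
    ∃ b : Box φ, b.P.U ≤ D ∧ x ∈ b.chart.dom := by
  obtain ⟨P, k, m, hxP, hPD, hk, hm⟩ := RelPatch.exists_mem φ hx
  obtain ⟨c, hc⟩ := exists_chart_of_isStandardSmooth P.affineU (P.relativeDimension_add hk hm) hxP
  obtain ⟨d, hd⟩ := exists_chart_of_isStandardSmooth P.affineV hm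
    (realMap_mem_onOpen φ P.V P.U P.le hxP)
  obtain ⟨f, bf, hbf⟩ := exists_basis_kaehlerDifferential hk
  let F : RealPoints X → (Set.univ : Set (RealPoints Y)) := fun z => ⟨realMap φ z, trivial⟩
  have hF : Continuous F := (continuous_realMap φ).subtype_mk _
  let w₀ := c.toChart ⟨x, trivial⟩
  have hw₀ : w₀ ∈ c.toChart.target := c.toChart.map_source hc
  have hpw₀ : c.param w₀ = x := congrArg Subtype.val (c.toChart.left_inv hc)
  -- the new coordinates
  let q : (Fin (k + m) → ℝ) → Fin m → ℝ := fun w => d.toChart (F (c.param w))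
  let G : (Fin (k + m) → ℝ) → Fin (k + m) → ℝ := fun w =>
    Fin.append (fun i => evalAt X (f i) (c.param w)) (q w)
  let N : Set (Fin (k + m) → ℝ) := {w | w ∈ c.toChart.target ∧ F (c.param w) ∈ d.toChart.source}
  have hN : IsOpen N := (hF.comp_continuousOn c.continuousOn_param).isOpen_inter_preimage
    c.toChart.open_target d.toChart.open_source
  have hw₀N : w₀ ∈ N := ⟨hw₀, by rw [hpw₀]; exact hd⟩
  have hqa : ∀ w ∈ N, AnalyticAt ℝ q w := fun w hw => by
    refine d.analyticAt_toChart (g := fun w => F (c.param w)) ?_ hw.2 fun b => ?_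
    · exact hF.continuousAt.comp
        (c.continuousOn_param.continuousAt (c.toChart.open_target.mem_nhds hw.1))
    · refine (c.analytic (P.hom b) w hw.1).congr ?_
      filter_upwards [c.toChart.open_target.mem_nhds hw.1] with u hu
      exact evalAt_pull φ P.V P.U P.le b (c.param_mem hu)
  have hGa : ∀ w ∈ N, AnalyticAt ℝ G w := fun w hw => by
    refine AnalyticAt.pi fun j => ?_
    refine Fin.addCases (fun i => ?_) (fun i => ?_) j
    · simp only [Fin.append_left]
      exact c.analytic (f i) w hw.1
    · simp only [Fin.append_right]
      exact (ContinuousLinearMap.proj (R := ℝ) (φ := fun _ : Fin m => ℝ) i).analyticAt _ |>.comp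
        (hqa w hw)
  have hGd : DifferentiableAt ℝ G w₀ := (hGa w₀ hw₀N).differentiableAt
  have hcomp : ∀ j v, fderiv ℝ G w₀ v j = fderiv ℝ (fun w => G w j) w₀ v := fun j v => by
    rw [fderiv_apply hGd]; rfl
  have hinj : Function.Injective (fderiv ℝ G w₀) := by
    rw [injective_iff_map_eq_zero]
    intro v hv
    have h1 : ∀ i, fderiv ℝ (fun w => evalAt X (f i) (c.param w)) w₀ v = 0 := fun i => by
      have := (hcomp (Fin.castAdd m i) v).symm
      simp only [G, Fin.append_left] at this
      rw [this, hv]; rfl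
    have h2 : fderiv ℝ q w₀ v = 0 := by
      ext i
      have := (hcomp (Fin.natAdd k i) v).symm
      simp only [G, Fin.append_right] at this
      rw [fderiv_apply (hqa w₀ hw₀N).differentiableAt] at this
      exact this.trans (by rw [hv]; rfl)
    refine c.immersion w₀ hw₀ v fun a => ?_
    have ht := c.isTangent_fderiv hw₀ v
    -- The derivation along `v` vanishes on pulled back functions, as these factor through `q` and
    -- `v` is killed by the differential of `q`. It is therefore linear over `P.B`.
    refine IsTangent.eq_zero (R := P.B)
      (v := fun a => fderiv ℝ (fun w => evalAt X a (c.param w)) w₀ v) ⟨ht.add, ht.leibniz, fun b => ?_⟩ bf hbf h1 a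
    have h3 : (fun w => evalAt X (algebraMap P.B P.A b) (c.param w)) =ᶠ[𝓝 w₀]
        (fun u => evalAt Y b (d.param u)) ∘ q := by
      filter_upwards [hN.mem_nhds hw₀N] with u hu
      refine (evalAt_pull φ P.V P.U P.le b (c.param_mem hu.1)).trans ?_
      rw [Function.comp_apply,
        show d.param (q u) = F (c.param u) from congrArg Subtype.val (d.toChart.left_inv hu.2)]
    have hqt : q w₀ ∈ d.toChart.target := d.toChart.map_source hw₀N.2
    change fderiv ℝ (fun w => evalAt X (algebraMap P.B P.A b) (c.param w)) w₀ v = 0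
    rw [h3.fderiv_eq, fderiv_comp _ (d.differentiableAt_evalAt hqt b)
      (hqa w₀ hw₀N).differentiableAt, ContinuousLinearMap.comp_apply, h2, map_zero]
  let L : (Fin (k + m) → ℝ) ≃L[ℝ] (Fin (k + m) → ℝ) :=
    (LinearEquiv.ofInjectiveEndo (fderiv ℝ G w₀ : (Fin (k + m) → ℝ) →ₗ[ℝ] (Fin (k + m) → ℝ))
      hinj).toContinuousLinearEquiv
  have hL : (L : (Fin (k + m) → ℝ) →L[ℝ] (Fin (k + m) → ℝ)) = fderiv ℝ G w₀ := by ext v; rfl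
  obtain ⟨E, hE₀, hEG, hEa⟩ := exists_analytic_local_inverse (hGa w₀ hw₀N) (f' := L)
    (hL ▸ hGd.hasFDerivAt)
  have hEw₀ : E.symm (G w₀) = w₀ := by rw [← hEG]; exact E.left_inv hE₀
  have hN' : IsOpen (E.target ∩ E.symm ⁻¹' N) := E.isOpen_inter_preimage_symm hN
  have hmem : G w₀ ∈ E.target ∩ E.symm ⁻¹' N :=
    ⟨hEG w₀ ▸ E.map_source hE₀, by rw [Set.mem_preimage, hEw₀]; exact hw₀N⟩
  -- a box inside the good set
  let ap : (Fin k → ℝ) × (Fin m → ℝ) → Fin (k + m) → ℝ := fun p => Fin.append p.1 p.2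
  have hap : Continuous ap := continuous_pi fun j => by
    refine Fin.addCases (fun i => ?_) (fun i => ?_) j
    · simp only [ap, Fin.append_left]; fun_prop
    · simp only [ap, Fin.append_right]; fun_prop
  obtain ⟨S, T, hS, hs₀, hT, ht₀, hST⟩ := mem_nhds_prod_iff'.1
    ((hN'.preimage hap).mem_nhds
      (show (fun i => evalAt X (f i) (c.param w₀), q w₀) ∈ ap ⁻¹' _ from hmem))
  let Bx : Set (Fin (k + m) → ℝ) :=
    {w | (fun i => w (Fin.castAdd m i)) ∈ S ∧ (fun i => w (Fin.natAdd k i)) ∈ T}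
  have hBx : IsOpen Bx := (hS.preimage (by fun_prop)).inter (hT.preimage (by fun_prop))
  have hBxN : Bx ⊆ E.target ∩ E.symm ⁻¹' N := fun w hw => by
    have := hST (Set.mk_mem_prod hw.1 hw.2)
    rwa [Set.mem_preimage, show ap (fun i => w (Fin.castAdd m i), fun i => w (Fin.natAdd k i)) = w
      from Fin.append_castAdd_natAdd] at this
  have hqE : ∀ w ∈ Bx, q (E.symm w) = fun i => w (Fin.natAdd k i) := fun w hw => by
    have h1 : G (E.symm w) = w := by rw [← hEG]; exact E.right_inv (hBxN hw).1
    funext i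
    have := congrFun h1 (Fin.natAdd k i)
    simpa only [G, Fin.append_right] using this
  -- Cutting the coordinate change down to `Bx` makes the target of the new chart exactly the box.
  let E' := (E.symm.restrOpen Bx hBx).symm
  have hE't : E'.target = E.target ∩ Bx := rfl
  obtain ⟨c', hc't, hc'p⟩ : ∃ c' : Chart X Set.univ P.U (k + m), c'.toChart.target = Bx ∧
      ∀ w, c'.param w = c.param (E.symm w) := by
    refine ⟨c.trans E' (fun w hw => hEa w hw.1) (fun w hw => ?_), ?_, fun w => rfl⟩
    · have hw' : w ∈ E.source ∧ E w ∈ Bx := by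
        have h1 := E'.map_source hw
        have h2 := E'.left_inv hw
        rw [← h2]
        change E.symm (E' w) ∈ E.source ∧ E (E.symm (E' w)) ∈ Bx
        exact ⟨E.map_target h1.1, by rw [E.right_inv h1.1]; exact h1.2⟩
      have h3 : w ∈ N := by
        have := (hBxN hw'.2).2
        rwa [Set.mem_preimage, E.left_inv hw'.1] at this
      have h4 : (E' : _ → _) = G := funext hEG
      rw [h4]
      exact (hGa w h3).differentiableAt
    · refine (Chart.trans_target _ _ _ _).trans ?_
      rw [hE't]
      apply Set.Subset.antisymm
      · exact fun w hw => hw.1.2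
      · exact fun w hw => ⟨⟨(hBxN hw).1, hw⟩, (hBxN hw).2.1⟩
  -- Each `t` is the base coordinate of the box point over it whose first component is that of the
  -- centre.
  have hTd : T ⊆ d.toChart.target := fun t ht => by
    have hw : ap (fun i => evalAt X (f i) (c.param w₀), t) ∈ Bx := by
      constructor
      · simp only [ap, Fin.append_left]; exact hs₀
      · simp only [ap, Fin.append_right]; exact ht
    have h1 := hqE _ hw
    simp only [ap, Fin.append_right] at h1
    rw [← show _ = t from h1]
    exact d.toChart.map_source (hBxN hw).2.2
  obtain ⟨d', hd't, hd'p⟩ := d.exists_restrTarget hT hTd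
  refine ⟨⟨P, k, m, hk, hm, S, T, ⟨_, hs₀⟩, c', d', hc't, hd't, fun w hw => ?_⟩, hPD, ?_⟩
  · rw [hc't] at hw
    rw [hc'p, hd'p, ← hqE w hw]
    exact (congrArg Subtype.val (d.toChart.left_inv (hBxN hw).2.2)).symm
  · refine c'.mem_dom.2 ⟨G w₀, ?_, ?_⟩
    · rw [hc't]
      constructor
      · simp only [G, Fin.append_left]; exact hs₀
      · simp only [G, Fin.append_right]; exact ht₀
    · rw [hc'p, hEw₀, hpw₀]

end BoxExistence

end RealVar

namespace RealVar

/-! ### Slices of a box, and the factorization of coefficients. -/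

namespace Box

variable {X Y : RScheme} {φ : X ⟶ Y} (b : Box φ)

theorem isOpen_T : IsOpen b.T := b.base_target_eq ▸ b.base.toChart.open_target

theorem mem_target {w : Fin (b.k + b.m) → ℝ} : w ∈ b.chart.toChart.target ↔
    (fun i => w (Fin.castAdd b.m i)) ∈ b.S ∧ (fun i => w (Fin.natAdd b.k i)) ∈ b.T := by
  rw [b.target_eq]; rfl

theorem append_mem_target {s : Fin b.k → ℝ} {t : Fin b.m → ℝ} :
    Fin.append s t ∈ b.chart.toChart.target ↔ s ∈ b.S ∧ t ∈ b.T := by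
  rw [b.mem_target]
  simp only [Fin.append_left, Fin.append_right]

theorem realMap_append {s : Fin b.k → ℝ} {t : Fin b.m → ℝ} (hs : s ∈ b.S) (ht : t ∈ b.T) :
    realMap φ (b.chart.param (Fin.append s t)) = b.base.param t := by
  rw [b.realMap_param _ (b.append_mem_target.2 ⟨hs, ht⟩)]
  simp only [Fin.append_right]

/-- Appending as an affine map of the first component. -/
theorem hasFDerivAt_append_left {k m : ℕ} (s : Fin k → ℝ) (t : Fin m → ℝ) :
    ∃ L : (Fin k → ℝ) →L[ℝ] (Fin (k + m) → ℝ), (∀ v, L v = Fin.append v 0) ∧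
      HasFDerivAt (fun s => Fin.append s t) L s := by
  let L : (Fin k → ℝ) →L[ℝ] (Fin (k + m) → ℝ) := ContinuousLinearMap.pi
    (Fin.append (fun i => ContinuousLinearMap.proj i) fun _ => 0)
  have hL : ∀ v, L v = Fin.append v 0 := fun v => by
    funext j
    refine Fin.addCases (fun i => ?_) (fun i => ?_) j <;> simp [L]
  refine ⟨L, hL, ?_⟩
  have : (fun s : Fin k → ℝ => Fin.append s t) = fun s => L s + Fin.append 0 t := by
    funext s
    rw [hL]
    funext j
    refine Fin.addCases (fun i => ?_) (fun i => ?_) j <;> simp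
  rw [this]
  exact L.hasFDerivAt.add_const _

theorem analyticAt_append_left {k m : ℕ} (s : Fin k → ℝ) (t : Fin m → ℝ) :
    AnalyticAt ℝ (fun s => Fin.append s t) s := by
  refine AnalyticAt.pi fun j => ?_
  refine Fin.addCases (fun i => ?_) (fun i => ?_) j
  · simp only [Fin.append_left]
    exact (ContinuousLinearMap.proj (R := ℝ) (φ := fun _ : Fin k => ℝ) i).analyticAt _
  · simp only [Fin.append_right]
    exact analyticAt_const

theorem isOpen_S {t : Fin b.m → ℝ} (ht : t ∈ b.T) : IsOpen b.S := by
  have : b.S = (fun s => Fin.append s t) ⁻¹' b.chart.toChart.target := by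
    ext s
    simp [b.append_mem_target, ht]
  rw [this]
  exact b.chart.toChart.open_target.preimage
    (continuous_iff_continuousAt.2 fun s => (analyticAt_append_left s t).continuousAt)

theorem fderiv_slice {s : Fin b.k → ℝ} {t : Fin b.m → ℝ} (hs : s ∈ b.S) (ht : t ∈ b.T)
    (a : Sec X b.P.U) (v : Fin b.k → ℝ) :
    fderiv ℝ (fun s => evalAt X a (b.chart.param (Fin.append s t))) s v =
      fderiv ℝ (fun w => evalAt X a (b.chart.param w)) (Fin.append s t) (Fin.append v 0) := by
  obtain ⟨L, hL, hd⟩ := hasFDerivAt_append_left s t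
  have h := (b.chart.differentiableAt_evalAt (b.append_mem_target.2 ⟨hs, ht⟩) a).hasFDerivAt.comp
    s hd
  rw [← hL, ← ContinuousLinearMap.comp_apply, ← h.fderiv]
  rfl

/-- The chart of a fibre cut out by the box. -/
theorem exists_slice {t : Fin b.m → ℝ} (ht : t ∈ b.T) :
    ∃ e : Chart X (fibre φ (b.base.param t)) b.P.U b.k, e.toChart.target = b.S ∧
      (∀ s ∈ b.S, e.param s = b.chart.param (Fin.append s t)) ∧
      e.dom = fibre φ (b.base.param t) ∩ b.chart.dom := by
  obtain ⟨s₀, hs₀⟩ := b.nonempty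
  obtain ⟨O, hO, hOd⟩ := b.chart.exists_dom_eq
  rw [Set.univ_inter] at hOd
  subst hOd
  have hS := b.isOpen_S ht
  have hmem : ∀ s ∈ b.S, Fin.append s t ∈ b.chart.toChart.target := fun s hs =>
    b.append_mem_target.2 ⟨hs, ht⟩
  let q : RealPoints X → Fin b.k → ℝ := fun x i => b.chart.toChart ⟨x, trivial⟩ (Fin.castAdd b.m i)
  have hpar : ∀ x ∈ b.chart.dom, b.chart.toChart ⟨x, trivial⟩ ∈ b.chart.toChart.target ∧
      b.chart.param (b.chart.toChart ⟨x, trivial⟩) = x := by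
    rintro _ ⟨x, hx, rfl⟩
    exact ⟨b.chart.toChart.map_source hx, congrArg Subtype.val (b.chart.toChart.left_inv hx)⟩
  obtain ⟨e, he1, he2, he3, he4⟩ := exists_chart (F := fibre φ (b.base.param t)) b.P.affineU
    ⟨_, b.realMap_append hs₀ ht⟩ hS (fun s => b.chart.param (Fin.append s t)) q hO
    (fun x _ hx => b.chart.dom_subset_onOpen hx)
    (fun s hs => b.realMap_append hs ht)
    (fun s hs => b.chart.param_mem_dom (hmem s hs))
    (fun x _ hx => (b.mem_target.1 (hpar x hx).1).1)
    (fun s hs => by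
      have h1 : b.chart.toChart ⟨b.chart.param (Fin.append s t), trivial⟩ = Fin.append s t :=
        b.chart.toChart.right_inv (hmem s hs)
      funext i
      simp only [q, h1, Fin.append_left])
    (fun x hxF hx => by
      obtain ⟨h1, h2⟩ := hpar x hx
      -- The base parametrization is injective, so all points of the fibre in the box have the same
      -- last `m` coordinates.
      have h3 : (fun i => b.chart.toChart ⟨x, trivial⟩ (Fin.natAdd b.k i)) = t := by
        refine b.base.injOn_param ?_ ?_ ?_
        · rw [b.base_target_eq]; exact (b.mem_target.1 h1).2
        · rw [b.base_target_eq]; exact ht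
        · rw [← b.realMap_param _ h1, h2]; exact hxF
      have h4 : Fin.append (q x) t = b.chart.toChart ⟨x, trivial⟩ := by
        rw [← h3]; exact Fin.append_castAdd_natAdd
      simp only [h4, h2])
    (by
      have h1 : ContinuousOn (fun x : RealPoints X => b.chart.toChart ⟨x, trivial⟩) b.chart.dom := by
        refine b.chart.toChart.continuousOn.comp (by fun_prop) ?_
        rintro _ ⟨x, hx, rfl⟩
        exact hx
      exact ((continuous_pi fun i => continuous_apply _).comp_continuousOn h1).mono
        Set.inter_subset_right)
    (fun a s hs => (b.chart.analytic a _ (hmem s hs)).comp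
      (f := fun s => Fin.append s t) (analyticAt_append_left s t))
    (fun s hs v hv => by
      have h1 : Fin.append v (0 : Fin b.m → ℝ) = 0 := b.chart.immersion _ (hmem s hs) _ fun a => by
        rw [← hv a, b.fderiv_slice hs ht]
        rfl
      funext i
      have := congrFun h1 (Fin.castAdd b.m i)
      rwa [Fin.append_left] at this)
  refine ⟨e, he1, he2, ?_⟩
  ext x
  constructor
  · rintro ⟨x, hx, rfl⟩
    exact ⟨x.2, (he3 x).1 hx⟩
  · rintro ⟨hx, hx'⟩
    exact ⟨⟨x, hx⟩, (he3 ⟨x, hx⟩).2 hx', rfl⟩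

/-- The coefficient of `η ∧ φ^* β` is the product of the coefficients of `η` on the slices and of `β` on
the base. -/
theorem coeff_mul {t : Fin b.m → ℝ} (ht : t ∈ b.T)
    {e : Chart X (fibre φ (b.base.param t)) b.P.U b.k} (he : e.toChart.target = b.S)
    (hep : ∀ s ∈ b.S, e.param s = b.chart.param (Fin.append s t))
    (θ : Form ℝ b.P.A b.k) (β : Form ℝ b.P.B b.m) (ω : Form ℝ b.P.A (b.k + b.m))
    (hω : (θ : ExteriorAlgebra b.P.A Ω[b.P.A⁄ℝ]) *
      (Form.map b.m (RingHom.id ℝ) b.P.hom (pull_structureHom φ b.P.V b.P.U b.P.le) β :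
        ExteriorAlgebra b.P.A Ω[b.P.A⁄ℝ]) = (ω : ExteriorAlgebra b.P.A Ω[b.P.A⁄ℝ]))
    {s : Fin b.k → ℝ} (hs : s ∈ b.S) :
    b.chart.coeff (structure_const _ _) ω (Fin.append s t) =
      e.coeff (b.P.const_on_fibre _) (Form.map b.k (algebraMap ℝ b.P.B) (RingHom.id b.P.A)
        (fun r => (pull_structureHom φ b.P.V b.P.U b.P.le r).symm) θ) s *
      b.base.coeff (structure_const _ _) β t := by
  have hw := b.append_mem_target.2 ⟨hs, ht⟩
  have hse : s ∈ e.toChart.target := he ▸ hs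
  have htb : t ∈ b.base.toChart.target := b.base_target_eq ▸ ht
  -- Pulled back functions depend on the last `m` coordinates only. So the first `k` coordinate
  -- vectors kill them, and the last `m` act as the frame of the base.
  have hpull : ∀ (a : Sec Y b.P.V) (v : Fin (b.k + b.m) → ℝ),
      fderiv ℝ (fun w => evalAt X (b.P.hom a) (b.chart.param w)) (Fin.append s t) v =
        fderiv ℝ (fun t => evalAt Y a (b.base.param t)) t fun i => v (Fin.natAdd b.k i) := by
    intro a v
    let π : (Fin (b.k + b.m) → ℝ) →L[ℝ] (Fin b.m → ℝ) :=
      ContinuousLinearMap.pi fun i => ContinuousLinearMap.proj (Fin.natAdd b.k i)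
    have h1 : (fun w => evalAt X (b.P.hom a) (b.chart.param w)) =ᶠ[𝓝 (Fin.append s t)]
        (fun t => evalAt Y a (b.base.param t)) ∘ π := by
      filter_upwards [b.chart.toChart.open_target.mem_nhds hw] with u hu
      refine (evalAt_pull φ b.P.V b.P.U b.P.le a (b.chart.param_mem hu)).trans ?_
      rw [b.realMap_param u hu]
      rfl
    have hπ : π (Fin.append s t) = t := funext fun i => Fin.append_right s t i
    have h2 : DifferentiableAt ℝ (fun t => evalAt Y a (b.base.param t)) (π (Fin.append s t)) :=
      hπ.symm ▸ b.base.differentiableAt_evalAt htb a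
    rw [h1.fderiv_eq, fderiv_comp _ h2 π.differentiableAt, hπ, π.fderiv]
    rfl
  rw [Chart.coeff_of_mem _ _ _ hw, Chart.coeff_of_mem _ _ _ hse, Chart.coeff_of_mem _ _ _ htb,
    formEval_wedge (pull_structureHom φ b.P.V b.P.U b.P.le) _ _ _ (fun i a => ?_) θ β ω hω]
  · congr 1
    · symm
      refine formEval_map _ _ _ _ _ _ _ (fun a => ?_) (fun j a => ?_) θ
      · rw [RingHom.id_apply, ← evalAt_of_mem, ← evalAt_of_mem, hep s hs]
      · rw [RingHom.id_apply]
        unfold Chart.frame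
        have h1 : (fun s => evalAt X a (e.param s)) =ᶠ[𝓝 s]
            fun s => evalAt X a (b.chart.param (Fin.append s t)) := by
          filter_upwards [(b.isOpen_S ht).mem_nhds hs] with u hu
          rw [hep u hu]
        rw [h1.fderiv_eq, b.fderiv_slice hs ht]
        congr 1
        funext l
        refine Fin.addCases (fun i => ?_) (fun i => ?_) l
        · simp [Pi.single_apply]
        · simp [Pi.single_apply, Fin.ext_iff]
          omega
    · refine formEval_map _ _ _ _ _ _ _ (fun a => ?_) (fun j a => ?_) β
      · rw [← evalAt_of_mem, ← evalAt_of_mem, ← b.realMap_append hs ht]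
        exact (evalAt_pull φ b.P.V b.P.U b.P.le a (b.chart.param_mem hw)).symm
      · unfold Chart.frame
        rw [hpull]
        congr 1
        funext i
        simp [Pi.single_apply]
  · unfold Chart.frame
    rw [hpull]
    have h0 : (fun l => (Pi.single (Fin.castAdd b.m i) 1 : Fin (b.k + b.m) → ℝ) (Fin.natAdd b.k l)) =
        0 := by
      funext l
      rw [Pi.single_apply, if_neg]
      · rfl
      · simp only [Fin.ext_iff, Fin.val_natAdd, Fin.val_castAdd]
        omega
    rw [h0, map_zero]

end Box

/-- If a generator vanished at a point, all forms would. But the differentials of functions with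
prescribed independent differentials there have a wedge product of value `1`. -/
theorem Chart.coeff_ne_zero {X : RScheme} {F : Set (RealPoints X)} {U : X.left.Opens} {k : ℕ}
    (c : Chart X F U k) (θ : Form ℝ (Sec X U) k)
    (hθ : Submodule.span (Sec X U) {θ} = ⊤) {w : Fin k → ℝ} (hw : w ∈ c.toChart.target) :
    c.coeff (structure_const _ _) θ w ≠ 0 := by
  intro h0
  rw [coeff_of_mem _ _ _ hw] at h0
  have hall : ∀ θ' : Form ℝ (Sec X U) k, formEval (evalHom X U (c.param w) (c.param_mem hw))
      (c.frame w) (fun j => c.frame_isTangent (structure_const F U) hw j) θ' = 0 := fun θ' => by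
    obtain ⟨a, rfl⟩ := Submodule.mem_span_singleton.1
      (hθ ▸ Submodule.mem_top : θ' ∈ Submodule.span (Sec X U) {θ})
    rw [formEval_smul, h0, mul_zero]
  obtain ⟨a, ha⟩ := c.exists_coordinates hw
  have h1 := hall (exteriorPower.ιMulti _ k fun i => KaehlerDifferential.D ℝ (Sec X U) (a i))
  rw [formEval_ι] at h1
  have : (Matrix.of fun i j => c.frame w j (a i)) = (1 : Matrix (Fin k) (Fin k) ℝ) := by
    ext i j
    simp only [Matrix.of_apply, frame, (ha i).fderiv, Matrix.one_apply,
      ContinuousLinearMap.proj_apply, Pi.single_apply]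
  rw [this, Matrix.det_one] at h1
  exact one_ne_zero h1

end RealVar

namespace RealVar

/-! ### Fubini on a product of coordinate spaces. -/

section Analysis

theorem continuous_of_eq_zero_off {T M : Type*} [TopologicalSpace T] [TopologicalSpace M] [Zero M]
    {K O : Set T} (hK : IsClosed K) (hO : IsOpen O) (hKO : K ⊆ O) {g : T → M}
    (hg : ContinuousOn g O) (h0 : ∀ x ∉ K, g x = 0) : Continuous g := by
  refine continuous_of_tsupport fun x hx => hg.continuousAt (hO.mem_nhds (hKO ?_))
  exact closure_minimal (Function.support_subset_iff'.2 h0) hK hx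

variable {k m : ℕ}

theorem measurePreserving_append : MeasurePreserving
    (Fin.appendHomeomorph (X := ℝ) k m).toMeasurableEquiv volume volume := by
  refine ⟨(Fin.appendHomeomorph (X := ℝ) k m).toMeasurableEquiv.measurable, ?_⟩
  symm
  refine Measure.pi_eq fun s hs => ?_
  rw [MeasurableEquiv.map_apply]
  have : (Fin.appendHomeomorph (X := ℝ) k m).toMeasurableEquiv ⁻¹' Set.univ.pi s =
      (Set.univ.pi fun i => s (Fin.castAdd m i)) ×ˢ (Set.univ.pi fun i => s (Fin.natAdd k i)) := by
    ext p
    simp only [Set.mem_preimage, Set.mem_univ_pi, Set.mem_prod]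
    change (∀ j, Fin.append p.1 p.2 j ∈ s j) ↔ _
    constructor
    · intro h
      exact ⟨fun i => by simpa using h (Fin.castAdd m i), fun i => by simpa using h (Fin.natAdd k i)⟩
    · rintro ⟨h, h'⟩ j
      refine Fin.addCases (fun i => ?_) (fun i => ?_) j
      · simpa using h i
      · simpa using h' i
  rw [this, Measure.volume_eq_prod, Measure.prod_prod, volume_pi_pi, volume_pi_pi,
    Fin.prod_univ_add]

variable {H : (Fin (k + m) → ℝ) → ℝ}

theorem continuous_integral_append (hH : Continuous H) (hc : HasCompactSupport H) :
    Continuous fun t => ∫ s, H (Fin.append s t) := by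
  -- One compact set contains the supports of all slices of `H`, so the parameter integral runs over
  -- a fixed compact set.
  let K : Set (Fin k → ℝ) := (fun w i => w (Fin.castAdd m i)) '' tsupport H
  have hK : IsCompact K := hc.isCompact.image (by fun_prop)
  have h0 : ∀ t, ∀ s ∉ K, H (Fin.append s t) = 0 := fun t s hs => by
    by_contra hne
    exact hs ⟨_, subset_tsupport _ hne, by simp only [Fin.append_left]⟩
  have h1 : (fun t => ∫ s, H (Fin.append s t)) = fun t => ∫ s in K, H (Fin.append s t) := by
    funext t
    exact (setIntegral_eq_integral_of_forall_compl_eq_zero (h0 t)).symm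
  rw [h1]
  have h2 : Continuous (Function.uncurry fun (t : Fin m → ℝ) (s : Fin k → ℝ) =>
      H (Fin.append s t)) :=
    hH.comp ((Fin.appendHomeomorph (X := ℝ) k m).continuous.comp continuous_swap)
  exact continuous_parametric_integral_of_continuous h2 hK

theorem integral_append_eq_zero {t : Fin m → ℝ} (ht : ∀ s, H (Fin.append s t) = 0) :
    ∫ s, H (Fin.append s t) = 0 := by
  simp only [ht, integral_zero]

theorem setIntegral_append (hH : Continuous H) (hc : HasCompactSupport H)
    {A : Set (Fin m → ℝ)} (hA : MeasurableSet A) :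
    ∫ w in {w : Fin (k + m) → ℝ | (fun i => w (Fin.natAdd k i)) ∈ A}, H w =
      ∫ t in A, ∫ s, H (Fin.append s t) := by
  have hB : MeasurableSet {w : Fin (k + m) → ℝ | (fun i => w (Fin.natAdd k i)) ∈ A} :=
    measurableSet_preimage (by fun_prop) hA
  have hi : Integrable H := hH.integrable_of_hasCompactSupport hc
  let e := (Fin.appendHomeomorph (X := ℝ) k m).toMeasurableEquiv
  have he : ∀ p : (Fin k → ℝ) × (Fin m → ℝ), e p = Fin.append p.1 p.2 := fun _ => rfl
  have hmp : MeasurePreserving e volume volume := measurePreserving_append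
  rw [← hmp.setIntegral_preimage_emb e.measurableEmbedding]
  have hpre : e ⁻¹' {w : Fin (k + m) → ℝ | (fun i => w (Fin.natAdd k i)) ∈ A} =
      Set.univ ×ˢ A := by
    ext p
    simp [he]
  have hie : Integrable (fun p => H (e p)) := (hmp.integrable_comp_emb e.measurableEmbedding).2 hi
  rw [hpre, Measure.volume_eq_prod, ← Measure.prod_restrict, Measure.restrict_univ]
  rw [integral_prod_symm]
  · rfl
  · have : ((volume : Measure (Fin k → ℝ)).prod ((volume : Measure (Fin m → ℝ)).restrict A)) ≤
        (volume : Measure ((Fin k → ℝ) × (Fin m → ℝ))) := by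
      rw [Measure.volume_eq_prod, ← Measure.restrict_univ (μ := (volume : Measure (Fin k → ℝ))),
        Measure.prod_restrict, Measure.restrict_univ]
      exact Measure.restrict_le_self
    exact hie.mono_measure this

end Analysis

/-! ### Integrands in coordinates, and local finiteness. -/

namespace Chart

variable {X : RScheme} {F : Set (RealPoints X)} {U : X.left.Opens} {k : ℕ}
  {R : Type} [CommRing R] [Algebra R (Sec X U)]
  {hR : ∀ r : R, ∃ t : ℝ, ∀ x ∈ F, x ∈ onOpen X U → evalAt X (algebraMap R (Sec X U) r) x = t}

theorem integral_measure (c : Chart X F U k) (θ : Form R (Sec X U) k) {f : RealPoints X → ℝ}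
    (hf : Measurable f) : ∫ x, f x ∂c.measure hR θ =
      ∫ w in c.toChart.target, f (c.param w) * |c.coeff hR θ w| := by
  have hm := c.aemeasurable_param
  rw [measure, integral_map (hm.mono_ac (withDensity_absolutelyContinuous _ _))
    hf.aestronglyMeasurable, integral_withDensity_eq_integral_toReal_smul₀ (c.measurable_density θ)
      (ae_of_all _ fun _ => ENNReal.ofReal_lt_top)]
  simp only [ENNReal.toReal_ofReal (abs_nonneg _), smul_eq_mul, mul_comm]

/-- A function on `X(ℝ)` times the density of a form, in the coordinates of a chart. -/
def density (c : Chart X F U k) (hR : ∀ r : R, ∃ t : ℝ, ∀ x ∈ F, x ∈ onOpen X U →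
      evalAt X (algebraMap R (Sec X U) r) x = t) (θ : Form R (Sec X U) k) (f : RealPoints X → ℝ) :
    (Fin k → ℝ) → ℝ :=
  c.toChart.target.indicator fun w => f (c.param w) * |c.coeff hR θ w|

theorem isCompact_coordinates (c : Chart X F U k) {K : Set (RealPoints X)} (hK : IsCompact K)
    (hKc : K ⊆ c.dom) : IsCompact (c.toChart '' (Subtype.val ⁻¹' K)) := by
  have hF : K ⊆ Set.range (Subtype.val : F → RealPoints X) := fun x hx => by
    obtain ⟨y, -, rfl⟩ := hKc hx
    exact ⟨y, rfl⟩
  refine ((Topology.IsInducing.subtypeVal.isCompact_preimage_iff hF).2 hK).image_of_continuousOn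
    (c.toChart.continuousOn.mono fun x hx => ?_)
  obtain ⟨y, hy, hyx⟩ := hKc hx
  exact (Subtype.ext hyx : y = x) ▸ hy

theorem mem_coordinates (c : Chart X F U k) {K : Set (RealPoints X)} {w : Fin k → ℝ}
    (hw : w ∈ c.toChart.target) (h : c.param w ∈ K) :
    w ∈ c.toChart '' (Subtype.val ⁻¹' K) :=
  ⟨c.toChart.symm w, h, c.toChart.right_inv hw⟩

theorem coordinates_subset (c : Chart X F U k) {K : Set (RealPoints X)} (hKc : K ⊆ c.dom) :
    c.toChart '' (Subtype.val ⁻¹' K) ⊆ c.toChart.target := by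
  rintro _ ⟨x, hx, rfl⟩
  obtain ⟨y, hy, hyx⟩ := hKc hx
  exact c.toChart.map_source ((Subtype.ext hyx : y = x) ▸ hy)

theorem density_eq_zero (c : Chart X F U k) (θ : Form R (Sec X U) k) {f : RealPoints X → ℝ}
    {w : Fin k → ℝ} (hw : w ∉ c.toChart '' (Subtype.val ⁻¹' tsupport f)) :
    c.density hR θ f w = 0 := by
  rw [density, Set.indicator_apply_eq_zero]
  intro h
  by_cases hf : f (c.param w) = 0
  · rw [hf, zero_mul]
  · exact (hw (c.mem_coordinates h (subset_tsupport _ hf))).elim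

variable {f : RealPoints X → ℝ}

/-- The compact support of `f` lies in the chart, so its coordinates form a compact subset of the
target, and the extension by zero stays continuous. -/
theorem continuous_density (c : Chart X F U k) (θ : Form R (Sec X U) k)
    (hf : Continuous f) (hc : HasCompactSupport f) (hfc : tsupport f ⊆ c.dom) :
    Continuous (c.density hR θ f) := by
  refine continuous_of_eq_zero_off (c.isCompact_coordinates hc hfc).isClosed c.toChart.open_target
    (c.coordinates_subset hfc) ?_ fun w hw => c.density_eq_zero θ hw
  refine ((hf.comp_continuousOn c.continuousOn_param).mul
    (continuous_abs.comp_continuousOn (c.continuousOn_coeff (hR := hR) θ))).congr fun w hw => ?_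
  rw [density, Set.indicator_of_mem hw]
  rfl

theorem hasCompactSupport_density (c : Chart X F U k) (θ : Form R (Sec X U) k)
    (hc : HasCompactSupport f) (hfc : tsupport f ⊆ c.dom) :
    HasCompactSupport (c.density hR θ f) :=
  HasCompactSupport.intro (c.isCompact_coordinates hc hfc) fun _ hw => c.density_eq_zero θ hw

/-- A point of a chart has a neighbourhood of finite measure. -/
theorem exists_measure_lt_top (c : Chart X F U k) (θ : Form R (Sec X U) k) {x : RealPoints X}
    (hx : x ∈ c.dom) : ∃ N, IsOpen N ∧ x ∈ N ∧ c.measure hR θ N < ⊤ := by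
  obtain ⟨y, hy, rfl⟩ := hx
  have ht : c.toChart.target ∈ 𝓝 (c.toChart y) :=
    c.toChart.open_target.mem_nhds (c.toChart.map_source hy)
  obtain ⟨r, hr, hrt⟩ := Metric.nhds_basis_closedBall.mem_iff.1 ht
  have hpre : c.toChart ⁻¹' Metric.closedBall (c.toChart y) r ∈ 𝓝 y :=
    (c.toChart.continuousAt hy).preimage_mem_nhds (Metric.closedBall_mem_nhds _ hr)
  obtain ⟨N, hN, hNs⟩ := (mem_nhds_subtype _ _ _).1 hpre
  obtain ⟨N', hN', hNo, hyN⟩ := mem_nhds_iff.1 hN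
  refine ⟨N', hNo, hyN, ?_⟩
  rw [measure_apply _ _ hNo.measurableSet]
  have hsub : c.toChart.target ∩ c.param ⁻¹' N' ⊆ Metric.closedBall (c.toChart y) r := by
    rintro w ⟨hw, hwN⟩
    have : c.toChart (c.toChart.symm w) ∈ Metric.closedBall (c.toChart y) r := hNs (hN' hwN)
    rwa [c.toChart.right_inv hw] at this
  refine (lintegral_mono_set hsub).trans_lt ?_
  have hi : IntegrableOn (fun w => |c.coeff hR θ w|) (Metric.closedBall (c.toChart y) r) :=
    (continuous_abs.comp_continuousOn ((c.continuousOn_coeff θ).mono hrt)).integrableOn_compact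
      (isCompact_closedBall _ _)
  have := hi.lintegral_lt_top
  exact this

theorem exists_compact_nhds (c : Chart X Set.univ U k) {x : RealPoints X} (hx : x ∈ c.dom) :
    ∃ K, IsCompact K ∧ K ∈ 𝓝 x := by
  obtain ⟨y, hy, rfl⟩ := hx
  have ht : c.toChart.target ∈ 𝓝 (c.toChart y) :=
    c.toChart.open_target.mem_nhds (c.toChart.map_source hy)
  obtain ⟨r, hr, hrt⟩ := Metric.nhds_basis_closedBall.mem_iff.1 ht
  refine ⟨c.param '' Metric.closedBall (c.toChart y) r,
    (isCompact_closedBall _ _).image_of_continuousOn (c.continuousOn_param.mono hrt), ?_⟩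
  have h1 : c.toChart ⁻¹' Metric.closedBall (c.toChart y) r ∩ c.toChart.source ∈ 𝓝 y :=
    Filter.inter_mem ((c.toChart.continuousAt hy).preimage_mem_nhds (Metric.closedBall_mem_nhds _ hr))
      (c.toChart.open_source.mem_nhds hy)
  have h2 := (isOpen_univ.isOpenEmbedding_subtypeVal.image_mem_nhds (x := y)).2 h1
  refine Filter.mem_of_superset h2 ?_
  rintro _ ⟨z, ⟨hz, hzs⟩, rfl⟩
  exact ⟨c.toChart z, hz, congrArg Subtype.val (c.toChart.left_inv hzs)⟩

end Chart

section Topology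

variable {X Y : RScheme}

theorem locallyCompact_realPoints [Smooth X.hom] [IsSeparated X.hom] :
    LocallyCompactSpace (RealPoints X) := by
  have := t2_realPoints X
  have : WeaklyLocallyCompactSpace (RealPoints X) := ⟨fun x => by
    obtain ⟨U, hU, hx, -, n, hn⟩ := exists_standardSmooth_mem (x := x) (D := ⊤)
      (onOpen_top ▸ trivial)
    obtain ⟨c, hc⟩ := exists_chart_of_isStandardSmooth hU hn hx
    exact c.exists_compact_nhds ⟨_, hc, rfl⟩⟩
  infer_instance

theorem TopForm.isLocallyFiniteMeasure [Smooth X.hom] [SecondCountableTopology (RealPoints X)]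
    (ω : TopForm X ⊤) : IsLocallyFiniteMeasure ω.measure := ⟨fun x => by
  obtain ⟨U, hU, hx, -, n, hn⟩ := exists_standardSmooth_mem (x := x) (D := ⊤) (onOpen_top ▸ trivial)
  obtain ⟨c, hc⟩ := exists_chart_of_isStandardSmooth hU hn hx
  let c' : TopChart (X := X) ⊤ := ⟨U, n, hU, le_top, hn, c⟩
  have hxc : x ∈ c.dom := ⟨_, hc, rfl⟩
  obtain ⟨N, hN, hxN, hlt⟩ := c.exists_measure_lt_top (hR := structure_const _ _)
    (ω.val U n hU le_top hn) hxc
  obtain ⟨O, hO, hOd⟩ := c.exists_dom_eq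
  rw [Set.univ_inter] at hOd
  refine ⟨N ∩ c.dom, (hN.inter (hOd ▸ hO)).mem_nhds ⟨hxN, hxc⟩, ?_⟩
  rw [show ω.measure (N ∩ c.dom) = _ from ω.measure_inter_dom c' hN.measurableSet]
  exact hlt⟩

theorem isClosed_fibre [IsSeparated Y.hom] (φ : X ⟶ Y) (y : RealPoints Y) :
    IsClosed (fibre φ y) := by
  have := t2_realPoints Y
  exact isClosed_singleton.preimage (continuous_realMap φ)

/-- Near a point of the fibre the measure is that of a slice of a box, where the coefficient is
continuous. The complement of the fibre is open and null. -/
theorem RelTopForm.isLocallyFiniteMeasure {φ : X ⟶ Y} [Smooth Y.hom] [Smooth φ.left]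
    [IsSeparated Y.hom] [SecondCountableTopology (RealPoints X)] (η : RelTopForm φ)
    (y : RealPoints Y) : IsLocallyFiniteMeasure (η.fibreMeasure y) := ⟨fun x => by
  have hF := (isClosed_fibre φ y).measurableSet
  by_cases hx : x ∈ fibre φ y
  · obtain ⟨b, -, hxb⟩ := exists_box (φ := φ) (x := x) (D := ⊤) (onOpen_top ▸ trivial)
    obtain ⟨w, hw, hwx⟩ := b.chart.mem_dom.1 hxb
    have ht := (b.mem_target.1 hw).2
    obtain ⟨t, ht, rfl⟩ : ∃ t ∈ b.T, b.base.param t = y :=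
      ⟨_, ht, by rw [← b.realMap_param w hw, hwx]; exact hx⟩
    obtain ⟨e, he, hep, hed⟩ := b.exists_slice ht
    have hxe : x ∈ e.dom := hed ▸ ⟨hx, hxb⟩
    obtain ⟨N, hN, hxN, hlt⟩ := e.exists_measure_lt_top (hR := b.P.const_on_fibre _)
      (η.val b.P b.k b.smooth) hxe
    obtain ⟨O, hO, hOd⟩ := b.chart.exists_dom_eq
    rw [Set.univ_inter] at hOd
    refine ⟨N ∩ b.chart.dom, (hN.inter (hOd ▸ hO)).mem_nhds ⟨hxN, hxb⟩, ?_⟩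
    have h1 := η.fibreMeasure_restrict_dom hF ⟨b.P, b.k, b.smooth, e⟩
    rw [← measure_inter_conull (η.fibreMeasure_compl_fibre hF), Set.inter_assoc,
      Set.inter_comm b.chart.dom, ← hed, ← Measure.restrict_apply hN.measurableSet, h1]
    exact hlt
  · refine ⟨(fibre φ y)ᶜ, (isClosed_fibre φ y).isOpen_compl.mem_nhds hx, ?_⟩
    rw [η.fibreMeasure_compl_fibre hF]
    exact ENNReal.zero_lt_top⟩

end Topology

end RealVar

namespace RealVar

/-! ### Integrals of functions supported in one chart. -/

namespace Chart

variable {X : RScheme} {U : X.left.Opens} {k : ℕ} (c : Chart X Set.univ U k)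

/-- The coordinates of a point. -/
def coord (x : RealPoints X) : Fin k → ℝ := c.toChart ⟨x, trivial⟩

theorem isOpen_dom : IsOpen c.dom := by
  obtain ⟨O, hO, h⟩ := c.exists_dom_eq
  rw [h, Set.univ_inter]
  exact hO

theorem continuousOn_coord : ContinuousOn c.coord c.dom := by
  refine c.toChart.continuousOn.comp (by fun_prop) ?_
  rintro _ ⟨x, hx, rfl⟩
  exact hx

theorem coord_mem {x : RealPoints X} (hx : x ∈ c.dom) : c.coord x ∈ c.toChart.target := by
  obtain ⟨x, hx, rfl⟩ := hx
  exact c.toChart.map_source hx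

theorem param_coord {x : RealPoints X} (hx : x ∈ c.dom) : c.param (c.coord x) = x := by
  obtain ⟨x, hx, rfl⟩ := hx
  exact congrArg Subtype.val (c.toChart.left_inv hx)

theorem coord_param {w : Fin k → ℝ} (hw : w ∈ c.toChart.target) : c.coord (c.param w) = w :=
  c.toChart.right_inv hw

end Chart

section Integrals

variable {X Y : RScheme} {D : X.left.Opens} [SecondCountableTopology (RealPoints X)]

theorem TopForm.setIntegral_eq (ω : TopForm X D) (c : TopChart D) {g : RealPoints X → ℝ}
    (hg : Measurable g) (h0 : ∀ x ∉ c.chart.dom, g x = 0) {A : Set (RealPoints X)}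
    (hA : MeasurableSet A) : ∫ x in A, g x ∂ω.measure =
      ∫ w in c.chart.toChart.target ∩ c.chart.param ⁻¹' A, g (c.chart.param w) * |ω.coeff c w| := by
  have h1 : ∀ x ∉ c.chart.dom, A.indicator g x = 0 := fun x hx => by
    rw [Set.indicator_apply_eq_zero]; exact fun _ => h0 x hx
  rw [← integral_indicator hA, ← setIntegral_eq_integral_of_forall_compl_eq_zero h1,
    ω.measure_restrict_dom c, chartMeasure, c.chart.integral_measure _ (hg.indicator hA),
    ← integral_indicator c.chart.measurableSet_target,
    ← integral_indicator (c.chart.measurableSet_inter_preimage hA)]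
  congr 1
  funext w
  by_cases hw : w ∈ c.chart.toChart.target
  · by_cases hwA : c.chart.param w ∈ A
    · rw [Set.indicator_of_mem hw, Set.indicator_of_mem hwA, Set.indicator_of_mem (by exact ⟨hw, hwA⟩)]
      rfl
    · rw [Set.indicator_of_mem hw, Set.indicator_of_notMem hwA, zero_mul,
        Set.indicator_of_notMem (fun h => hwA h.2)]
  · rw [Set.indicator_of_notMem hw, Set.indicator_of_notMem (fun h => hw h.1)]

theorem TopForm.setLIntegral_eq (ω : TopForm X D) (c : TopChart D) {g : RealPoints X → ℝ≥0∞}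
    (hg : Measurable g) (h0 : ∀ x ∉ c.chart.dom, g x = 0) {A : Set (RealPoints X)}
    (hA : MeasurableSet A) : ∫⁻ x in A, g x ∂ω.measure =
      ∫⁻ w in c.chart.toChart.target ∩ c.chart.param ⁻¹' A,
        g (c.chart.param w) * ENNReal.ofReal |ω.coeff c w| := by
  have h1 : ∀ x, c.chart.dom.indicator (A.indicator g) x = A.indicator g x := fun x => by
    by_cases hx : x ∈ c.chart.dom
    · rw [Set.indicator_of_mem hx]
    · rw [Set.indicator_of_notMem hx]
      symm
      rw [Set.indicator_apply_eq_zero]; exact fun _ => h0 x hx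
  rw [← lintegral_indicator hA, ← lintegral_congr h1,
    lintegral_indicator (c.chart.measurableSet_dom MeasurableSet.univ), ω.measure_restrict_dom c,
    chartMeasure, c.chart.lintegral_measure _ (hg.indicator hA),
    ← lintegral_indicator c.chart.measurableSet_target,
    ← lintegral_indicator (c.chart.measurableSet_inter_preimage hA)]
  congr 1
  funext w
  by_cases hw : w ∈ c.chart.toChart.target
  · by_cases hwA : c.chart.param w ∈ A
    · rw [Set.indicator_of_mem hw, Set.indicator_of_mem hwA, Set.indicator_of_mem (by exact ⟨hw, hwA⟩)]
      rfl
    · rw [Set.indicator_of_mem hw, Set.indicator_of_notMem hwA, zero_mul,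
        Set.indicator_of_notMem (fun h => hwA h.2)]
  · rw [Set.indicator_of_notMem hw, Set.indicator_of_notMem (fun h => hw h.1)]

theorem RelTopForm.integral_eq_zero {φ : X ⟶ Y} [IsSeparated Y.hom] (η : RelTopForm φ)
    {y : RealPoints Y} {f : RealPoints X → ℝ} (h : ∀ x ∈ fibre φ y, f x = 0) :
    ∫ x, f x ∂η.fibreMeasure y = 0 := by
  refine integral_eq_zero_of_ae ?_
  have h0 := η.fibreMeasure_compl_fibre (isClosed_fibre φ y).measurableSet
  exact measure_mono_null (fun x hx hxF => hx (h x hxF)) h0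

end Integrals

/-! ### Integration along the fibres in one box. -/

namespace Box

variable {X Y : RScheme} {φ : X ⟶ Y} (b : Box φ)

/-- The box as a chart for top forms of `X`. -/
def topChart {D : X.left.Opens} (hD : b.P.U ≤ D) : TopChart D :=
  ⟨b.P.U, b.k + b.m, b.P.affineU, hD, b.P.relativeDimension_add b.smooth b.smoothBase, b.chart⟩

/-- The base of the box as a chart for top forms of `Y`. -/
def baseChart {D : Y.left.Opens} (hD : b.P.V ≤ D) : TopChart D :=
  ⟨b.P.V, b.m, b.P.affineV, hD, b.smoothBase, b.base⟩

theorem realMap_mem_dom {x : RealPoints X} (hx : x ∈ b.chart.dom) : realMap φ x ∈ b.base.dom := by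
  obtain ⟨w, hw, rfl⟩ := b.chart.mem_dom.1 hx
  rw [b.realMap_param w hw]
  refine b.base.param_mem_dom ?_
  rw [b.base_target_eq]
  exact (b.mem_target.1 hw).2

/-- The density of the push-forward of `f |θ|`, in the coordinates of the base. -/
def push (θ : Form ℝ b.P.A (b.k + b.m)) (f : RealPoints X → ℝ) (t : Fin b.m → ℝ) : ℝ :=
  ∫ s, b.chart.density (structure_const _ _) θ f (Fin.append s t)

variable {f : RealPoints X → ℝ} (θ : Form ℝ b.P.A (b.k + b.m))

theorem push_nonneg (hf : ∀ x, 0 ≤ f x) (t : Fin b.m → ℝ) : 0 ≤ b.push θ f t :=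
  integral_nonneg fun _ => Set.indicator_nonneg
    (fun _ _ => mul_nonneg (hf _) (abs_nonneg _)) _

theorem push_eq_zero {t : Fin b.m → ℝ} (h : ∀ x ∈ fibre φ (b.base.param t), f x = 0) :
    b.push θ f t = 0 := by
  refine integral_append_eq_zero fun s => ?_
  rw [Chart.density, Set.indicator_apply_eq_zero]
  intro hw
  obtain ⟨hs, ht⟩ := b.append_mem_target.1 hw
  rw [h _ (b.realMap_append hs ht), zero_mul]

theorem continuous_push (hf : Continuous f) (hc : HasCompactSupport f)
    (hfc : tsupport f ⊆ b.chart.dom) : Continuous (b.push θ f) :=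
  continuous_integral_append (b.chart.continuous_density θ hf hc hfc)
    (b.chart.hasCompactSupport_density θ hc hfc)

/-- The function is continuous, and on `T` it vanishes off the coordinates of the image of the
support of `f`, a compact set. -/
theorem integrableOn_push (hf : Continuous f) (hc : HasCompactSupport f)
    (hfc : tsupport f ⊆ b.chart.dom) : IntegrableOn (b.push θ f) b.T := by
  let K : Set (RealPoints Y) := realMap φ '' tsupport f
  have hK : IsCompact K := hc.isCompact.image (continuous_realMap φ)
  have hKd : K ⊆ b.base.dom := by
    rintro _ ⟨x, hx, rfl⟩
    exact b.realMap_mem_dom (hfc hx)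
  have hC := b.base.isCompact_coordinates hK hKd
  have h1 : IntegrableOn (b.push θ f) (b.base.toChart '' (Subtype.val ⁻¹' K)) :=
    (b.continuous_push θ hf hc hfc).continuousOn.integrableOn_compact hC
  refine h1.of_forall_sdiff_eq_zero b.isOpen_T.measurableSet fun t ht => b.push_eq_zero θ ?_
  intro x hx
  by_contra hne
  refine ht.2 (b.base.mem_coordinates (b.base_target_eq ▸ ht.1) ?_)
  exact ⟨x, subset_tsupport _ hne, hx⟩

/-- The preimage of `A` in the box is `S` times the coordinates of `A`, so this is Fubini. -/
theorem setIntegral_preimage [SecondCountableTopology (RealPoints X)] {D : X.left.Opens}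
    (ω : TopForm X D) (hD : b.P.U ≤ D) (hf : Continuous f)
    (hc : HasCompactSupport f) (hfc : tsupport f ⊆ b.chart.dom) {A : Set (RealPoints Y)}
    (hA : MeasurableSet A) : ∫ x in realMap φ ⁻¹' A, f x ∂ω.measure =
      ∫ t in b.T ∩ b.base.param ⁻¹' A, b.push
        (ω.val b.P.U _ b.P.affineU hD (b.P.relativeDimension_add b.smooth b.smoothBase)) f t := by
  have hA' : MeasurableSet (realMap φ ⁻¹' A) := (continuous_realMap φ).measurable hA
  have hAT : MeasurableSet (b.T ∩ b.base.param ⁻¹' A) :=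
    b.base_target_eq ▸ b.base.measurableSet_inter_preimage hA
  let B : Set (Fin (b.k + b.m) → ℝ) :=
    {w | (fun i => w (Fin.natAdd b.k i)) ∈ b.T ∩ b.base.param ⁻¹' A}
  have hB : MeasurableSet B := measurableSet_preimage (by fun_prop) hAT
  refine (ω.setIntegral_eq (b.topChart hD) hf.measurable (fun x hx => ?_) hA').trans ?_
  · exact image_eq_zero_of_notMem_tsupport fun h => hx (hfc h)
  refine Eq.trans ?_ (setIntegral_append (b.chart.continuous_density _ hf hc hfc)
    (b.chart.hasCompactSupport_density _ hc hfc) hAT)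
  change ∫ w in b.chart.toChart.target ∩ b.chart.param ⁻¹' (realMap φ ⁻¹' A),
    f (b.chart.param w) * |b.chart.coeff _ _ w| = _
  rw [← integral_indicator hB,
    ← integral_indicator (b.chart.measurableSet_inter_preimage hA')]
  congr 1
  funext w
  by_cases hw : w ∈ b.chart.toChart.target
  · have hmem : w ∈ b.chart.toChart.target ∩
        b.chart.param ⁻¹' (realMap φ ⁻¹' A) ↔
        (fun i => w (Fin.natAdd b.k i)) ∈ b.T ∩ b.base.param ⁻¹' A := by
      simp only [Set.mem_inter_iff, Set.mem_preimage, b.realMap_param w hw,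
        (b.mem_target.1 hw).2, hw, true_and]
    by_cases hwA : (fun i => w (Fin.natAdd b.k i)) ∈ b.T ∩ b.base.param ⁻¹' A
    · rw [Set.indicator_of_mem (hmem.2 hwA), Set.indicator_of_mem (s := B) hwA, Chart.density,
        Set.indicator_of_mem hw]
      rfl
    · rw [Set.indicator_of_notMem (fun h => hwA (hmem.1 h)), Set.indicator_of_notMem (s := B) hwA]
  · rw [Set.indicator_of_notMem (fun h => hw h.1)]
    symm
    rw [Set.indicator_apply_eq_zero]
    intro _
    rw [Chart.density, Set.indicator_of_notMem hw]

variable [SecondCountableTopology (RealPoints X)] [IsSeparated Y.hom]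
  {ωX : TopForm X ⊤} {ωY : TopForm Y ⊤} {η : RelTopForm φ}

/-- On the slice over `t` the coefficient of `ω_X` is that of `η` times that of `ω_Y` at `t`. The
second factor is constant in `s` and leaves the integral. -/
theorem push_eq (hη : IsQuotient φ ωX ωY η) (hf : Continuous f)
    (hfc : tsupport f ⊆ b.chart.dom) {t : Fin b.m → ℝ} (ht : t ∈ b.T) :
    b.push (ωX.val b.P.U _ b.P.affineU le_top
        (b.P.relativeDimension_add b.smooth b.smoothBase)) f t =
      (∫ x, f x ∂η.fibreMeasure (b.base.param t)) * |ωY.coeff (b.baseChart le_top) t| := by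
  have hF := (isClosed_fibre φ (b.base.param t)).measurableSet
  obtain ⟨e, he, hep, hed⟩ := b.exists_slice ht
  obtain ⟨θ, hθ, hω⟩ := hη b.P b.k b.m b.smooth b.smoothBase
    (b.P.relativeDimension_add b.smooth b.smoothBase)
  have hS := b.isOpen_S ht
  have h1 : ∫ x, f x ∂η.fibreMeasure (b.base.param t) =
      ∫ x, f x ∂(η.chartMeasure ⟨b.P, b.k, b.smooth, e⟩) := by
    have h0 : ∀ x ∉ b.chart.dom, f x = 0 := fun x hx =>
      image_eq_zero_of_notMem_tsupport fun h => hx (hfc h)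
    rw [← η.fibreMeasure_restrict_dom hF, ← setIntegral_eq_integral_of_forall_compl_eq_zero h0]
    -- The fibre measure is null off the fibre, so it does not distinguish the box from its slice.
    refine setIntegral_congr_set ?_
    change (b.chart.dom : Set _) =ᵐ[_] (e.dom : Set _)
    rw [hed]
    filter_upwards [measure_eq_zero_iff_ae_notMem.1 (η.fibreMeasure_compl_fibre hF)] with x hx
    have hx' : x ∈ fibre φ (b.base.param t) := not_not.1 hx
    exact propext ⟨fun h => ⟨hx', h⟩, fun h => h.2⟩
  rw [h1, RelTopForm.chartMeasure, e.integral_measure _ hf.measurable, he,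
    ← integral_indicator hS.measurableSet, ← integral_mul_const]
  refine integral_congr_ae (ae_of_all _ fun s => ?_)
  by_cases hs : s ∈ b.S
  · simp only [Chart.density, Set.indicator_of_mem hs,
      Set.indicator_of_mem (b.append_mem_target.2 ⟨hs, ht⟩)]
    rw [b.coeff_mul ht he hep θ _ _ hω hs, hθ, hep s hs, abs_mul, mul_assoc]
    rfl
  · simp only [Chart.density, Set.indicator_of_notMem hs, zero_mul]
    rw [Set.indicator_of_notMem fun h => hs (b.append_mem_target.1 h).1]

/-- On the base chart the fibre integral is the continuous push-forward density divided by the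
nonvanishing coefficient of `ω_Y`; it is zero off the compact image of the support of `f`. -/
theorem continuous_fibreIntegral (hωY : ωY.NowhereVanishing) (hη : IsQuotient φ ωX ωY η)
    (hf : Continuous f) (hc : HasCompactSupport f) (hfc : tsupport f ⊆ b.chart.dom) :
    Continuous fun y => ∫ x, f x ∂η.fibreMeasure y := by
  have := t2_realPoints Y
  have hK : IsCompact (realMap φ '' tsupport f) := hc.isCompact.image (continuous_realMap φ)
  refine continuous_of_eq_zero_off hK.isClosed b.base.isOpen_dom ?_ ?_ fun y hy => ?_
  · rintro _ ⟨x, hx, rfl⟩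
    exact b.realMap_mem_dom (hfc hx)
  · have hγ0 : ∀ t ∈ b.base.toChart.target, ωY.coeff (b.baseChart le_top) t ≠ 0 := fun t ht =>
      b.base.coeff_ne_zero _ (hωY b.P.V b.m b.P.affineV le_top b.smoothBase) ht
    have h1 : ContinuousOn (fun t => b.push (ωX.val b.P.U _ b.P.affineU le_top
        (b.P.relativeDimension_add b.smooth b.smoothBase)) f t / |ωY.coeff (b.baseChart le_top) t|)
        b.base.toChart.target :=
      (b.continuous_push _ hf hc hfc).continuousOn.div
        (continuous_abs.comp_continuousOn (b.base.continuousOn_coeff _))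
        fun t ht => abs_ne_zero.2 (hγ0 t ht)
    refine (h1.comp b.base.continuousOn_coord fun y hy => b.base.coord_mem hy).congr fun y hy => ?_
    have hT := b.base.coord_mem hy
    rw [Function.comp_apply, b.push_eq hη hf hfc (b.base_target_eq ▸ hT),
      mul_div_cancel_right₀ _ (abs_ne_zero.2 (hγ0 _ hT)), b.base.param_coord hy]
  · refine η.integral_eq_zero fun x hx => ?_
    by_contra hne
    exact hy ⟨x, subset_tsupport _ hne, hx⟩

theorem setIntegral_fibreIntegral [SecondCountableTopology (RealPoints Y)]
    (hωY : ωY.NowhereVanishing) (hη : IsQuotient φ ωX ωY η)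
    (hf : Continuous f) (hc : HasCompactSupport f) (hfc : tsupport f ⊆ b.chart.dom)
    {A : Set (RealPoints Y)} (hA : MeasurableSet A) :
    ∫ x in realMap φ ⁻¹' A, f x ∂ωX.measure =
      ∫ y in A, (∫ x, f x ∂η.fibreMeasure y) ∂ωY.measure := by
  rw [b.setIntegral_preimage ωX le_top hf hc hfc hA, ωY.setIntegral_eq (b.baseChart le_top)
    (b.continuous_fibreIntegral hωY hη hf hc hfc).measurable (fun y hy => ?_) hA]
  · change _ = ∫ w in b.base.toChart.target ∩ b.base.param ⁻¹' A, _
    rw [b.base_target_eq]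
    refine setIntegral_congr_fun (b.base_target_eq ▸ b.base.measurableSet_inter_preimage hA)
      fun t ht => ?_
    exact b.push_eq hη hf hfc ht.1
  · refine η.integral_eq_zero fun x hx => ?_
    by_contra hne
    refine hy ?_
    rw [← show realMap φ x = y from hx]
    exact b.realMap_mem_dom (hfc (subset_tsupport _ hne))

end Box

/-! ### Partitions of unity subordinate to boxes. -/

section Partition

variable {X Y : RScheme} {φ : X ⟶ Y} [T2Space (RealPoints X)] [LocallyCompactSpace (RealPoints X)]

/-- A partition of unity on a compact set that is subordinate to boxes. -/
theorem exists_box_partition {K : Set (RealPoints X)} (hK : IsCompact K) {p : Box φ → Prop}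
    (h : ∀ x ∈ K, ∃ b, p b ∧ x ∈ b.chart.dom) :
    ∃ (n : ℕ) (b : Fin n → Box φ) (ρ : Fin n → C(RealPoints X, ℝ)), (∀ i, p (b i)) ∧
      (∀ i, tsupport (ρ i) ⊆ (b i).chart.dom) ∧ (∀ x ∈ K, ∑ i, ρ i x = 1) ∧
      (∀ i x, 0 ≤ ρ i x) ∧ ∀ i, HasCompactSupport (ρ i) := by
  choose! β hβp hβx using fun x : K => h x x.2
  obtain ⟨t, ht⟩ := hK.elim_finite_subcover (fun x : K => (β x).chart.dom)
    (fun x => (β x).chart.isOpen_dom) fun x hx => Set.mem_iUnion.2 ⟨⟨x, hx⟩, hβx ⟨x, hx⟩⟩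
  let e := t.equivFin
  let b : Fin t.card → Box φ := fun i => β (e.symm i)
  obtain ⟨ρ, h1, h2, h3, h4⟩ := exists_continuous_sum_one_of_isOpen_isCompact
    (s := fun i => (b i).chart.dom) (fun i => (b i).chart.isOpen_dom) hK fun x hx => by
      obtain ⟨y, hy, hxy⟩ := Set.mem_iUnion₂.1 (ht hx)
      refine Set.mem_iUnion.2 ⟨e ⟨y, hy⟩, ?_⟩
      change x ∈ (β (e.symm (e ⟨y, hy⟩) : t)).chart.dom
      rw [Equiv.symm_apply_apply]
      exact hxy
  exact ⟨_, b, ρ, fun i => hβp _, h1, fun x hx => by simpa using h2 hx, fun i x => (h3 i x).1, h4⟩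

end Partition

end RealVar

namespace RealVar

/-! ### Fibre integration of compactly supported continuous functions. -/

section FibreIntegration

variable {X Y : RScheme} {φ : X ⟶ Y} {ωX : TopForm X ⊤} {ωY : TopForm Y ⊤} {η : RelTopForm φ}
  {f : RealPoints X → ℝ}

theorem TopForm.integrable [QuasiCompact X.hom] [Smooth X.hom] (ωX : TopForm X ⊤) (hf : Continuous f) (hc : HasCompactSupport f) :
    Integrable f ωX.measure := by
  have := secondCountable_realPoints X
  have := ωX.isLocallyFiniteMeasure
  exact hf.integrable_of_hasCompactSupport hc

theorem RelTopForm.integrable [QuasiCompact X.hom] [Smooth X.hom] [IsSeparated Y.hom] [Smooth Y.hom]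
    [Smooth φ.left] (η : RelTopForm φ) (hf : Continuous f) (hc : HasCompactSupport f)
    (y : RealPoints Y) : Integrable f (η.fibreMeasure y) := by
  have := secondCountable_realPoints X
  have := η.isLocallyFiniteMeasure y
  exact hf.integrable_of_hasCompactSupport hc

theorem hasCompactSupport_fibreIntegral [QuasiCompact X.hom] [Smooth X.hom] [IsSeparated Y.hom]
    (η : RelTopForm φ) (hc : HasCompactSupport f) :
    HasCompactSupport fun y => ∫ x, f x ∂η.fibreMeasure y := by
  have := secondCountable_realPoints X
  have := t2_realPoints Y
  refine HasCompactSupport.intro (hc.isCompact.image (continuous_realMap φ)) fun y hy => ?_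
  refine η.integral_eq_zero fun x hx => ?_
  by_contra hne
  exact hy ⟨x, subset_tsupport _ hne, hx⟩

theorem exists_decomposition [IsSeparated X.hom] [Smooth X.hom] [Smooth Y.hom] (φ : X ⟶ Y)
    [Smooth φ.left] (hf : Continuous f) (hc : HasCompactSupport f) :
    ∃ (n : ℕ) (b : Fin n → Box φ) (g : Fin n → RealPoints X → ℝ), (∀ i, Continuous (g i)) ∧
      (∀ i, HasCompactSupport (g i)) ∧ (∀ i, tsupport (g i) ⊆ (b i).chart.dom) ∧
      f = fun x => ∑ i, g i x := by
  have := t2_realPoints X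
  have := locallyCompact_realPoints (X := X)
  obtain ⟨n, b, ρ, -, hρ, hsum, -, hρc⟩ := exists_box_partition (φ := φ) (p := fun _ => True)
    hc.isCompact fun x _ => by
      obtain ⟨b, -, hb⟩ := exists_box (φ := φ) (x := x) (D := ⊤) (onOpen_top ▸ trivial)
      exact ⟨b, trivial, hb⟩
  refine ⟨n, b, fun i x => ρ i x * f x, fun i => (ρ i).continuous.mul hf, fun i => (hρc i).mul_right,
    fun i => (tsupport_mul_subset_left).trans (hρ i), funext fun x => ?_⟩
  rw [← Finset.sum_mul]
  by_cases hx : x ∈ tsupport f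
  · rw [hsum x hx, one_mul]
  · rw [image_eq_zero_of_notMem_tsupport hx, mul_zero]

variable [IsSeparated X.hom] [QuasiCompact X.hom] [Smooth X.hom] [IsSeparated Y.hom]
  [Smooth Y.hom] [Smooth φ.left]

theorem continuous_fibreIntegral (hωY : ωY.NowhereVanishing) (hη : IsQuotient φ ωX ωY η)
    (hf : Continuous f) (hc : HasCompactSupport f) :
    Continuous fun y => ∫ x, f x ∂η.fibreMeasure y := by
  have := secondCountable_realPoints X
  obtain ⟨n, b, g, hg, hgc, hgb, rfl⟩ := exists_decomposition φ hf hc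
  have h : (fun y => ∫ x, ∑ i, g i x ∂η.fibreMeasure y) =
      fun y => ∑ i, ∫ x, g i x ∂η.fibreMeasure y := funext fun y =>
    integral_finsetSum _ fun i _ => η.integrable (hg i) (hgc i) y
  rw [h]
  exact continuous_finsetSum _ fun i _ =>
    (b i).continuous_fibreIntegral hωY hη (hg i) (hgc i) (hgb i)

variable [QuasiCompact Y.hom]

theorem setIntegral_fibreIntegral (hωY : ωY.NowhereVanishing) (hη : IsQuotient φ ωX ωY η)
    (hf : Continuous f) (hc : HasCompactSupport f) {A : Set (RealPoints Y)} (hA : MeasurableSet A) :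
    ∫ x in realMap φ ⁻¹' A, f x ∂ωX.measure =
      ∫ y in A, (∫ x, f x ∂η.fibreMeasure y) ∂ωY.measure := by
  have := secondCountable_realPoints X
  have := secondCountable_realPoints Y
  obtain ⟨n, b, g, hg, hgc, hgb, rfl⟩ := exists_decomposition φ hf hc
  have h : (fun y => ∫ x, ∑ i, g i x ∂η.fibreMeasure y) =
      fun y => ∑ i, ∫ x, g i x ∂η.fibreMeasure y := funext fun y =>
    integral_finsetSum _ fun i _ => η.integrable (hg i) (hgc i) y
  rw [h, integral_finsetSum _ fun i _ => (ωX.integrable (hg i) (hgc i)).integrableOn,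
    integral_finsetSum _ fun i _ => (ωY.integrable
      (continuous_fibreIntegral hωY hη (hg i) (hgc i))
      (hasCompactSupport_fibreIntegral η (hgc i))).integrableOn]
  exact Finset.sum_congr rfl fun i _ =>
    (b i).setIntegral_fibreIntegral hωY hη (hg i) (hgc i) (hgb i) hA

theorem map_withDensityᵥ (hωY : ωY.NowhereVanishing) (hη : IsQuotient φ ωX ωY η)
    (hf : Continuous f) (hc : HasCompactSupport f) :
    (ωX.measure.withDensityᵥ f).map (realMap φ) =
      ωY.measure.withDensityᵥ fun y => ∫ x, f x ∂η.fibreMeasure y := by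
  have hm := (continuous_realMap φ).measurable
  refine VectorMeasure.ext fun A hA => ?_
  rw [VectorMeasure.map_apply _ hm hA, withDensityᵥ_apply (ωX.integrable hf hc) (hm hA),
    withDensityᵥ_apply (ωY.integrable (continuous_fibreIntegral hωY hη hf hc)
      (hasCompactSupport_fibreIntegral η hc)) hA, setIntegral_fibreIntegral hωY hη hf hc hA]

end FibreIntegration

/-! ### Push-forward of measures with continuous density. -/

section ContinuousDensity

variable {X Y : RScheme}

/-- The diagonal of a separated morphism is a closed immersion, hence affine. -/
theorem IsAffineOpen.inf_of_isSeparated [IsSeparated Y.hom] {U V : Y.left.Opens} (hU : IsAffineOpen U)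
    (hV : IsAffineOpen V) : IsAffineOpen (U ⊓ V) :=
  isAffineHom_diagonal_iff.1 (inferInstance : IsAffineHom (Limits.pullback.diagonal Y.hom)) ⊤
    (isAffineOpen_top _) U le_top V le_top hU hV

theorem IsCompactlySupported.map {T T' : Type} [TopologicalSpace T] [TopologicalSpace T']
    [MeasurableSpace T] [BorelSpace T] [MeasurableSpace T'] [BorelSpace T'] {μ : Measure T}
    (h : IsCompactlySupported μ) {g : T → T'} (hg : Continuous g) :
    IsCompactlySupported (μ.map g) := by
  obtain ⟨K, hK, h⟩ := h
  refine ⟨g '' K, hK.image hg, fun S hS hd => ?_⟩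
  rw [Measure.map_apply hg.measurable hS]
  exact h _ (hg.measurable hS) (Set.disjoint_left.2 fun x hx hxK =>
    Set.disjoint_left.1 hd hx ⟨x, hxK, rfl⟩)

namespace Box

variable {φ : X ⟶ Y} (b : Box φ) {f : RealPoints X → ℝ}

/-- A form on `D` may have a measure that is not locally finite at the boundary of `D`, so
integrability is read off in the chart, where the integrand is continuous with compact support. -/
theorem integrable [SecondCountableTopology (RealPoints X)] {D : X.left.Opens} (ω : TopForm X D)
    (hD : b.P.U ≤ D) (hf : Continuous f) (hf0 : ∀ x, 0 ≤ f x)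
    (hc : HasCompactSupport f) (hfc : tsupport f ⊆ b.chart.dom) : Integrable f ω.measure := by
  refine ⟨hf.measurable.aestronglyMeasurable, ?_⟩
  rw [hasFiniteIntegral_iff_ofReal (ae_of_all _ hf0), ← setLIntegral_univ,
    ω.setLIntegral_eq (b.topChart hD) hf.measurable.ennreal_ofReal (fun x hx => ?_) MeasurableSet.univ]
  · let θ := ω.val b.P.U _ b.P.affineU hD (b.P.relativeDimension_add b.smooth b.smoothBase)
    have hi : Integrable (b.chart.density (structure_const _ _) θ f) :=
      (b.chart.continuous_density θ hf hc hfc).integrable_of_hasCompactSupport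
        (b.chart.hasCompactSupport_density θ hc hfc)
    refine lt_of_le_of_lt ?_ hi.lintegral_lt_top
    refine le_trans (le_of_eq ?_) (setLIntegral_le_lintegral b.chart.toChart.target _)
    change ∫⁻ w in b.chart.toChart.target ∩ b.chart.param ⁻¹' Set.univ, _ = _
    rw [Set.preimage_univ, Set.inter_univ]
    refine setLIntegral_congr_fun b.chart.measurableSet_target fun w hw => ?_
    simp only [Chart.density]
    rw [Set.indicator_of_mem hw, ENNReal.ofReal_mul (hf0 _)]
    rfl
  · rw [image_eq_zero_of_notMem_tsupport fun h => hx (hfc h), ENNReal.ofReal_zero]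

/-- The push-forward of `f |ω|` has a continuous density on every affine open of `Y`. -/
theorem exists_density_push [IsSeparated Y.hom] [SecondCountableTopology (RealPoints X)]
    [SecondCountableTopology (RealPoints Y)] {D : X.left.Opens} (ω : TopForm X D)
    (hD : b.P.U ≤ D) (hf : Continuous f) (hf0 : ∀ x, 0 ≤ f x)
    (hc : HasCompactSupport f) (hfc : tsupport f ⊆ b.chart.dom)
    {V : Y.left.Opens} (hV : IsAffineOpen V) (ω' : TopForm Y V) (hω' : ω'.NowhereVanishing) :
    ∃ g : RealPoints Y → ℝ≥0, Measurable g ∧ ContinuousOn g (onOpen Y V) ∧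
      ∀ A, MeasurableSet A → (ω.measure.withDensity fun x => ENNReal.ofReal (f x))
        (realMap φ ⁻¹' (A ∩ onOpen Y V)) = ∫⁻ y in A, g y ∂ω'.measure := by
  have := t2_realPoints Y
  have hfi := b.integrable ω hD hf hf0 hc hfc
  -- The reference form `ω'` lives on `V`, unrelated to the base of the box. On the affine
  -- intersection the base chart restricts to a chart for `ω'`.
  let W : Y.left.Opens := b.P.V ⊓ V
  have hW : IsAffineOpen W := IsAffineOpen.inf_of_isSeparated b.P.affineV hV
  have hWm := isStandardSmooth_res b.P.affineV hW inf_le_left b.smoothBase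
  let c : TopChart V := ⟨W, b.m, hW, inf_le_right, hWm, b.base.restr b.P.affineV inf_le_left⟩
  let θ := ω.val b.P.U _ b.P.affineU hD (b.P.relativeDimension_add b.smooth b.smoothBase)
  have hct : ∀ t, t ∈ c.chart.toChart.target ↔ t ∈ b.T ∧ b.base.param t ∈ onOpen Y V := fun t => by
    refine (b.base.mem_restr_target b.P.affineV inf_le_left).trans ?_
    rw [onOpen_inf, b.base_target_eq]
    constructor
    · exact fun h => ⟨h.1, h.2.2⟩
    · exact fun h => ⟨h.1, b.base.param_mem (b.base_target_eq ▸ h.1), h.2⟩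
  have hcd : c.chart.dom = b.base.dom ∩ onOpen Y V := by
    ext y
    rw [Set.mem_inter_iff, c.chart.mem_dom, b.base.mem_dom]
    constructor
    · rintro ⟨t, ht, rfl⟩
      exact ⟨⟨t, b.base_target_eq ▸ ((hct t).1 ht).1, rfl⟩, ((hct t).1 ht).2⟩
    · rintro ⟨⟨t, ht, rfl⟩, hy⟩
      exact ⟨t, (hct t).2 ⟨b.base_target_eq ▸ ht, hy⟩, rfl⟩
  have hγ0 : ∀ t ∈ c.chart.toChart.target, ω'.coeff c t ≠ 0 := fun t ht =>
    c.chart.coeff_ne_zero _ (hω' W b.m hW inf_le_right hWm) ht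
  -- The push-forward has density `b.push θ f` in the coordinates and `|ω'|` has density `|ω'.coeff
  -- c|`; `g₀` is their quotient, extended by zero.
  let g₀ : RealPoints Y → ℝ := c.chart.dom.indicator fun y =>
    b.push θ f (c.chart.coord y) / |ω'.coeff c (c.chart.coord y)|
  have hg₀ : ContinuousOn g₀ c.chart.dom := by
    have h1 : ContinuousOn (fun t => b.push θ f t / |ω'.coeff c t|) c.chart.toChart.target :=
      (b.continuous_push θ hf hc hfc).continuousOn.div
        (continuous_abs.comp_continuousOn (c.chart.continuousOn_coeff _))
        fun t ht => abs_ne_zero.2 (hγ0 t ht)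
    refine (h1.comp c.chart.continuousOn_coord fun y hy => c.chart.coord_mem hy).congr fun y hy => ?_
    exact Set.indicator_of_mem hy _
  have hg₀m : Measurable g₀ := by
    have hd := c.chart.isOpen_dom.measurableSet
    refine measurable_of_restrict_of_restrict_compl hd ?_ ?_
    · exact (continuousOn_iff_continuous_domRestrict.1 hg₀).measurable
    · have : (c.chart.domᶜ).domRestrict g₀ = fun _ => 0 :=
        funext fun y => by
          rw [Set.domRestrict_apply]
          exact Set.indicator_of_notMem y.2 _
      rw [this]
      exact measurable_const
  -- A point of `V(ℝ)` outside the chart is not in the compact image of the support of `f`, and `g₀`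
  -- is zero near it.
  have hg₀V : ContinuousOn g₀ (onOpen Y V) := by
    have hK : IsCompact (realMap φ '' tsupport f) := hc.isCompact.image (continuous_realMap φ)
    intro y hy
    by_cases hyK : y ∈ realMap φ '' tsupport f
    · obtain ⟨x, hx, rfl⟩ := hyK
      have hyd : realMap φ x ∈ c.chart.dom := hcd ▸ ⟨b.realMap_mem_dom (hfc hx), hy⟩
      exact (hg₀.continuousAt (c.chart.isOpen_dom.mem_nhds hyd)).continuousWithinAt
    · have h0 : g₀ =ᶠ[𝓝 y] fun _ => 0 := by
        filter_upwards [hK.isClosed.isOpen_compl.mem_nhds hyK] with z hz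
        refine Set.indicator_apply_eq_zero.2 fun hzd => ?_
        rw [b.push_eq_zero, zero_div]
        intro x hx
        by_contra hne
        refine hz ⟨x, subset_tsupport _ hne, ?_⟩
        rw [show realMap φ x = _ from hx]
        exact c.chart.param_coord hzd
      exact (continuousAt_const.congr h0.symm).continuousWithinAt
  refine ⟨fun y => (g₀ y).toNNReal, hg₀m.real_toNNReal,
    continuous_real_toNNReal.comp_continuousOn hg₀V, fun A hA => ?_⟩
  have hAV : MeasurableSet (A ∩ onOpen Y V) := hA.inter (isOpen_onOpen V).measurableSet
  have hAV' := (continuous_realMap φ).measurable hAV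
  have hTm : MeasurableSet (b.T ∩ b.base.param ⁻¹' (A ∩ onOpen Y V)) :=
    b.base_target_eq ▸ b.base.measurableSet_inter_preimage hAV
  -- All integrands are nonnegative and integrable, so the identity of real integrals transfers to
  -- lower integrals.
  rw [withDensity_apply _ hAV', ← ofReal_integral_eq_lintegral_ofReal hfi.integrableOn
      (ae_of_all _ hf0), b.setIntegral_preimage ω hD hf hc hfc hAV,
    ofReal_integral_eq_lintegral_ofReal
      ((b.integrableOn_push θ hf hc hfc).mono_set Set.inter_subset_left)
      (ae_of_all _ fun t => b.push_nonneg θ hf0 t),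
    ω'.setLIntegral_eq c hg₀m.real_toNNReal.coe_nnreal_ennreal (fun y hy => ?_) hA]
  · have hset : b.T ∩ b.base.param ⁻¹' (A ∩ onOpen Y V) =
        c.chart.toChart.target ∩ c.chart.param ⁻¹' A := by
      ext t
      simp only [Set.mem_inter_iff, Set.mem_preimage, hct]
      change _ ↔ _ ∧ b.base.param t ∈ A
      tauto
    rw [hset]
    refine setLIntegral_congr_fun (hset ▸ hTm) fun t ht => ?_
    have h1 : g₀ (c.chart.param t) = b.push θ f t / |ω'.coeff c t| := by
      simp only [g₀]
      rw [Set.indicator_of_mem (c.chart.param_mem_dom ht.1), c.chart.coord_param ht.1]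
    change _ = ENNReal.ofReal (g₀ (c.chart.param t)) * _
    rw [h1, ← ENNReal.ofReal_mul (div_nonneg (b.push_nonneg θ hf0 t) (abs_nonneg _)),
      div_mul_cancel₀ _ (abs_ne_zero.2 (hγ0 t ht.1))]
  · simp only [g₀, Set.indicator_of_notMem hy, Real.toNNReal_zero, ENNReal.coe_zero]

end Box

variable [IsSeparated X.hom] [QuasiCompact X.hom] [Smooth X.hom]
  [IsSeparated Y.hom] [QuasiCompact Y.hom] [Smooth Y.hom]

/-- A partition of unity on the compact set that carries `μ` writes `μ` as a finite sum of measures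
`fᵢ |ωᵢ|` supported in boxes. On one affine neighbourhood of a given point of `Y(ℝ)`, with one
reference form, the densities of the push-forwards add up. -/
theorem HasContinuousDensity.map (φ : X ⟶ Y) [Smooth φ.left] {μ : Measure (RealPoints X)}
    (hμ : HasContinuousDensity X μ) (hc : IsCompactlySupported μ) :
    HasContinuousDensity Y (μ.map (realMap φ)) := by
  have := t2_realPoints X
  have := locallyCompact_realPoints (X := X)
  have := secondCountable_realPoints X
  have := secondCountable_realPoints Y
  obtain ⟨K, hK, hKμ⟩ := hc
  obtain ⟨n, b, ρ, hb, hρ, hsum, hρ0, hρc⟩ := exists_box_partition (φ := φ)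
    (p := fun b => ∃ (D : X.left.Opens) (ω : TopForm X D) (g : RealPoints X → ℝ≥0), b.P.U ≤ D ∧
      ContinuousOn g (onOpen X D) ∧
      μ.restrict (onOpen X D) = ω.measure.withDensity fun x => (g x : ℝ≥0∞)) hK fun x _ => by
    obtain ⟨D, hxD, ω, -, g, hg, hμg⟩ := hμ x
    obtain ⟨b, hbD, hxb⟩ := exists_box (φ := φ) hxD
    exact ⟨b, ⟨D, ω, g, hbD, hg, hμg⟩, hxb⟩
  choose D ω g hbD hg hμg using hb
  have hρD : ∀ i, tsupport (ρ i) ⊆ onOpen X (D i) := fun i =>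
    (hρ i).trans ((b i).chart.dom_subset_onOpen.trans (onOpen_mono (hbD i)))
  let f : Fin n → RealPoints X → ℝ := fun i x => ρ i x * g i x
  have hf : ∀ i, Continuous (f i) := fun i => by
    refine continuous_of_eq_zero_off (isClosed_tsupport (ρ i)) (isOpen_onOpen (D i)) (hρD i) ?_ ?_
    · exact (ρ i).continuous.continuousOn.mul (NNReal.continuous_coe.comp_continuousOn (hg i))
    · intro x hx
      simp only [f, image_eq_zero_of_notMem_tsupport hx, zero_mul]
  have hf0 : ∀ i x, 0 ≤ f i x := fun i x => mul_nonneg (hρ0 i x) (NNReal.coe_nonneg _)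
  have hfc : ∀ i, HasCompactSupport (f i) := fun i => (hρc i).mul_right
  have hfb : ∀ i, tsupport (f i) ⊆ (b i).chart.dom := fun i =>
    tsupport_mul_subset_left.trans (hρ i)
  -- The support of `ρ i` lies in `D i`, so only the restriction of `μ` to the real points of `D i`
  -- matters, and this is `g i` times the measure of `ω i`.
  have hpart : ∀ i, μ.withDensity (fun x => ENNReal.ofReal (ρ i x)) =
      (ω i).measure.withDensity fun x => ENNReal.ofReal (f i x) := fun i => by
    have hDm := (isOpen_onOpen (D i)).measurableSet
    have h1 : (onOpen X (D i)).indicator (fun x => ENNReal.ofReal (ρ i x)) =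
        fun x => ENNReal.ofReal (ρ i x) := by
      refine Set.indicator_eq_self.2 fun x hx => hρD i (subset_tsupport _ fun h0 => hx ?_)
      simp only [h0, ENNReal.ofReal_zero]
    have h2 : (ω i).measure.restrict (onOpen X (D i)) = (ω i).measure :=
      Measure.restrict_eq_self_of_ae_mem
        (measure_mono_null (fun _ h => h) ((ω i).measure_eq_zero disjoint_compl_left))
    have hgm : AEMeasurable (fun x => (g i x : ℝ≥0∞)) (ω i).measure := by
      rw [← h2]
      exact ((hg i).aemeasurable hDm).coe_nnreal_ennreal
    have hρm : Measurable fun x => ENNReal.ofReal (ρ i x) :=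
      (ρ i).continuous.measurable.ennreal_ofReal
    rw [← h1, withDensity_indicator hDm, hμg i, ← withDensity_mul₀ hgm hρm.aemeasurable]
    congr 1
    funext x
    rw [Pi.mul_apply, mul_comm, ENNReal.ofReal_mul (hρ0 i x), ENNReal.ofReal_coe_nnreal]
  -- Almost every point for `μ` lies in `K`, where the `ρ i` sum to `1`.
  have hμsum : ∀ S, MeasurableSet S →
      μ S = ∑ i, ((ω i).measure.withDensity fun x => ENNReal.ofReal (f i x)) S := fun S hS => by
    have h0 : ∀ᵐ x ∂μ, x ∈ K :=
      hKμ Kᶜ hK.isClosed.measurableSet.compl disjoint_compl_left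
    simp only [← hpart, withDensity_apply _ hS]
    rw [← lintegral_finsetSum _ fun i _ => (ρ i).continuous.measurable.ennreal_ofReal,
      ← setLIntegral_one]
    refine lintegral_congr_ae (ae_restrict_of_ae ?_)
    filter_upwards [h0] with x hx
    rw [← ENNReal.ofReal_sum_of_nonneg fun i _ => hρ0 i x, hsum x hx, ENNReal.ofReal_one]
  intro y
  obtain ⟨V, hV, hyV, -, m, hm⟩ := exists_standardSmooth_mem (x := y) (D := ⊤)
    (onOpen_top ▸ trivial)
  obtain ⟨ω', hω'⟩ := TopForm.exists_nowhereVanishing hV hm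
  choose h hhm hhc hhA using fun i => (b i).exists_density_push (ω i) (hbD i) (hf i) (hf0 i) (hfc i)
    (hfb i) hV ω' hω'
  refine ⟨V, hyV, ω', hω', fun y => ∑ i, h i y, continuousOn_finsetSum _ fun i _ => hhc i, ?_⟩
  refine Measure.ext fun A hA => ?_
  have hAV : MeasurableSet (A ∩ onOpen Y V) := hA.inter (isOpen_onOpen V).measurableSet
  have hm := (continuous_realMap φ).measurable
  rw [Measure.restrict_apply hA, Measure.map_apply hm hAV, hμsum _ (hm hAV), withDensity_apply _ hA]
  simp only [ENNReal.ofNNReal_finsetSum]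
  rw [lintegral_finsetSum _ fun i _ => (hhm i).coe_nnreal_ennreal]
  exact Finset.sum_congr rfl fun i _ => hhA i A hA

end ContinuousDensity

end RealVar

/-! ### The theorem. -/

theorem mainTheorem10 (X Y : RealVar.RScheme)
    [IsSeparated X.hom] [QuasiCompact X.hom] [Smooth X.hom]
    [IsSeparated Y.hom] [QuasiCompact Y.hom] [Smooth Y.hom]
    (φ : X ⟶ Y) [Smooth φ.left] :
    (∀ μ : Measure (RealVar.RealPoints X),
      RealVar.HasContinuousDensity X μ → RealVar.IsCompactlySupported μ →
        RealVar.HasContinuousDensity Y (μ.map (RealVar.realMap φ)) ∧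
        RealVar.IsCompactlySupported (μ.map (RealVar.realMap φ))) ∧
    (∀ (ωX : RealVar.TopForm X ⊤) (ωY : RealVar.TopForm Y ⊤), ωY.NowhereVanishing →
      (∃! η : RealVar.RelTopForm φ, RealVar.IsQuotient φ ωX ωY η) ∧
      ∀ η : RealVar.RelTopForm φ, RealVar.IsQuotient φ ωX ωY η →
        ∀ f : RealVar.RealPoints X → ℝ, Continuous f → HasCompactSupport f →
          Integrable f ωX.measure ∧
          (∀ y, Integrable f (η.fibreMeasure y)) ∧
          Continuous (fun y => ∫ x, f x ∂(η.fibreMeasure y)) ∧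
          Integrable (fun y => ∫ x, f x ∂(η.fibreMeasure y)) ωY.measure ∧
          VectorMeasure.AbsolutelyContinuous
            ((ωX.measure.withDensityᵥ f).map (RealVar.realMap φ))
            ωY.measure.toENNRealVectorMeasure ∧
          (ωX.measure.withDensityᵥ f).map (RealVar.realMap φ) =
            ωY.measure.withDensityᵥ (fun y => ∫ x, f x ∂(η.fibreMeasure y))) := by
  refine ⟨fun μ hμ hc => ⟨hμ.map φ hc, hc.map (RealVar.continuous_realMap φ)⟩,
    fun ωX ωY hωY => ⟨?_, fun η hη f hf hc => ?_⟩⟩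
  · obtain ⟨η, hη⟩ := RealVar.exists_isQuotient (φ := φ) ωX ωY hωY
    exact ⟨η, hη, fun η' hη' => RealVar.isQuotient_unique ωX ωY hωY hη' hη⟩
  · have hI := ωY.integrable (RealVar.continuous_fibreIntegral hωY hη hf hc)
      (RealVar.hasCompactSupport_fibreIntegral η hc)
    have hmap := RealVar.map_withDensityᵥ hωY hη hf hc
    refine ⟨ωX.integrable hf hc, η.integrable hf hc, RealVar.continuous_fibreIntegral hωY hη hf hc,
      hI, ?_, hmap⟩
    rw [hmap]
    refine VectorMeasure.AbsolutelyContinuous.mk fun A hA h0 => ?_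
    rw [Measure.toENNRealVectorMeasure_apply_measurable hA] at h0
    rw [withDensityᵥ_apply hI hA, Measure.restrict_eq_zero.2 h0, integral_zero_measure]

end
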